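/- **Theorem (Nöther's theorem for Colombeau generalized functions).** *Setting.* Let $\Omega\subseteq\mathbb R^p$ be open and let $L\in\mathcal G_\tau((\bar\Omega\times\mathbb R^q)^{(n)})$, where $(\bar\Omega\times\mathbb R^q)^{(n)}$ is the space of $n$-jets $(x,u^{(n)})=(x,(u^\alpha_J)_{1\le\alpha\le q,\ 0\le|J|\le n})$ with $x\in\bar\Omega$ (functions smooth up to $\partial\Omega$ being restrictions of smooth functions). Generalized functions are classes of nets $(u_\varepsilon)_{\varepsilon\in(0,1]}$ of smooth functions, moderate nets modulo negligible nets. In $\mathcal G(U)$ all derivatives are $O(\varepsilon^{-N})$ for some $N$ (negligible: $O(\varepsilon^m)$ for all $m$) uniformly on compact subsets of $U$. In $\mathcal G_\tau(A)$ the suprema over $z\in A$ are taken with a weight $(1+|z|)^{-N}$ (negligible: with a weight $(1+|z|)^{-l}$, $l$ independent of $m$). In the mixed algebra $\tilde{\mathcal G}_\tau(U\times\mathbb R^d)$ the suprema are over $K\times\mathbb R^d$, $K\subset U$ compact, with weights $(1+|y|)^{-N}$, resp. $(1+|y|)^{-l}$, in the second variable $y$ only. Let $\Phi=(\eta,(x,u))\mapsto(\Xi_\eta(x),\Psi_\eta(x,u))\in\tilde{\mathcal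 G}_\tau(\mathbb R\times\mathbb R^{p+q})^{p+q}$ be a projectable generalized group action: $\Phi_0=\mathrm{id}$ in $\mathcal G_\tau(\mathbb R^{p+q})^{p+q}$ and $\Phi_{\eta_1+\eta_2}=\Phi_{\eta_1}\circ\Phi_{\eta_2}$ in $\tilde{\mathcal G}_\tau(\mathbb R^2\times\mathbb R^{p+q})^{p+q}$. Let it be strictly $\mathcal G$-complete with infinitesimal generator $$\mathbf v=\sum_{i=1}^p\xi^i(x)\,\partial_{x^i}+\sum_{\alpha=1}^q\psi_\alpha(x,u)\,\partial_{u^\alpha},$$ with coefficients in $\mathcal G_\tau$; that is, $\Phi$ is the unique generalized group action with $\frac{d}{d\eta}\Phi=\mathbf v(\Phi)$ in $\tilde{\mathcal G}_\tau(\mathbb R\times\mathbb R^{p+q})^{p+q}$, and there are representatives such that $\Phi_\varepsilon$ is the flow of $\mathbf v_\varepsilon$ for each $\varepsilon\in(0,1]$. Assume that $\Phi$ is a variational symmetry group of $\int_\Omega L(x,u^{(n)})\,dx$, that is: for some $\eta_0>0$, $\Xi$ restricts to a c-bounded generalized function from $(-\eta_0,\eta_0)\times\Omega$ to $\Omega$;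 and for all open sets $\Omega_1,U$ with $\bar\Omega_1$ compact and $\bar\Omega_1\subset U\subseteq\Omega$, all $f\in\mathcal G(U)^q$, and all $\eta_1>0$ such that $\Xi_{\varepsilon,\eta}(\bar\Omega_1)$ stays in a fixed compact subset of $\Omega$ for $|\eta|<\eta_1$ and $\varepsilon$ small, $$\int_{\Omega_1}L\big(\Xi_\eta(x),\mathrm{pr}^{(n)}f'_\eta(\Xi_\eta(x))\big)\det D\Xi_\eta(x)\,dx=\int_{\Omega_1}L(x,\mathrm{pr}^{(n)}f(x))\,dx\quad\text{in }\mathcal G((-\eta_1,\eta_1)),$$ where $f'_\eta(x')=\Psi_\eta(\Xi_{-\eta}(x'),f(\Xi_{-\eta}(x')))$. Let $D_i$ denote the total derivatives, $\mathrm{Div}\,P=\sum_iD_iP_i$, let $Q_\alpha=\psi_\alpha-\sum_i\xi^iu^\alpha_i$ be the characteristic of $\mathbf v$, and let $E_\alpha(L)=\sum_{0\le|J|\le n}(-D)_J\,\partial L/\partial u^\alpha_J$ (sum over unordered multi-indices). *Conclusion.* There is a $p$-tuple $P$ of elements of $\mathcal G_\tau((\bar\Omega\times\mathbb R^q)^{(2n)})$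 such that $$\mathrm{Div}\,P=Q\cdot E(L)=\sum_{\alpha=1}^qQ_\alpha E_\alpha(L)$$ as functions on the $(2n+1)$-jets over $\Omega$, in the algebra $\tilde{\mathcal G}_\tau$ with local estimates in $x\in\Omega$ and tempered estimates in the jet variables $u^{(2n+1)}$. Consequently $Q\cdot E(L)$ is a conservation law for the Euler–Lagrange equations: for every open $U\subseteq\Omega$ and every $f\in\mathcal G(U)^q$ with $E_\alpha(L)(x,\mathrm{pr} f(x))=0$ in $\mathcal G(U)$ for all $\alpha$, one has $(\mathrm{Div}\,P)(x,\mathrm{pr} f(x))=0$ in $\mathcal G(U)$. -/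

import Mathlib

open Set Filter Topology MeasureTheory
open scoped ContDiff

noncomputable section

namespace Colombeau

/-! ## Algebras of generalized functions

A generalized function is the class `[(u_ε)_ε]` of a moderate net modulo negligible nets.  It is
handled through its representatives, which are families `u : ℝ → E → F` of which only the members
`u ε` with `ε ∈ (0, 1]` matter; equality in the algebra means that the difference is negligible.
The bounds on all `∂^α u_ε` with `|α| = k` are bounds on the norm of the `k`-th derivative. -/

section Nets

variable {E F : Type*} [NormedAddCommGroup E] [NormedSpace ℝ E]
  [NormedAddCommGroup F] [NormedSpace ℝ F]

/-- For all `K ∈ S` and all orders `k` there is `N` with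
`sup_{x ∈ K} (1 + w x)^{-N} |∂^k u_ε(x)| = O(ε^{-N})` as `ε → 0`. -/
def ModerateBounds (S : Set (Set E)) (w : E → ℝ) (u : ℝ → E → F) : Prop :=
  ∀ K ∈ S, ∀ k : ℕ, ∃ N : ℕ, ∃ C : ℝ, ∀ᶠ ε : ℝ in 𝓝[>] 0, ∀ x ∈ K,
    ‖iteratedFDeriv ℝ k (u ε) x‖ ≤ C * ε ^ (-(N : ℤ)) * (1 + w x) ^ N

/-- For all `K ∈ S` and all orders `k` there is `l` such that for all `m`
`sup_{x ∈ K} (1 + w x)^{-l} |∂^k u_ε(x)| = O(ε^m)` as `ε → 0`. -/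
def NegligibleBounds (S : Set (Set E)) (w : E → ℝ) (u : ℝ → E → F) : Prop :=
  ∀ K ∈ S, ∀ k : ℕ, ∃ l : ℕ, ∀ m : ℕ, ∃ C : ℝ, ∀ᶠ ε : ℝ in 𝓝[>] 0, ∀ x ∈ K,
    ‖iteratedFDeriv ℝ k (u ε) x‖ ≤ C * ε ^ m * (1 + w x) ^ l

/-- The compact subsets of `U`. -/
def compactsIn (U : Set E) : Set (Set E) := {K | IsCompact K ∧ K ⊆ U}

/-- `(u_ε)` represents an element of `𝒢(U)`, `U` open. -/
def MemG (U : Set E) (u : ℝ → E → F) : Prop :=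
  (∀ ε ∈ Ioc (0 : ℝ) 1, ContDiffOn ℝ ∞ (u ε) U) ∧ ModerateBounds (compactsIn U) (fun _ => 0) u

/-- `u = v` in `𝒢(U)`. -/
def EqG (U : Set E) (u v : ℝ → E → F) : Prop :=
  NegligibleBounds (compactsIn U) (fun _ => 0) (fun ε x => u ε x - v ε x)

/-- `(u_ε)` represents an element of `𝒢_τ(A)`, where `A` is the whole space or the closure of an
open set; a function smooth on such a closure is given by a smooth extension to the whole space,
and the bounds are imposed on `A` only. -/
def MemGTau (A : Set E) (u : ℝ → E → F) : Prop :=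
  (∀ ε ∈ Ioc (0 : ℝ) 1, ContDiff ℝ ∞ (u ε)) ∧ ModerateBounds {A} (fun x => ‖x‖) u

/-- `u = v` in `𝒢_τ(A)`. -/
def EqGTau (A : Set E) (u v : ℝ → E → F) : Prop :=
  NegligibleBounds {A} (fun x => ‖x‖) (fun ε x => u ε x - v ε x)

/-- `(u_ε)` represents an element of `𝒢[A, B]`, the c-bounded generalized functions from `A` to `B`
(`A`, `B` open): the class of `(u_ε)` in `𝒢(A)` has a representative with values in `B` such that
for each compact `K ⊆ A` there is a compact `K' ⊆ B` with `v_ε(K) ⊆ K'` for small `ε`. -/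
def MemCBounded (A : Set E) (B : Set F) (u : ℝ → E → F) : Prop :=
  ∃ v : ℝ → E → F, MemG A v ∧ EqG A u v ∧ (∀ ε ∈ Ioc (0 : ℝ) 1, MapsTo (v ε) A B) ∧
    ∀ K ∈ compactsIn A, ∃ K' ∈ compactsIn B, ∀ᶠ ε : ℝ in 𝓝[>] 0, MapsTo (v ε) K K'

end Nets

section MixedNets

variable {E Y F : Type*} [NormedAddCommGroup E] [NormedSpace ℝ E]
  [NormedAddCommGroup Y] [NormedSpace ℝ Y] [NormedAddCommGroup F] [NormedSpace ℝ F]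

/-- The sets `K × Y` with `K ⊆ U` compact. -/
def slabsIn (U : Set E) (Y : Type*) : Set (Set (E × Y)) :=
  {S | ∃ K ∈ compactsIn U, S = K ×ˢ (univ : Set Y)}

/-- `(u_ε)` represents an element of the mixed algebra `𝒢̃_τ(U × Y)`, `U` open: local estimates in
the `U`-variable and tempered estimates in the `Y`-variable. -/
def MemGMixed (U : Set E) (u : ℝ → E × Y → F) : Prop :=
  (∀ ε ∈ Ioc (0 : ℝ) 1, ContDiffOn ℝ ∞ (u ε) (U ×ˢ univ)) ∧
    ModerateBounds (slabsIn U Y) (fun z => ‖z.2‖) u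

/-- `u = v` in `𝒢̃_τ(U × Y)`. -/
def EqGMixed (U : Set E) (u v : ℝ → E × Y → F) : Prop :=
  NegligibleBounds (slabsIn U Y) (fun z => ‖z.2‖) (fun ε z => u ε z - v ε z)

end MixedNets

/-! ## Generalized one-parameter group actions and their generators -/

section Actions

variable {V : Type*} [NormedAddCommGroup V] [NormedSpace ℝ V]

/-- `Φ ∈ 𝒢̃_τ(ℝ × V)` with `Φ(0, ·) = id` in `𝒢_τ(V)` and
`Φ(η₁ + η₂, ·) = Φ(η₁, Φ(η₂, ·))` in `𝒢̃_τ(ℝ² × V)`. -/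
structure IsGroupAction (Φ : ℝ → ℝ × V → V) : Prop where
  mem : MemGMixed (univ : Set ℝ) Φ
  zero : EqGTau (univ : Set V) (fun ε y => Φ ε (0, y)) (fun _ y => y)
  add : EqGMixed (univ : Set (ℝ × ℝ)) (fun ε z => Φ ε (z.1.1 + z.1.2, z.2))
    (fun ε z => Φ ε (z.1.1, Φ ε (z.1.2, z.2)))

/-- `d/dη Φ(η, y) = v(Φ(η, y))` in `𝒢̃_τ(ℝ × V)`. -/
def SatisfiesFlow (v : ℝ → V → V) (Φ : ℝ → ℝ × V → V) : Prop :=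
  EqGMixed (univ : Set ℝ) (fun ε z => deriv (fun t => Φ ε (t, z.2)) z.1) (fun ε z => v ε (Φ ε z))

/-- `Φ` is `𝒢`-complete with infinitesimal generator `v`: it is the unique generalized group action
that is a flow of `v`. -/
structure IsGComplete (v : ℝ → V → V) (Φ : ℝ → ℝ × V → V) : Prop where
  generator_mem : MemGTau (univ : Set V) v
  action : IsGroupAction Φ
  flow : SatisfiesFlow v Φ
  unique : ∀ Φ' : ℝ → ℝ × V → V, IsGroupAction Φ' → SatisfiesFlow v Φ' →
    EqGMixed (univ : Set ℝ) Φ' Φ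

/-- `Φ` is strictly `𝒢`-complete with infinitesimal generator `v`: in addition there are
representatives such that `Φ_ε` is the flow of `v_ε` for each `ε ∈ (0, 1]`. -/
structure IsStrictlyGComplete (v : ℝ → V → V) (Φ : ℝ → ℝ × V → V) : Prop
    extends IsGComplete v Φ where
  strict : ∃ (v' : ℝ → V → V) (Φ' : ℝ → ℝ × V → V),
    MemGTau (univ : Set V) v' ∧ EqGTau (univ : Set V) v' v ∧
    MemGMixed (univ : Set ℝ) Φ' ∧ EqGMixed (univ : Set ℝ) Φ' Φ ∧
    ∀ ε ∈ Ioc (0 : ℝ) 1, ∀ y : V, Φ' ε (0, y) = y ∧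
      ∀ η : ℝ, HasDerivAt (fun t => Φ' ε (t, y)) (v' ε (Φ' ε (η, y))) η

end Actions

/-! ## Jets, total derivatives and the Euler operator -/

/-- Multi-indices in `p` variables of length at most `n`. -/
abbrev MultiIndex (p n : ℕ) : Type := {J : Fin p → ℕ // ∑ i, J i ≤ n}

instance (p n : ℕ) : Finite (MultiIndex p n) := by
  refine Finite.of_injective (β := Fin p → Fin (n + 1))
    (fun J i => ⟨J.1 i, Nat.lt_succ_of_le
      ((Finset.single_le_sum (fun j _ => Nat.zero_le (J.1 j)) (Finset.mem_univ i)).trans J.2)⟩) ?_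
  intro J K h
  ext i
  simpa using congrArg Fin.val (congrFun h i)

instance (p n : ℕ) : Fintype (MultiIndex p n) := Fintype.ofFinite _

/-- The jet space `(ℝ^p × ℝ^q)^(n)`: points `(x, u^(n))` with coordinates `u^α_J`, `|J| ≤ n`. -/
abbrev Jet (p q n : ℕ) : Type := (Fin p → ℝ) × (Fin q → MultiIndex p n → ℝ)

/-- Jets of unrestricted order. -/
abbrev JetInf (p q : ℕ) : Type := (Fin p → ℝ) × (Fin q → (Fin p → ℕ) → ℝ)

variable {p q : ℕ}

/-- The projection onto the jets of order `n`.  A function `F` on `Jet p q n` is regarded as the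
function `F ∘ truncate n` of all jet coordinates. -/
def truncate (n : ℕ) (z : JetInf p q) : Jet p q n := (z.1, fun α J => z.2 α J.1)

/-- The jet of unrestricted order with all coordinates of order above `n` equal to zero. -/
def extend {n : ℕ} (z : Jet p q n) : JetInf p q :=
  (z.1, fun α J => if h : ∑ i, J i ≤ n then z.2 α ⟨J, h⟩ else 0)

/-- `T^J = T_1^{J_1} ⋯ T_p^{J_p}` for operators `T_1, …, T_p`. -/
def opPow {A : Type*} (T : Fin p → A → A) (J : Fin p → ℕ) : A → A :=
  (List.finRange p).foldr (fun i S => (T i)^[J i] ∘ S) id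

/-- The partial derivative `∂/∂x^i` of a function of `x`. -/
def partialX (i : Fin p) (g : (Fin p → ℝ) → ℝ) : (Fin p → ℝ) → ℝ :=
  fun x => fderiv ℝ g x (Pi.single i 1)

/-- The prolongation `pr f` of `f : ℝ^p → ℝ^q` with components `u^α_J = ∂^J f^α(x)`. -/
def prolong (f : (Fin p → ℝ) → (Fin q → ℝ)) (x : Fin p → ℝ) : JetInf p q :=
  (x, fun α J => opPow partialX J (fun y => f y α) x)

/-- The partial derivative `∂/∂u^α_J` of a function of the jet variables. -/
def partialU (α : Fin q) (J : Fin p → ℕ) (F : JetInf p q → ℝ) : JetInf p q → ℝ :=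
  fun z => lineDeriv ℝ F z (0, Pi.single α (Pi.single J 1))

/-- The total derivative `D_i = ∂/∂x^i + ∑_{α, J} u^α_{J,i} ∂/∂u^α_J`, that is, the derivative in
the direction with `x`-component `e_i` and `u^α_J`-components `u^α_{J,i}`. -/
def totalD (i : Fin p) (F : JetInf p q → ℝ) : JetInf p q → ℝ :=
  fun z => lineDeriv ℝ F z (Pi.single i 1, fun α J => z.2 α (J + Pi.single i 1))

/-- The total divergence `Div P = ∑_i D_i P_i`. -/
def totalDiv (P : Fin p → JetInf p q → ℝ) : JetInf p q → ℝ :=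
  fun z => ∑ i, totalD i (P i) z

/-- The Euler operator `E_α(L) = ∑_{|J| ≤ n} (-D)_J ∂L/∂u^α_J` for `L` of order `n`. -/
def euler {n : ℕ} (L : Jet p q n → ℝ) (α : Fin q) : JetInf p q → ℝ :=
  fun z => ∑ J : MultiIndex p n,
    (-1 : ℝ) ^ (∑ i, J.1 i) * opPow totalD J.1 (partialU α J.1 (L ∘ truncate n)) z

/-- The characteristic `Q_α = ψ_α(x, u) - ∑_i ξ^i(x) u^α_i`. -/
def characteristic (ξ : (Fin p → ℝ) → (Fin p → ℝ))
    (ψ : (Fin p → ℝ) × (Fin q → ℝ) → (Fin q → ℝ)) (α : Fin q) : JetInf p q → ℝ :=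
  fun z => ψ (z.1, fun β => z.2 β 0) α - ∑ i, ξ z.1 i * z.2 α (Pi.single i 1)

/-! ## Variational symmetry groups -/

/-- The projectable transformation `(η, (x, u)) ↦ (Ξ_η(x), Ψ_η(x, u))`. -/
def projectable (Ξ : ℝ → ℝ × (Fin p → ℝ) → (Fin p → ℝ))
    (Ψ : ℝ → ℝ × ((Fin p → ℝ) × (Fin q → ℝ)) → (Fin q → ℝ)) :
    ℝ → ℝ × ((Fin p → ℝ) × (Fin q → ℝ)) → (Fin p → ℝ) × (Fin q → ℝ) :=
  fun ε z => (Ξ ε (z.1, z.2.1), Ψ ε z)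

/-- The vector field `∑ ξ^i(x) ∂/∂x^i + ∑ ψ_α(x, u) ∂/∂u^α`. -/
def vectorField (ξ : ℝ → (Fin p → ℝ) → (Fin p → ℝ))
    (ψ : ℝ → (Fin p → ℝ) × (Fin q → ℝ) → (Fin q → ℝ)) :
    ℝ → (Fin p → ℝ) × (Fin q → ℝ) → (Fin p → ℝ) × (Fin q → ℝ) :=
  fun ε y => (ξ ε y.1, ψ ε y)

/-- The transformed function `f'(x') = Ψ_η(Ξ_{-η}(x'), f(Ξ_{-η}(x')))`, for fixed `ε`. -/
def transformed (Ξ : ℝ × (Fin p → ℝ) → (Fin p → ℝ))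
    (Ψ : ℝ × ((Fin p → ℝ) × (Fin q → ℝ)) → (Fin q → ℝ))
    (η : ℝ) (f : (Fin p → ℝ) → (Fin q → ℝ)) : (Fin p → ℝ) → (Fin q → ℝ) :=
  fun x' => Ψ (η, (Ξ (-η, x'), f (Ξ (-η, x'))))

/-- The group action with components `Ξ`, `Ψ` is a variational symmetry group of
`∫_Ω L(x, u^(n)) dx`: `Ξ` is c-bounded from `(-η₀, η₀) × Ω` into `Ω` for some `η₀ > 0`, and for
every open `Ω₁` with compact closure in an open `U ⊆ Ω` and every `f ∈ 𝒢(U)^q`,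
`∫_{Ω₁} L(Ξ_η(x), pr^(n) f'(Ξ_η(x))) det DΞ_η(x) dx = ∫_{Ω₁} L(x, pr^(n) f(x)) dx` in
`𝒢((-η₁, η₁))`, whenever `Ξ_η` maps the closure of `Ω₁` into a fixed compact subset of `Ω` for
`|η| < η₁` and small `ε`. -/
structure IsVariationalSymmetry (Ω : Set (Fin p → ℝ)) {n : ℕ} (L : ℝ → Jet p q n → ℝ)
    (Ξ : ℝ → ℝ × (Fin p → ℝ) → (Fin p → ℝ))
    (Ψ : ℝ → ℝ × ((Fin p → ℝ) × (Fin q → ℝ)) → (Fin q → ℝ)) : Prop where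
  cBounded : ∃ η₀ : ℝ, 0 < η₀ ∧ MemCBounded (Ioo (-η₀) η₀ ×ˢ Ω) Ω Ξ
  integral_eq : ∀ Ω₁ U : Set (Fin p → ℝ), IsOpen Ω₁ → IsOpen U → IsCompact (closure Ω₁) →
    closure Ω₁ ⊆ U → U ⊆ Ω → ∀ f : ℝ → (Fin p → ℝ) → (Fin q → ℝ), MemG U f →
    ∀ η₁ : ℝ, 0 < η₁ →
    (∃ K ∈ compactsIn Ω, ∀ᶠ ε : ℝ in 𝓝[>] 0, ∀ η ∈ Ioo (-η₁) η₁, ∀ x ∈ closure Ω₁, Ξ ε (η, x) ∈ K) →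
    EqG (Ioo (-η₁) η₁)
      (fun ε η => ∫ x in Ω₁,
        L ε (truncate n (prolong (transformed (Ξ ε) (Ψ ε) η (f ε)) (Ξ ε (η, x)))) *
          (fderiv ℝ (fun y => Ξ ε (η, y)) x).det)
      (fun ε _ => ∫ x in Ω₁, L ε (truncate n (prolong (f ε) x)))

end Colombeau

end

/-! Classically, differentiating the invariance of the action at `η = 0` shows that the
infinitesimal variation of `L` along `f` has zero integral over every `Ω₁`. It therefore vanishes
pointwise, and since `f` is arbitrary it vanishes as a function on jets. The variation is `∑
∂L/∂u^α_J · D_J Q_α + Div(ξ L)`, and moving the `D_J` off `Q` turns it into `Q·E(L) - Div P` with an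
explicit `P` of order `2n` (`JetNet.exists_flux`, `exists_current`, `variation_eq`). Here the same
`P_ε` is formed for each `ε`, and everything comes down to showing that the moderate net `R_ε = Div
P_ε - Q_ε·E(L_ε)` is negligible. Three points go beyond the classical argument.

The representatives satisfy `Φ_0 = id` and `∂_η Φ = v(Φ)` only up to negligible nets. The derivative
of the integrand is therefore computed for the actual representatives (`partialEta_integrand`) and
then compared with the ideal expression (`small_variation_sub`). A moderate net with negligible
values has negligible derivatives, by interpolation between orders of differentiation
(`ModNet.negNet_of_small`), so only values ever have to be compared.

Passing from integrals to values is delicate, because the integral over each fixed `Ω₁` is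
negligible with no uniformity in `Ω₁`, so sets shrinking with `ε` are not allowed. A gliding hump
overcomes this (`eventually_abs_le_of_integral_small`). If smallness fails near `x₀` along a
sequence `ε_k`, then balls of rapidly decreasing size, one for each `ε_k`, are collected into a
single open set. At `ε_k` the earlier balls contribute little by the hypothesis, the later ones by
their size, and the `k`-th ball contributes a fixed power of `ε_k`.

Passing from functions to jets uses that every finite jet is the jet of its Taylor polynomial. For
each `ε` a worst jet over `K` of size at most `ε^{-M}` is selected. The polynomials with these jets
form a tempered net, so `R_ε` is small at all such points (`eventually_abs_le_at_moderate_points`).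
For larger jets the moderate bound on `R_ε` is already a negligible one, at the price of one more
power of the weight (`negNet_of_moderate_points`).

The conservation law follows on inserting the jet of a solution: `R` remains negligible, and each
`Q_α E_α(L)` is a moderate factor times a negligible one. -/

namespace Colombeau

/-! ### Calculus of moderate and negligible growth. -/

section Growth

variable {X Y F G H : Type*} [SeminormedAddCommGroup F] [SeminormedAddCommGroup G]
  [SeminormedAddCommGroup H]

/-- `‖u_ε(x)‖ ≤ (ε⁻¹ (1 + w x))^N` on `K` for small `ε`. -/
def Bdd (K : Set X) (w : X → ℝ) (u : ℝ → X → F) : Prop :=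
  ∃ N : ℕ, ∀ᶠ ε : ℝ in 𝓝[>] 0, ∀ x ∈ K, ‖u ε x‖ ≤ (ε⁻¹ * (1 + w x)) ^ N

/-- `‖u_ε(x)‖ ≤ ε^m (1 + w x)^l` on `K` for small `ε`, with `l` independent of `m`. -/
def Small (K : Set X) (w : X → ℝ) (u : ℝ → X → F) : Prop :=
  ∃ l : ℕ, ∀ m : ℕ, ∀ᶠ ε : ℝ in 𝓝[>] 0, ∀ x ∈ K, ‖u ε x‖ ≤ ε ^ m * (1 + w x) ^ l

theorem eventually_mem_Ioo {δ : ℝ} (hδ : 0 < δ) : ∀ᶠ ε : ℝ in 𝓝[>] 0, ε ∈ Ioo 0 δ :=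
  Ioo_mem_nhdsGT hδ

theorem eventually_mem_Ioc : ∀ᶠ ε : ℝ in 𝓝[>] 0, ε ∈ Ioc (0 : ℝ) 1 :=
  Ioc_mem_nhdsGT one_pos

theorem eventually_le_inv (C : ℝ) : ∀ᶠ ε : ℝ in 𝓝[>] 0, C ≤ ε⁻¹ :=
  tendsto_inv_nhdsGT_zero.eventually_ge_atTop C

theorem eventually_mul_le_one (C : ℝ) : ∀ᶠ ε : ℝ in 𝓝[>] 0, C * ε ≤ 1 := by
  filter_upwards [eventually_le_inv C, eventually_mem_Ioc] with ε h h0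
  have := mul_le_mul_of_nonneg_right h h0.1.le
  rwa [inv_mul_cancel₀ h0.1.ne'] at this

theorem one_le_gauge {ε w : ℝ} (hε : ε ∈ Ioc (0 : ℝ) 1) (hw : 0 ≤ w) : 1 ≤ ε⁻¹ * (1 + w) :=
  one_le_mul_of_one_le_of_one_le ((one_le_inv₀ hε.1).2 hε.2) (by linarith)

variable {K : Set X} {w : X → ℝ}

theorem Bdd.of_le {u : ℝ → X → F} {v : ℝ → X → G} (hv : Bdd K w v)
    (h : ∀ᶠ ε : ℝ in 𝓝[>] 0, ∀ x ∈ K, ‖u ε x‖ ≤ ‖v ε x‖) : Bdd K w u := by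
  obtain ⟨N, hN⟩ := hv
  exact ⟨N, by filter_upwards [h, hN] with ε h1 h2 x hx using (h1 x hx).trans (h2 x hx)⟩

theorem Small.of_le {u : ℝ → X → F} {v : ℝ → X → G} (hv : Small K w v)
    (h : ∀ᶠ ε : ℝ in 𝓝[>] 0, ∀ x ∈ K, ‖u ε x‖ ≤ ‖v ε x‖) : Small K w u := by
  obtain ⟨l, hl⟩ := hv
  exact ⟨l, fun m => by
    filter_upwards [h, hl m] with ε h1 h2 x hx using (h1 x hx).trans (h2 x hx)⟩

theorem Bdd.mono {K' : Set X} {u : ℝ → X → F} (hu : Bdd K w u) (h : K' ⊆ K) : Bdd K' w u := by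
  obtain ⟨N, hN⟩ := hu
  exact ⟨N, hN.mono fun ε h2 x hx => h2 x (h hx)⟩

theorem Small.mono {K' : Set X} {u : ℝ → X → F} (hu : Small K w u) (h : K' ⊆ K) :
    Small K' w u := by
  obtain ⟨N, hN⟩ := hu
  exact ⟨N, fun m => (hN m).mono fun ε h2 x hx => h2 x (h hx)⟩

theorem Bdd.norm {u : ℝ → X → F} (hu : Bdd K w u) : Bdd K w (fun ε x => ‖u ε x‖) :=
  hu.of_le (.of_forall fun ε x _ => by simp)

theorem Small.norm {u : ℝ → X → F} (hu : Small K w u) : Small K w (fun ε x => ‖u ε x‖) :=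
  hu.of_le (.of_forall fun ε x _ => by simp)

theorem Bdd.const (hw : ∀ x, 0 ≤ w x) (c : F) : Bdd K w (fun _ _ => c) := by
  refine ⟨1, ?_⟩
  filter_upwards [eventually_le_inv ‖c‖, eventually_mem_Ioc] with ε h h0 x _
  rw [pow_one]
  have := hw x
  exact h.trans (le_mul_of_one_le_right (inv_nonneg.2 h0.1.le) (by linarith))

theorem Bdd.inv (hw : ∀ x, 0 ≤ w x) : Bdd K w (fun ε _ => ε⁻¹) := by
  refine ⟨1, ?_⟩
  filter_upwards [eventually_mem_Ioc] with ε h0 x _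
  rw [pow_one, Real.norm_of_nonneg (inv_nonneg.2 h0.1.le)]
  have := hw x
  exact le_mul_of_one_le_right (inv_nonneg.2 h0.1.le) (by linarith)

theorem Bdd.weight (hw : ∀ x, 0 ≤ w x) : Bdd K w (fun _ => w) := by
  refine ⟨1, ?_⟩
  filter_upwards [eventually_mem_Ioc] with ε h0 x _
  rw [pow_one, Real.norm_of_nonneg (hw x)]
  have := hw x
  exact (by linarith : w x ≤ 1 + w x).trans
    (le_mul_of_one_le_left (by linarith) ((one_le_inv₀ h0.1).2 h0.2))

theorem Small.zero (hw : ∀ x, 0 ≤ w x) : Small K w (fun _ _ => (0 : F)) := by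
  refine ⟨0, fun m => ?_⟩
  filter_upwards [eventually_mem_Ioc] with ε h0 x _
  have := hw x
  rw [norm_zero]
  exact mul_nonneg (pow_nonneg h0.1.le _) (by positivity)

/-- A net dominated by the product of two bounded nets is bounded. -/
theorem Bdd.of_le_mul (hw : ∀ x, 0 ≤ w x) {u : ℝ → X → F} {v : ℝ → X → G} {z : ℝ → X → H}
    (hu : Bdd K w u) (hv : Bdd K w v)
    (h : ∀ᶠ ε : ℝ in 𝓝[>] 0, ∀ x ∈ K, ‖z ε x‖ ≤ ‖u ε x‖ * ‖v ε x‖) : Bdd K w z := by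
  obtain ⟨N, hN⟩ := hu
  obtain ⟨M, hM⟩ := hv
  refine ⟨N + M, ?_⟩
  filter_upwards [h, hN, hM, eventually_mem_Ioc] with ε h h1 h2 h0 x hx
  rw [pow_add]
  have := one_le_gauge h0 (hw x)
  exact (h x hx).trans (mul_le_mul (h1 x hx) (h2 x hx) (norm_nonneg _) (by positivity))

/-- A net dominated by the product of a bounded and a small net is small. -/
theorem Small.of_le_mul (hw : ∀ x, 0 ≤ w x) {u : ℝ → X → F} {v : ℝ → X → G} {z : ℝ → X → H}
    (hu : Bdd K w u) (hv : Small K w v)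
    (h : ∀ᶠ ε : ℝ in 𝓝[>] 0, ∀ x ∈ K, ‖z ε x‖ ≤ ‖u ε x‖ * ‖v ε x‖) : Small K w z := by
  obtain ⟨N, hN⟩ := hu
  obtain ⟨l, hl⟩ := hv
  -- The order `m + N` pays for the factor `ε^{-N}` of the bounded net, while the weight exponent `N
  -- + l` stays independent of `m`.
  refine ⟨N + l, fun m => ?_⟩
  filter_upwards [h, hN, hl (m + N), eventually_mem_Ioc] with ε h h1 h2 h0 x hx
  have hx0 := hw x
  have h3 := one_le_gauge h0 hx0
  refine (h x hx).trans ((mul_le_mul (h1 x hx) (h2 x hx) (norm_nonneg _)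
    (by positivity)).trans (le_of_eq ?_))
  have : ε⁻¹ ^ N * ε ^ N = 1 := by rw [← mul_pow, inv_mul_cancel₀ h0.1.ne', one_pow]
  rw [mul_pow, pow_add, pow_add]
  linear_combination (1 + w x) ^ N * ε ^ m * (1 + w x) ^ l * this

theorem Bdd.of_le_add (hw : ∀ x, 0 ≤ w x) {u : ℝ → X → F} {v : ℝ → X → G} {z : ℝ → X → H}
    (hu : Bdd K w u) (hv : Bdd K w v)
    (h : ∀ᶠ ε : ℝ in 𝓝[>] 0, ∀ x ∈ K, ‖z ε x‖ ≤ ‖u ε x‖ + ‖v ε x‖) : Bdd K w z := by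
  obtain ⟨N, hN⟩ := hu
  obtain ⟨M, hM⟩ := hv
  refine ⟨N + M + 1, ?_⟩
  filter_upwards [h, hN, hM, eventually_mem_Ioc, eventually_le_inv 2] with ε h h1 h2 h0 h20 x hx
  have h3 := one_le_gauge h0 (hw x)
  have h4 : 2 ≤ ε⁻¹ * (1 + w x) := h20.trans
    (le_mul_of_one_le_right (inv_nonneg.2 h0.1.le) (by linarith [hw x]))
  have h5 := pow_le_pow_right₀ h3 (Nat.le_add_right N M)
  have h6 := pow_le_pow_right₀ h3 (Nat.le_add_left M N)
  have h7 : 0 ≤ (ε⁻¹ * (1 + w x)) ^ (N + M) := by positivity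
  rw [pow_succ]
  nlinarith [h x hx, h1 x hx, h2 x hx]

theorem Small.of_le_add (hw : ∀ x, 0 ≤ w x) {u : ℝ → X → F} {v : ℝ → X → G} {z : ℝ → X → H}
    (hu : Small K w u) (hv : Small K w v)
    (h : ∀ᶠ ε : ℝ in 𝓝[>] 0, ∀ x ∈ K, ‖z ε x‖ ≤ ‖u ε x‖ + ‖v ε x‖) : Small K w z := by
  obtain ⟨N, hN⟩ := hu
  obtain ⟨M, hM⟩ := hv
  refine ⟨N + M, fun m => ?_⟩
  filter_upwards [h, hN (m + 1), hM (m + 1), eventually_mem_Ioc, eventually_mul_le_one 2]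
    with ε h h1 h2 h0 h20 x hx
  have h3 : 1 ≤ 1 + w x := by linarith [hw x]
  have h5 := pow_le_pow_right₀ h3 (Nat.le_add_right N M)
  have h6 := pow_le_pow_right₀ h3 (Nat.le_add_left M N)
  have h7 : 0 ≤ ε ^ m * (1 + w x) ^ (N + M) := mul_nonneg (pow_nonneg h0.1.le _) (by positivity)
  have h8 : 0 ≤ ε ^ (m + 1) := pow_nonneg h0.1.le _
  calc ‖z ε x‖ ≤ ε ^ (m + 1) * (1 + w x) ^ (N + M) + ε ^ (m + 1) * (1 + w x) ^ (N + M) :=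
        (h x hx).trans (add_le_add ((h1 x hx).trans (mul_le_mul_of_nonneg_left h5 h8))
          ((h2 x hx).trans (mul_le_mul_of_nonneg_left h6 h8)))
    _ = 2 * ε * (ε ^ m * (1 + w x) ^ (N + M)) := by ring
    _ ≤ _ := mul_le_of_le_one_left h7 h20

theorem Bdd.add (hw : ∀ x, 0 ≤ w x) {u v : ℝ → X → F} (hu : Bdd K w u) (hv : Bdd K w v) :
    Bdd K w (fun ε x => u ε x + v ε x) :=
  hu.of_le_add hw hv (.of_forall fun _ _ _ => norm_add_le _ _)

theorem Small.add (hw : ∀ x, 0 ≤ w x) {u v : ℝ → X → F} (hu : Small K w u) (hv : Small K w v) :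
    Small K w (fun ε x => u ε x + v ε x) :=
  hu.of_le_add hw hv (.of_forall fun _ _ _ => norm_add_le _ _)

theorem Small.sub (hw : ∀ x, 0 ≤ w x) {u v : ℝ → X → F} (hu : Small K w u) (hv : Small K w v) :
    Small K w (fun ε x => u ε x - v ε x) :=
  hu.of_le_add hw hv (.of_forall fun _ _ _ => norm_sub_le _ _)

theorem Bdd.sum (hw : ∀ x, 0 ≤ w x) {ι : Type*} (s : Finset ι) {u : ι → ℝ → X → F}
    (hu : ∀ i ∈ s, Bdd K w (u i)) : Bdd K w (fun ε x => ∑ i ∈ s, u i ε x) := by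
  classical
  induction s using Finset.induction_on with
  | empty => simpa using Bdd.const hw (0 : F)
  | insert a s ha ih =>
    simp only [Finset.sum_insert ha]
    exact (hu a (by simp)).add hw (ih fun i hi => hu i (by simp [hi]))

theorem Small.sum (hw : ∀ x, 0 ≤ w x) {ι : Type*} (s : Finset ι) {u : ι → ℝ → X → F}
    (hu : ∀ i ∈ s, Small K w (u i)) : Small K w (fun ε x => ∑ i ∈ s, u i ε x) := by
  classical
  induction s using Finset.induction_on with
  | empty => simpa using Small.zero hw
  | insert a s ha ih =>
    simp only [Finset.sum_insert ha]
    exact (hu a (by simp)).add hw (ih fun i hi => hu i (by simp [hi]))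

theorem Bdd.mul (hw : ∀ x, 0 ≤ w x) {u v : ℝ → X → ℝ} (hu : Bdd K w u) (hv : Bdd K w v) :
    Bdd K w (fun ε x => u ε x * v ε x) :=
  hu.of_le_mul hw hv (.of_forall fun _ _ _ => norm_mul_le _ _)

theorem Bdd.mul_small (hw : ∀ x, 0 ≤ w x) {u v : ℝ → X → ℝ} (hu : Bdd K w u)
    (hv : Small K w v) : Small K w (fun ε x => u ε x * v ε x) :=
  Small.of_le_mul hw hu hv (.of_forall fun _ _ _ => norm_mul_le _ _)

theorem Bdd.pow (hw : ∀ x, 0 ≤ w x) {u : ℝ → X → ℝ} (hu : Bdd K w u) (n : ℕ) :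
    Bdd K w (fun ε x => u ε x ^ n) := by
  induction n with
  | zero => simpa using Bdd.const hw (1 : ℝ)
  | succ n ih => simpa only [pow_succ] using ih.mul hw hu

theorem Small.bdd (hw : ∀ x, 0 ≤ w x) {u : ℝ → X → F} (hu : Small K w u) : Bdd K w u := by
  obtain ⟨l, hl⟩ := hu
  refine ⟨l, ?_⟩
  filter_upwards [hl 0, eventually_mem_Ioc] with ε h h0 x hx
  have := hw x
  have hx1 := h x hx
  rw [pow_zero, one_mul] at hx1
  exact hx1.trans (pow_le_pow_left₀ (by positivity)
    (le_mul_of_one_le_left (by positivity) ((one_le_inv₀ h0.1).2 h0.2)) _)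

theorem Bdd.comp (hw : ∀ x, 0 ≤ w x) {K' : Set Y} {w' : Y → ℝ}
    {g : ℝ → Y → F} (hg : Bdd K' w' g) {a : ℝ → X → Y}
    (ha : ∀ᶠ ε : ℝ in 𝓝[>] 0, ∀ x ∈ K, a ε x ∈ K') (hwa : Bdd K w (fun ε x => w' (a ε x))) :
    Bdd K w (fun ε x => g ε (a ε x)) := by
  obtain ⟨N, hN⟩ := hg
  refine (((Bdd.inv hw).mul hw ((Bdd.const hw (1 : ℝ)).add hw hwa)).pow hw N).of_le ?_
  filter_upwards [hN, ha] with ε h1 h2 x hx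
  exact (h1 _ (h2 x hx)).trans (le_abs_self _)

/-- A moderate inner map turns `(1 + w')^l` into at most `(ε⁻¹ (1 + w))^N`, where `N` depends on `l`
alone. Asking for order `m + N` cancels the loss `ε^{-N}`, so the new weight exponent is again
independent of `m`. -/
theorem Small.comp (hw : ∀ x, 0 ≤ w x) {K' : Set Y} {w' : Y → ℝ}
    {g : ℝ → Y → F} (hg : Small K' w' g) {a : ℝ → X → Y}
    (ha : ∀ᶠ ε : ℝ in 𝓝[>] 0, ∀ x ∈ K, a ε x ∈ K') (hwa : Bdd K w (fun ε x => w' (a ε x))) :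
    Small K w (fun ε x => g ε (a ε x)) := by
  obtain ⟨l, hl⟩ := hg
  obtain ⟨N, hN⟩ := ((Bdd.const hw (1 : ℝ)).add hw hwa).pow hw l
  refine ⟨N, fun m => ?_⟩
  filter_upwards [hl (m + N), ha, hN, eventually_mem_Ioc] with ε h1 h2 h3 h0 x hx
  have h4 := (le_abs_self _).trans (h3 x hx)
  have h5 := hw x
  have : ε⁻¹ ^ N * ε ^ N = 1 := by rw [← mul_pow, inv_mul_cancel₀ h0.1.ne', one_pow]
  calc ‖g ε (a ε x)‖ ≤ ε ^ (m + N) * (1 + w' (a ε x)) ^ l := h1 _ (h2 x hx)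
    _ ≤ ε ^ (m + N) * (ε⁻¹ * (1 + w x)) ^ N :=
        mul_le_mul_of_nonneg_left h4 (pow_nonneg h0.1.le _)
    _ = ε ^ m * (1 + w x) ^ N := by
        rw [mul_pow, pow_add]; linear_combination ε ^ m * (1 + w x) ^ N * this

theorem Bdd.of_weight_le (hw : ∀ x, 0 ≤ w x) {w' : X → ℝ}
    (h : Bdd K w (fun _ => w')) {u : ℝ → X → F} (hu : Bdd K w' u) : Bdd K w u :=
  Bdd.comp hw hu (a := fun _ x => x) (.of_forall fun _ _ h => h) h

/-- A constant is absorbed by a higher power of the gauge `ε⁻¹ (1 + w)`, which eventually exceeds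
any constant. This keeps the estimates below free of constants. -/
theorem bdd_iff (hw : ∀ x, 0 ≤ w x) {u : ℝ → X → F} : Bdd K w u ↔
    ∃ N : ℕ, ∃ C : ℝ, ∀ᶠ ε : ℝ in 𝓝[>] 0, ∀ x ∈ K,
      ‖u ε x‖ ≤ C * ε ^ (-(N : ℤ)) * (1 + w x) ^ N := by
  constructor
  · rintro ⟨N, hN⟩
    refine ⟨N, 1, hN.mono fun ε h x hx => (h x hx).trans (le_of_eq ?_)⟩
    rw [mul_pow, zpow_neg, zpow_natCast, inv_pow, one_mul]
  · rintro ⟨N, C, h⟩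
    refine ((Bdd.const hw C).mul hw (((Bdd.inv hw).mul hw ((Bdd.const hw (1 : ℝ)).add hw
      (Bdd.weight hw))).pow hw N)).of_le (h.mono fun ε h x hx => ?_)
    refine (h x hx).trans ((le_of_eq ?_).trans (le_abs_self _))
    rw [mul_pow, zpow_neg, zpow_natCast, inv_pow, mul_assoc]

/-- The constant is removed by using the bound of order `m + 1`, since eventually `C ε ≤ 1`; the
weight exponent is not touched. -/
theorem small_iff (hw : ∀ x, 0 ≤ w x) {u : ℝ → X → F} : Small K w u ↔
    ∃ l : ℕ, ∀ m : ℕ, ∃ C : ℝ, ∀ᶠ ε : ℝ in 𝓝[>] 0, ∀ x ∈ K,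
      ‖u ε x‖ ≤ C * ε ^ m * (1 + w x) ^ l := by
  constructor
  · rintro ⟨l, hl⟩
    exact ⟨l, fun m => ⟨1, (hl m).mono fun ε h x hx => by simpa using h x hx⟩⟩
  · rintro ⟨l, hl⟩
    refine ⟨l, fun m => ?_⟩
    obtain ⟨C, hC⟩ := hl (m + 1)
    filter_upwards [hC, eventually_mul_le_one C, eventually_mem_Ioc] with ε h1 h2 h0 x hx
    have := hw x
    have h7 : 0 ≤ ε ^ m * (1 + w x) ^ l := mul_nonneg (pow_nonneg h0.1.le _) (by positivity)
    calc _ ≤ C * ε ^ (m + 1) * (1 + w x) ^ l := h1 x hx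
      _ = C * ε * (ε ^ m * (1 + w x) ^ l) := by ring
      _ ≤ _ := mul_le_of_le_one_left h7 h2

theorem bdd_of_forall_le (hw : ∀ x, 0 ≤ w x) {u : ℝ → X → F} (C : ℝ)
    (h : ∀ ε, ∀ x ∈ K, ‖u ε x‖ ≤ C) : Bdd K w u :=
  (Bdd.const hw C).of_le (.of_forall fun ε x hx => (h ε x hx).trans (le_abs_self _))

end Growth

/-! ### Nets of smooth functions: products, composition, and negligibility from values. -/

section Derivatives

variable {E E' F G H : Type*} [NormedAddCommGroup E] [NormedSpace ℝ E]
  [NormedAddCommGroup E'] [NormedSpace ℝ E'] [NormedAddCommGroup F] [NormedSpace ℝ F]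
  [NormedAddCommGroup G] [NormedSpace ℝ G] [NormedAddCommGroup H] [NormedSpace ℝ H]

/-- Sets and weights with respect to which growth is measured, inside an open set `W`. -/
structure IsFrame (W : Set E) (S : Set (Set E)) (w : E → ℝ) : Prop where
  isOpen : IsOpen W
  subset : ∀ K ∈ S, K ⊆ W
  nonneg : ∀ x, 0 ≤ w x

/-- Nets of smooth functions on `W` with moderate growth. -/
structure ModNet (W : Set E) (S : Set (Set E)) (w : E → ℝ) (u : ℝ → E → F) : Prop
    extends IsFrame W S w where
  smooth : ∀ ε ∈ Ioc (0 : ℝ) 1, ContDiffOn ℝ ∞ (u ε) W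
  bdd : ∀ K ∈ S, ∀ k : ℕ, Bdd K w (fun ε => iteratedFDeriv ℝ k (u ε))

/-- Nets all of whose derivatives are negligible. -/
def NegNet (S : Set (Set E)) (w : E → ℝ) (u : ℝ → E → F) : Prop :=
  ∀ K ∈ S, ∀ k : ℕ, Small K w (fun ε => iteratedFDeriv ℝ k (u ε))

theorem moderateBounds_iff {S : Set (Set E)} {w : E → ℝ} (hw : ∀ x, 0 ≤ w x) {u : ℝ → E → F} :
    ModerateBounds S w u ↔ ∀ K ∈ S, ∀ k : ℕ, Bdd K w (fun ε => iteratedFDeriv ℝ k (u ε)) := by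
  simp only [ModerateBounds, bdd_iff hw]

theorem negligibleBounds_iff {S : Set (Set E)} {w : E → ℝ} (hw : ∀ x, 0 ≤ w x) {u : ℝ → E → F} :
    NegligibleBounds S w u ↔ NegNet S w u := by
  simp only [NegligibleBounds, NegNet, small_iff hw]

theorem isFrame_compactsIn {U : Set E} (hU : IsOpen U) : IsFrame U (compactsIn U) (fun _ => 0) :=
  ⟨hU, fun _ h => h.2, fun _ => le_rfl⟩

theorem isFrame_norm (A : Set E) : IsFrame univ {A} (fun x => ‖x‖) :=
  ⟨isOpen_univ, fun _ _ => subset_univ _, fun _ => norm_nonneg _⟩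

theorem isFrame_slabsIn {U : Set E} (hU : IsOpen U) :
    IsFrame (U ×ˢ (univ : Set E')) (slabsIn U E') (fun z => ‖z.2‖) := by
  refine ⟨hU.prod isOpen_univ, ?_, fun _ => norm_nonneg _⟩
  rintro _ ⟨K, hK, rfl⟩
  exact prod_mono hK.2 le_rfl

theorem memG_iff {U : Set E} (hU : IsOpen U) {u : ℝ → E → F} :
    MemG U u ↔ ModNet U (compactsIn U) (fun _ => 0) u := by
  rw [MemG, moderateBounds_iff (fun _ => le_rfl)]
  exact ⟨fun h => ⟨isFrame_compactsIn hU, h.1, h.2⟩, fun h => ⟨h.smooth, h.bdd⟩⟩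

theorem memGTau_iff {A : Set E} {u : ℝ → E → F} :
    MemGTau A u ↔ ModNet univ {A} (fun x => ‖x‖) u := by
  rw [MemGTau, moderateBounds_iff (fun _ => norm_nonneg _)]
  simp only [← contDiffOn_univ]
  exact ⟨fun h => ⟨isFrame_norm A, h.1, h.2⟩, fun h => ⟨h.smooth, h.bdd⟩⟩

theorem memGMixed_iff {U : Set E} (hU : IsOpen U) {u : ℝ → E × E' → F} :
    MemGMixed U u ↔ ModNet (U ×ˢ univ) (slabsIn U E') (fun z => ‖z.2‖) u := by
  rw [MemGMixed, moderateBounds_iff (fun _ => norm_nonneg _)]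
  exact ⟨fun h => ⟨isFrame_slabsIn hU, h.1, h.2⟩, fun h => ⟨h.smooth, h.bdd⟩⟩

theorem eqG_iff {U : Set E} {u v : ℝ → E → F} :
    EqG U u v ↔ NegNet (compactsIn U) (fun _ => 0) (fun ε x => u ε x - v ε x) :=
  negligibleBounds_iff fun _ => le_rfl

theorem eqGTau_iff {A : Set E} {u v : ℝ → E → F} :
    EqGTau A u v ↔ NegNet {A} (fun x => ‖x‖) (fun ε x => u ε x - v ε x) :=
  negligibleBounds_iff fun _ => norm_nonneg _

theorem eqGMixed_iff {U : Set E} {u v : ℝ → E × E' → F} :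
    EqGMixed U u v ↔ NegNet (slabsIn U E') (fun z => ‖z.2‖) (fun ε x => u ε x - v ε x) :=
  negligibleBounds_iff fun _ => norm_nonneg _

variable {W : Set E} {S : Set (Set E)} {w : E → ℝ}

theorem ModNet.contDiffAt {u : ℝ → E → F} (hu : ModNet W S w u) {ε : ℝ} (hε : ε ∈ Ioc (0 : ℝ) 1)
    {x : E} (hx : x ∈ W) : ContDiffAt ℝ ∞ (u ε) x :=
  (hu.smooth ε hε).contDiffAt (hu.isOpen.mem_nhds hx)

theorem ModNet.bdd_zero {u : ℝ → E → F} (hu : ModNet W S w u) {K : Set E} (hK : K ∈ S) :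
    Bdd K w u :=
  (hu.bdd K hK 0).of_le (.of_forall fun _ _ _ => by rw [norm_iteratedFDeriv_zero])

theorem ModNet.bdd_fderiv {u : ℝ → E → F} (hu : ModNet W S w u) {K : Set E} (hK : K ∈ S) :
    Bdd K w (fun ε => fderiv ℝ (u ε)) :=
  (hu.bdd K hK 1).of_le (.of_forall fun _ _ _ => by rw [norm_iteratedFDeriv_one])

theorem NegNet.small_zero {u : ℝ → E → F} (hu : NegNet S w u) {K : Set E} (hK : K ∈ S) :
    Small K w u :=
  (hu K hK 0).of_le (.of_forall fun _ _ _ => by rw [norm_iteratedFDeriv_zero])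

theorem NegNet.small_fderiv {u : ℝ → E → F} (hu : NegNet S w u) {K : Set E} (hK : K ∈ S) :
    Small K w (fun ε => fderiv ℝ (u ε)) :=
  (hu K hK 1).of_le (.of_forall fun _ _ _ => by rw [norm_iteratedFDeriv_one])

theorem IsFrame.modNet {u : ℝ → E → F} (hF : IsFrame W S w)
    (h1 : ∀ ε ∈ Ioc (0 : ℝ) 1, ContDiffOn ℝ ∞ (u ε) W)
    (h2 : ∀ K ∈ S, ∀ k : ℕ, Bdd K w (fun ε => iteratedFDeriv ℝ k (u ε))) : ModNet W S w u :=
  { hF with smooth := h1, bdd := h2 }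

theorem NegNet.congr {u v : ℝ → E → F} (hu : NegNet S w u)
    (h : ∀ᶠ ε : ℝ in 𝓝[>] 0, ∀ K ∈ S, ∀ x ∈ K, u ε =ᶠ[𝓝 x] v ε) : NegNet S w v := fun K hK k =>
  (hu K hK k).of_le (h.mono fun ε h x hx => by
    rw [(EventuallyEq.iteratedFDeriv ℝ (h K hK x hx) k).eq_of_nhds])

theorem norm_iteratedFDeriv_fderiv_apply_le {f : E → F} {x : E} (hf : ContDiffAt ℝ ∞ f x) (e : E)
    (k : ℕ) : ‖iteratedFDeriv ℝ k (fun y => fderiv ℝ f y e) x‖ ≤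
      ‖e‖ * ‖iteratedFDeriv ℝ (k + 1) f x‖ := by
  have h := (ContinuousLinearMap.apply ℝ F e).norm_iteratedFDeriv_comp_left
    (hf.fderiv_right (m := ∞) (by simp)) (n := k) (by exact_mod_cast le_top)
  rw [norm_iteratedFDeriv_fderiv] at h
  refine le_trans h (mul_le_mul_of_nonneg_right ?_ (norm_nonneg _))
  exact ContinuousLinearMap.opNorm_le_bound _ (norm_nonneg _) fun y => by
    simpa [mul_comm] using y.le_opNorm e

/-- The directional derivative of a moderate net. -/
theorem ModNet.fderiv_apply {u : ℝ → E → F} (hu : ModNet W S w u) (e : E) :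
    ModNet W S w (fun ε x => fderiv ℝ (u ε) x e) := by
  refine hu.toIsFrame.modNet (fun ε hε => ?_) fun K hK k => ?_
  · exact ((hu.smooth ε hε).fderiv_of_isOpen hu.isOpen (m := ∞) (by simp)).clm_apply
      contDiffOn_const
  · refine Bdd.of_le_mul hu.nonneg (Bdd.const hu.nonneg e) (hu.bdd K hK (k + 1)) ?_
    filter_upwards [eventually_mem_Ioc] with ε hε x hx
    exact norm_iteratedFDeriv_fderiv_apply_le (hu.contDiffAt hε (hu.subset K hK hx)) e k

theorem ModNet.clm_comp {u : ℝ → E → F} (hu : ModNet W S w u) (A : F →L[ℝ] G) :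
    ModNet W S w (fun ε x => A (u ε x)) := by
  refine hu.toIsFrame.modNet (fun ε hε => A.contDiff.comp_contDiffOn (hu.smooth ε hε))
    fun K hK k => ?_
  refine Bdd.of_le_mul hu.nonneg (Bdd.const hu.nonneg A) (hu.bdd K hK k) ?_
  filter_upwards [eventually_mem_Ioc] with ε hε x hx
  exact A.norm_iteratedFDeriv_comp_left (hu.contDiffAt hε (hu.subset K hK hx))
    (by exact_mod_cast le_top)

theorem ModNet.add {u v : ℝ → E → F} (hu : ModNet W S w u) (hv : ModNet W S w v) :
    ModNet W S w (fun ε x => u ε x + v ε x) := by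
  refine hu.toIsFrame.modNet (fun ε hε => (hu.smooth ε hε).add (hv.smooth ε hε)) fun K hK k => ?_
  refine Bdd.of_le_add hu.nonneg (hu.bdd K hK k) (hv.bdd K hK k) ?_
  filter_upwards [eventually_mem_Ioc] with ε hε x hx
  have hx' := hu.subset K hK hx
  rw [fun_iteratedFDeriv_add_apply ((hu.contDiffAt hε hx').of_le (by exact_mod_cast le_top))
    ((hv.contDiffAt hε hx').of_le (by exact_mod_cast le_top))]
  exact norm_add_le _ _

theorem norm_iteratedFDeriv_const_le (c : F) (k : ℕ) (x : E) :
    ‖iteratedFDeriv ℝ k (fun _ : E => c) x‖ ≤ ‖c‖ := by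
  rcases Nat.eq_zero_or_pos k with rfl | hk
  · rw [norm_iteratedFDeriv_zero]
  · simp [iteratedFDeriv_const_of_ne hk.ne']

/-- A moderate net of constants. -/
theorem IsFrame.modNet_const (hF : IsFrame W S w) {c : ℝ → F}
    (hc : ∀ K ∈ S, Bdd K w (fun ε _ => c ε)) : ModNet W S w (fun ε _ => c ε) :=
  hF.modNet (fun _ _ => contDiffOn_const) fun K hK k =>
    (hc K hK).of_le (.of_forall fun _ _ _ => norm_iteratedFDeriv_const_le _ _ _)

theorem ModNet.sum {ι : Type*} (hF : IsFrame W S w) (s : Finset ι) {u : ι → ℝ → E → F}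
    (hu : ∀ i ∈ s, ModNet W S w (u i)) : ModNet W S w (fun ε x => ∑ i ∈ s, u i ε x) := by
  classical
  induction s using Finset.induction_on with
  | empty => simpa using hF.modNet_const (c := fun _ => (0 : F)) fun K _ => Bdd.const hF.nonneg 0
  | insert a s ha ih =>
    simp only [Finset.sum_insert ha]
    exact (hu a (by simp)).add (ih fun i hi => hu i (by simp [hi]))

theorem ModNet.prodMk {u : ℝ → E → F} {v : ℝ → E → G} (hu : ModNet W S w u)
    (hv : ModNet W S w v) : ModNet W S w (fun ε x => (u ε x, v ε x)) := by
  simpa using (hu.clm_comp (.inl ℝ F G)).add (hv.clm_comp (.inr ℝ F G))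

theorem ModNet.pi {ι : Type*} [Fintype ι] (hF : IsFrame W S w) {F : ι → Type*}
    [∀ i, NormedAddCommGroup (F i)]
    [∀ i, NormedSpace ℝ (F i)] {u : ℝ → E → ∀ i, F i}
    (hu : ∀ i, ModNet W S w (fun ε x => u ε x i)) : ModNet W S w u := by
  classical
  have h := ModNet.sum hF Finset.univ
    fun i _ => (hu i).clm_comp (ContinuousLinearMap.single ℝ F i)
  simpa [Finset.univ_sum_single] using h

/-- A continuous bilinear map applied to moderate nets. -/
theorem ModNet.bilin {u : ℝ → E → F} {v : ℝ → E → G} (B : F →L[ℝ] G →L[ℝ] H)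
    (hu : ModNet W S w u) (hv : ModNet W S w v) : ModNet W S w (fun ε x => B (u ε x) (v ε x)) := by
  refine hu.toIsFrame.modNet (fun ε hε => (B.contDiff.comp_contDiffOn (hu.smooth ε hε)).clm_apply
    (hv.smooth ε hε)) fun K hK k => ?_
  have hw := hu.nonneg
  refine ((Bdd.const hw ‖B‖).mul hw (Bdd.sum hw (Finset.range (k + 1))
    (u := fun i ε x => (k.choose i : ℝ) * ‖iteratedFDeriv ℝ i (u ε) x‖ *
      ‖iteratedFDeriv ℝ (k - i) (v ε) x‖) fun i _ => ((Bdd.const hw (k.choose i : ℝ)).mul hw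
      (hu.bdd K hK i).norm).mul hw (hv.bdd K hK (k - i)).norm)).of_le ?_
  filter_upwards [eventually_mem_Ioc] with ε hε x hx
  have hx' := hu.subset K hK hx
  have h := B.norm_iteratedFDerivWithin_le_of_bilinear (hu.smooth ε hε) (hv.smooth ε hε)
    hu.isOpen.uniqueDiffOn hx' (n := k) (by exact_mod_cast le_top)
  simp only [iteratedFDerivWithin_of_isOpen _ hu.isOpen hx'] at h
  exact h.trans (le_abs_self _)

/-- Each term of Leibniz' formula pairs a derivative of the moderate factor with one of the
negligible factor. -/
theorem NegNet.bilin {u : ℝ → E → F} {v : ℝ → E → G} (B : F →L[ℝ] G →L[ℝ] H)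
    (hu : ModNet W S w u) (hs : ∀ ε ∈ Ioc (0 : ℝ) 1, ContDiffOn ℝ ∞ (v ε) W) (hv : NegNet S w v) :
    NegNet S w (fun ε x => B (u ε x) (v ε x)) := by
  intro K hK k
  have hw := hu.nonneg
  refine ((Bdd.const hw ‖B‖).mul_small hw (Small.sum hw (Finset.range (k + 1))
    (u := fun i ε x => (k.choose i : ℝ) * ‖iteratedFDeriv ℝ i (u ε) x‖ *
      ‖iteratedFDeriv ℝ (k - i) (v ε) x‖) fun i _ => ((Bdd.const hw (k.choose i : ℝ)).mul hw
      (hu.bdd K hK i).norm).mul_small hw (hv K hK (k - i)).norm)).of_le ?_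
  filter_upwards [eventually_mem_Ioc] with ε hε x hx
  have hx' := hu.subset K hK hx
  have h := B.norm_iteratedFDerivWithin_le_of_bilinear (hu.smooth ε hε) (hs ε hε)
    hu.isOpen.uniqueDiffOn hx' (n := k) (by exact_mod_cast le_top)
  simp only [iteratedFDerivWithin_of_isOpen _ hu.isOpen hx'] at h
  exact h.trans (le_abs_self _)

theorem ModNet.mul {u v : ℝ → E → ℝ} (hu : ModNet W S w u) (hv : ModNet W S w v) :
    ModNet W S w (fun ε x => u ε x * v ε x) :=
  hu.bilin (ContinuousLinearMap.mul ℝ ℝ) hv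

theorem ModNet.neg {u : ℝ → E → F} (hu : ModNet W S w u) :
    ModNet W S w (fun ε x => - u ε x) :=
  hu.clm_comp (-ContinuousLinearMap.id ℝ F)

theorem ModNet.sub {u v : ℝ → E → F} (hu : ModNet W S w u) (hv : ModNet W S w v) :
    ModNet W S w (fun ε x => u ε x - v ε x) := by
  simpa only [sub_eq_add_neg] using hu.add hv.neg

theorem norm_iteratedFDeriv_clm_le (A : E →L[ℝ] F) (k : ℕ) (x : E) :
    ‖iteratedFDeriv ℝ k A x‖ ≤ ‖A x‖ + ‖A‖ := by
  cases k with
  | zero => rw [norm_iteratedFDeriv_zero]; linarith [norm_nonneg A]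
  | succ k =>
    rw [← norm_iteratedFDeriv_fderiv]
    have : fderiv ℝ A = fun _ => A := by ext1 y; exact A.fderiv
    rw [this]
    linarith [norm_iteratedFDeriv_const_le A k x, norm_nonneg (A x)]

theorem IsFrame.modNet_clm (hF : IsFrame W S w) (A : E →L[ℝ] F)
    (hA : ∀ K ∈ S, Bdd K w (fun _ => A)) : ModNet W S w (fun _ x => A x) :=
  hF.modNet (fun _ _ => A.contDiff.contDiffOn) fun K hK k =>
    (((hA K hK).norm.add hF.nonneg (Bdd.const hF.nonneg ‖A‖))).of_le
      (.of_forall fun _ x _ => (norm_iteratedFDeriv_clm_le A k x).trans (le_abs_self _))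

theorem bdd_clm_of_isCompact {K : Set E} (hK : IsCompact K) (hw : ∀ x, 0 ≤ w x) (A : E →L[ℝ] F) :
    Bdd K w (fun _ : ℝ => A) := by
  obtain ⟨C, hC⟩ := hK.exists_bound_of_continuousOn A.continuous.continuousOn
  exact bdd_of_forall_le hw C fun _ => hC

theorem bdd_clm_of_norm (K : Set E) (A : E →L[ℝ] F) :
    Bdd K (fun x => ‖x‖) (fun _ : ℝ => A) :=
  Bdd.of_le_mul (fun _ => norm_nonneg _) (Bdd.const (fun _ => norm_nonneg _) A)
    (Bdd.weight fun _ => norm_nonneg _) (.of_forall fun _ x _ => by simpa using A.le_opNorm x)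

variable {S' : Set (Set E')} {w' : E' → ℝ}

/-- A crude Faà di Bruno estimate. Sums over all orders replace maxima, and the summand `1` makes
the base at least one, so that it is bounded by each of its positive powers, as the general estimate
requires. -/
theorem norm_iteratedFDeriv_comp_le_sum {g : E' → F} {h : E → E'} (hW : IsOpen W)
    (hg : ContDiff ℝ ∞ g) (hh : ContDiffOn ℝ ∞ h W) {x : E} (hx : x ∈ W) (k : ℕ) :
    ‖iteratedFDeriv ℝ k (fun y => g (h y)) x‖ ≤ k.factorial *
      (∑ i ∈ Finset.range (k + 1), ‖iteratedFDeriv ℝ i g (h x)‖) *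
      (1 + ∑ i ∈ Finset.range (k + 1), ‖iteratedFDeriv ℝ i h x‖) ^ k := by
  have hm : ∀ i, i ≤ k → i ∈ Finset.range (k + 1) := fun i hi => Finset.mem_range.2 (by omega)
  have key := norm_iteratedFDerivWithin_comp_le hg.contDiffOn hh (n := k)
    (C := ∑ i ∈ Finset.range (k + 1), ‖iteratedFDeriv ℝ i g (h x)‖)
    (D := 1 + ∑ i ∈ Finset.range (k + 1), ‖iteratedFDeriv ℝ i h x‖)
    (by exact_mod_cast le_top) uniqueDiffOn_univ hW.uniqueDiffOn (mapsTo_univ _ _) hx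
    (fun i hi => ?_) (fun i h1 hi => ?_)
  · rwa [iteratedFDerivWithin_of_isOpen _ hW hx] at key
  · rw [iteratedFDerivWithin_univ]
    exact Finset.single_le_sum (f := fun i => ‖iteratedFDeriv ℝ i g (h x)‖)
      (fun _ _ => norm_nonneg _) (hm i hi)
  · rw [iteratedFDerivWithin_of_isOpen _ hW hx]
    have h2 := Finset.single_le_sum (f := fun i => ‖iteratedFDeriv ℝ i h x‖)
      (fun _ _ => norm_nonneg _) (hm i hi)
    have h3 : 0 ≤ ∑ i ∈ Finset.range (k + 1), ‖iteratedFDeriv ℝ i h x‖ :=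
      Finset.sum_nonneg fun _ _ => norm_nonneg _
    calc _ ≤ 1 + ∑ i ∈ Finset.range (k + 1), ‖iteratedFDeriv ℝ i h x‖ := by linarith
      _ ≤ _ := le_self_pow₀ (by linarith) (by omega)

/-- Composition of moderate nets, the outer one being defined everywhere. -/
theorem ModNet.comp {g : ℝ → E' → F} {h : ℝ → E → E'} (hg : ModNet univ S' w' g)
    (hh : ModNet W S w h)
    (hm : ∀ K ∈ S, ∃ K' ∈ S', (∀ᶠ ε : ℝ in 𝓝[>] 0, ∀ x ∈ K, h ε x ∈ K') ∧
      Bdd K w (fun ε x => w' (h ε x))) : ModNet W S w (fun ε x => g ε (h ε x)) := by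
  refine hh.toIsFrame.modNet (fun ε hε => (contDiffOn_univ.1 (hg.smooth ε hε)).comp_contDiffOn
    (hh.smooth ε hε)) fun K hK k => ?_
  obtain ⟨K', hK', h1, h2⟩ := hm K hK
  have hw := hh.nonneg
  refine (((Bdd.const hw (k.factorial : ℝ)).mul hw (Bdd.sum hw (Finset.range (k + 1))
    (u := fun i ε x => ‖iteratedFDeriv ℝ i (g ε) (h ε x)‖) fun i _ =>
      (Bdd.comp hw (hg.bdd K' hK' i) h1 h2).norm)).mul hw
    (((Bdd.const hw (1 : ℝ)).add hw (Bdd.sum hw (Finset.range (k + 1))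
    (u := fun i ε x => ‖iteratedFDeriv ℝ i (h ε) x‖) fun i _ =>
      (hh.bdd K hK i).norm)).pow hw k)).of_le ?_
  filter_upwards [eventually_mem_Ioc] with ε hε x hx
  exact (norm_iteratedFDeriv_comp_le_sum hh.isOpen (contDiffOn_univ.1 (hg.smooth ε hε))
    (hh.smooth ε hε) (hh.subset K hK hx) k).trans (le_abs_self _)

/-- Composition of a negligible net, defined everywhere, with a moderate net. -/
theorem NegNet.comp {g : ℝ → E' → F} {h : ℝ → E → E'}
    (hs : ∀ ε ∈ Ioc (0 : ℝ) 1, ContDiff ℝ ∞ (g ε)) (hg : NegNet S' w' g)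
    (hh : ModNet W S w h)
    (hm : ∀ K ∈ S, ∃ K' ∈ S', (∀ᶠ ε : ℝ in 𝓝[>] 0, ∀ x ∈ K, h ε x ∈ K') ∧
      Bdd K w (fun ε x => w' (h ε x))) : NegNet S w (fun ε x => g ε (h ε x)) := by
  intro K hK k
  obtain ⟨K', hK', h1, h2⟩ := hm K hK
  have hw := hh.nonneg
  refine ((((Bdd.const hw (1 : ℝ)).add hw (Bdd.sum hw (Finset.range (k + 1))
    (u := fun i ε x => ‖iteratedFDeriv ℝ i (h ε) x‖) fun i _ =>
      (hh.bdd K hK i).norm)).pow hw k).mul_small hw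
    ((Bdd.const hw (k.factorial : ℝ)).mul_small hw (Small.sum hw (Finset.range (k + 1))
    (u := fun i ε x => ‖iteratedFDeriv ℝ i (g ε) (h ε x)‖) fun i _ =>
      (Small.comp hw (hg K' hK' i) h1 h2).norm))).of_le ?_
  filter_upwards [eventually_mem_Ioc] with ε hε x hx
  exact (norm_iteratedFDeriv_comp_le_sum hh.isOpen (hs ε hε)
    (hh.smooth ε hε) (hh.subset K hK hx) k).trans ((le_of_eq (mul_comm _ _)).trans (le_abs_self _))

/-- If `g` is bounded by `B` and its derivative varies by at most `M t` on a ball of radius `t`,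
then its derivative at the centre is bounded by `2 B / t + M t`. -/
theorem norm_fderiv_le_of_ball {g : E → F} (hd : Differentiable ℝ g) {x : E}
    {t B M : ℝ} (ht : 0 < t) (hM0 : 0 ≤ M) (hB : ∀ z ∈ Metric.closedBall x t, ‖g z‖ ≤ B)
    (h1 : ∀ z ∈ Metric.closedBall x t, ‖fderiv ℝ g z - fderiv ℝ g x‖ ≤ M * t) :
    ‖fderiv ℝ g x‖ ≤ 2 * B / t + M * t := by
  have hconv := convex_closedBall x t
  have hxt : x ∈ Metric.closedBall x t := Metric.mem_closedBall_self ht.le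
  have hB0 : 0 ≤ B := (norm_nonneg _).trans (hB x hxt)
  refine ContinuousLinearMap.opNorm_le_bound _ (by positivity) fun v => ?_
  rcases eq_or_ne v 0 with rfl | hv
  · simp
  have hv' : 0 < ‖v‖ := norm_pos_iff.2 hv
  -- The direction `v` is rescaled to reach the boundary of the ball. There the linear part of `g`
  -- is compared with the increment of `g`, which is at most `2 B`; dividing by `t` gives the bound.
  have hn : ‖(t / ‖v‖) • v‖ = t := by
    rw [norm_smul, Real.norm_of_nonneg (by positivity)]; field_simp
  have hy : x + (t / ‖v‖) • v ∈ Metric.closedBall x t := by simp [hn]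
  have h3 := hconv.norm_image_sub_le_of_norm_fderiv_le' (𝕜 := ℝ) (fun y _ => hd y) h1 hxt hy
  rw [add_sub_cancel_left, hn, map_smul] at h3
  have h4 := hB _ hy
  have h5 := hB x hxt
  have h6 : ‖(t / ‖v‖) • fderiv ℝ g x v‖ ≤ M * t * t + B + B := by
    set a := g (x + (t / ‖v‖) • v)
    set b := g x
    set c := (t / ‖v‖) • fderiv ℝ g x v
    calc ‖c‖ = ‖-(a - b - c) + a - b‖ := by congr 1; abel
      _ ≤ ‖-(a - b - c) + a‖ + ‖b‖ := norm_sub_le _ _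
      _ ≤ ‖-(a - b - c)‖ + ‖a‖ + ‖b‖ := add_le_add_left (norm_add_le _ _) _
      _ ≤ _ := by rw [norm_neg]; linarith
  rw [norm_smul, Real.norm_of_nonneg (by positivity)] at h6
  calc ‖fderiv ℝ g x v‖ = (t / ‖v‖ * ‖fderiv ℝ g x v‖) * (‖v‖ / t) := by field_simp
    _ ≤ (M * t * t + B + B) * (‖v‖ / t) := mul_le_mul_of_nonneg_right h6 (by positivity)
    _ = _ := by field_simp; ring

/-- Landau–Kolmogorov interpolation: order `k + 1` is controlled by orders `k` and `k + 2` at a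
scale `t` that can be chosen freely, in particular as a power of `ε`. -/
theorem norm_iteratedFDeriv_succ_le_of_ball {f : E → F} (hf : ContDiff ℝ ∞ f) (k : ℕ) {x : E}
    {t B M : ℝ} (ht : 0 < t) (hM0 : 0 ≤ M)
    (hB : ∀ h, ‖h‖ ≤ t → ‖iteratedFDeriv ℝ k f (x + h)‖ ≤ B)
    (hM : ∀ h, ‖h‖ ≤ t → ‖iteratedFDeriv ℝ (k + 2) f (x + h)‖ ≤ M) :
    ‖iteratedFDeriv ℝ (k + 1) f x‖ ≤ 2 * B / t + M * t := by
  have hd : ∀ j, Differentiable ℝ (iteratedFDeriv ℝ j f) := fun j =>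
    hf.differentiable_iteratedFDeriv (m := j) (by exact_mod_cast WithTop.coe_lt_top _)
  have hball : ∀ z ∈ Metric.closedBall x t, ∃ h, ‖h‖ ≤ t ∧ z = x + h := fun z hz =>
    ⟨z - x, by rwa [← dist_eq_norm], by abel⟩
  rw [← norm_fderiv_iteratedFDeriv]
  refine norm_fderiv_le_of_ball (hd k) ht hM0 (fun z hz => ?_) fun z hz => ?_
  · obtain ⟨h, hh, rfl⟩ := hball z hz
    exact hB h hh
  · have h2 := (convex_closedBall x t).norm_image_sub_le_of_norm_fderiv_le (𝕜 := ℝ)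
      (f := iteratedFDeriv ℝ (k + 1) f) (C := M) (fun y _ => hd _ y) (fun y hy => by
        obtain ⟨h, hh, rfl⟩ := hball y hy
        rw [norm_fderiv_iteratedFDeriv]
        exact hM h hh) (Metric.mem_closedBall_self ht.le) hz
    refine (dist_eq_norm _ _).symm.le.trans ?_
    rw [fderiv_iteratedFDeriv]
    refine ((continuousMultilinearCurryLeftEquiv ℝ (fun _ : Fin (k + 1) => E) F).dist_map
      _ _).le.trans ?_
    rw [dist_eq_norm]
    refine h2.trans (mul_le_mul_of_nonneg_left ?_ hM0)
    rwa [← dist_eq_norm]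

/-- A moderate net is negligible as soon as its values are. -/
theorem ModNet.negNet_of_small {u : ℝ → E → F} (hu : ModNet univ S w u)
    (h0 : ∀ K ∈ S, Small K w u)
    (hS : ∀ K ∈ S, ∃ K' ∈ S, ∃ δ > 0, ∀ x ∈ K, ∀ h : E, ‖h‖ ≤ δ → x + h ∈ K' ∧ w (x + h) ≤ w x + 1) :
    NegNet S w u := by
  suffices ∀ k, ∀ K ∈ S, Small K w (fun ε => iteratedFDeriv ℝ k (u ε)) from fun K hK k => this k K hK
  intro k
  induction k with
  | zero =>
    exact fun K hK => (h0 K hK).of_le (.of_forall fun _ _ _ => by rw [norm_iteratedFDeriv_zero])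
  | succ k ih =>
    intro K hK
    obtain ⟨K', hK', δ, hδ, hKK⟩ := hS K hK
    obtain ⟨l, hl⟩ := ih K' hK'
    obtain ⟨N, hN⟩ := hu.bdd K' hK' (k + 2)
    rw [small_iff hu.nonneg]
    -- The scale is `t = ε^(m+N+1)`. Order `k` is taken small to order `m + (m+N+1)`, so `B / t` is
    -- of order `ε^m`, and `M t` is so because `M` costs only `ε^{-N}`. The powers of two come from
    -- `1 + w (x + h) ≤ 2 (1 + w x)`.
    refine ⟨l + N, fun m => ⟨2 * 2 ^ l + 2 ^ N, ?_⟩⟩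
    have hsmall : ∀ᶠ ε : ℝ in 𝓝[>] 0, ε ^ (m + N + 1) ≤ δ := by
      filter_upwards [eventually_mem_Ioo hδ, eventually_mem_Ioc] with ε h1 h2
      exact (pow_le_of_le_one h2.1.le h2.2 (by omega)).trans h1.2.le
    filter_upwards [hl (m + (m + N + 1)), hN, hsmall, eventually_mem_Ioc] with ε h1 h2 h3 h4 x hx
    have hε := h4.1
    have hw := hu.nonneg x
    have hKx := hKK x hx
    have key := norm_iteratedFDeriv_succ_le_of_ball (contDiffOn_univ.1 (hu.smooth ε h4)) k (x := x)
      (t := ε ^ (m + N + 1)) (B := ε ^ (m + (m + N + 1)) * (2 * (1 + w x)) ^ l)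
      (M := (ε⁻¹ * (2 * (1 + w x))) ^ N) (by positivity) (by positivity)
      (fun h hh => (h1 _ (hKx h (hh.trans h3)).1).trans ?_)
      (fun h hh => (h2 _ (hKx h (hh.trans h3)).1).trans ?_)
    · refine key.trans ?_
      have e1 : 2 * (ε ^ (m + (m + N + 1)) * (2 * (1 + w x)) ^ l) / ε ^ (m + N + 1) =
          2 * 2 ^ l * ε ^ m * (1 + w x) ^ l := by
        rw [pow_add ε m, mul_pow]; field_simp
      have e2 : (ε⁻¹ * (2 * (1 + w x))) ^ N * ε ^ (m + N + 1) =
          2 ^ N * (ε ^ m * ε) * (1 + w x) ^ N := by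
        rw [mul_pow, mul_pow, inv_pow, pow_succ, pow_add]; field_simp
      rw [e1, e2]
      have h5 : 1 ≤ 1 + w x := by linarith
      have h6 := pow_le_pow_right₀ h5 (Nat.le_add_right l N)
      have h7 := pow_le_pow_right₀ h5 (Nat.le_add_left N l)
      have h8 : ε ^ m * ε ≤ ε ^ m := mul_le_of_le_one_right (by positivity) h4.2
      calc _ ≤ 2 * 2 ^ l * ε ^ m * (1 + w x) ^ (l + N) + 2 ^ N * ε ^ m * (1 + w x) ^ (l + N) := by
            gcongr
        _ = _ := by ring
    · have := (hKx h (hh.trans h3)).2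
      have := hu.nonneg (x + h)
      gcongr
      linarith
    · have := (hKx h (hh.trans h3)).2
      have := hu.nonneg (x + h)
      gcongr
      linarith

end Derivatives


/-! ### Monomials in families of operators. -/

section Operators

variable {p : ℕ} {A B : Type*}

/-- Induction on the list and then on the exponent reduces statements about `D_J` and `∂^J` to a
single operator. Allowing two different types covers both invariance and intertwining. -/
theorem foldr_rel {T : Fin p → A → A} {T' : Fin p → B → B} {r : A → B → Prop}
    (h : ∀ i a b, r a b → r (T i a) (T' i b)) (J : Fin p → ℕ) (l : List (Fin p)) {a : A} {b : B}
    (hab : r a b) : r (l.foldr (fun i S => (T i)^[J i] ∘ S) id a)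
      (l.foldr (fun i S => (T' i)^[J i] ∘ S) id b) := by
  induction l with
  | nil => exact hab
  | cons i l ih =>
    simp only [List.foldr_cons, Function.comp_apply]
    generalize l.foldr (fun i S => (T i)^[J i] ∘ S) id a = a' at ih
    generalize l.foldr (fun i S => (T' i)^[J i] ∘ S) id b = b' at ih
    induction J i with
    | zero => exact ih
    | succ k ihk =>
      rw [Function.iterate_succ_apply', Function.iterate_succ_apply']
      exact h _ _ _ ihk

/-- A relation preserved by the operators is preserved by their monomials. -/
theorem opPow_rel {T : Fin p → A → A} {T' : Fin p → B → B} (r : A → B → Prop)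
    (h : ∀ i a b, r a b → r (T i a) (T' i b)) (J : Fin p → ℕ) {a : A} {b : B}
    (hab : r a b) : r (opPow T J a) (opPow T' J b) :=
  foldr_rel h J _ hab

theorem opPow_induction {T : Fin p → A → A} (P : A → Prop) (h : ∀ i a, P a → P (T i a))
    (J : Fin p → ℕ) {a : A} (ha : P a) : P (opPow T J a) :=
  opPow_rel (fun a _ => P a) (fun i a _ => h i a) (T' := fun _ => id) J (b := a) ha

/-- An operator which intertwines `T` and `T'` intertwines their monomials. -/
theorem opPow_semiconj {T : Fin p → A → A} {T' : Fin p → B → B} (P : A → Prop) (S : A → B)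
    (h : ∀ i a, P a → P (T i a)) (hS : ∀ i a, P a → S (T i a) = T' i (S a)) (J : Fin p → ℕ)
    {a : A} (ha : P a) : S (opPow T J a) = opPow T' J (S a) :=
  (opPow_rel (fun a b => P a ∧ S a = b)
    (fun i a b hab => ⟨h i a hab.1, by rw [hS i a hab.1, hab.2]⟩) J ⟨ha, rfl⟩).2

/-- The operators commute only on a class `P`, such as smooth functions or functions of finite
order, so `P` has to be carried along while the extra factor is moved to the outside. -/
theorem opPow_add_single {T : Fin p → A → A} (P : A → Prop) (h : ∀ i a, P a → P (T i a))
    (hc : ∀ i j a, P a → T i (T j a) = T j (T i a)) (J : Fin p → ℕ) (i : Fin p)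
    {a : A} (ha : P a) : opPow T (J + Pi.single i 1) a = T i (opPow T J a) := by
  have hit : ∀ j k b, P b → P ((T j)^[k] b) := fun j k b hb => by
    induction k with
    | zero => exact hb
    | succ k ih => rw [Function.iterate_succ_apply']; exact h _ _ ih
  have hcit : ∀ j k b, P b → T i ((T j)^[k] b) = (T j)^[k] (T i b) := fun j k b hb => by
    induction k with
    | zero => rfl
    | succ k ih =>
      rw [Function.iterate_succ_apply', Function.iterate_succ_apply', hc _ _ _ (hit j k b hb), ih]
  have hl : ∀ l : List (Fin p), P (l.foldr (fun i S => (T i)^[J i] ∘ S) id a) := fun l =>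
    foldr_rel (r := fun a (_ : A) => P a) (fun i a _ => h i a) (T' := fun _ => id) J l (b := a) ha
  -- Without repetitions the index `i` is met exactly once, so exactly one additional factor `T i`
  -- arises; the later steps commute it outwards.
  have key : ∀ l : List (Fin p), l.Nodup →
      l.foldr (fun j S => (T j)^[(J + Pi.single i 1 : Fin p → ℕ) j] ∘ S) id a =
        if i ∈ l then T i (l.foldr (fun j S => (T j)^[J j] ∘ S) id a)
        else l.foldr (fun j S => (T j)^[J j] ∘ S) id a := by
    intro l
    induction l with
    | nil => simp
    | cons j l ih =>
      intro hnd
      rw [List.nodup_cons] at hnd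
      simp only [List.foldr_cons, Function.comp_apply, ih hnd.2]
      by_cases hij : i = j
      · subst hij
        simp [hnd.1, Function.iterate_succ_apply']
      · simp only [List.mem_cons, hij, false_or, Pi.add_apply,
          Pi.single_eq_of_ne (Ne.symm hij), add_zero]
        split_ifs
        · rw [hcit j _ _ (hl l)]
        · rfl
  simpa [opPow] using key _ (List.nodup_finRange p)

theorem opPow_zero (T : Fin p → A → A) (a : A) : opPow T 0 a = a := by
  have : ∀ l : List (Fin p), l.foldr (fun j S => (T j)^[(0 : Fin p → ℕ) j] ∘ S) id a = a := by
    intro l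
    induction l with
    | nil => rfl
    | cons j l ih => simpa using ih
  exact this _

theorem opPow_single {T : Fin p → A → A} (P : A → Prop) (h : ∀ i a, P a → P (T i a))
    (hc : ∀ i j a, P a → T i (T j a) = T j (T i a)) (i : Fin p) {a : A} (ha : P a) :
    opPow T (Pi.single i 1) a = T i a := by
  have := opPow_add_single P h hc 0 i ha
  rwa [zero_add, opPow_zero] at this

end Operators

/-! ### Partial derivatives, and total derivatives along prolongations. -/

section Partials

variable {p q : ℕ}

theorem contDiff_partialX {g : (Fin p → ℝ) → ℝ} (hg : ContDiff ℝ ∞ g) (i : Fin p) :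
    ContDiff ℝ ∞ (partialX i g) :=
  (hg.fderiv_right (m := ∞) (by simp)).clm_apply contDiff_const

theorem partialX_comm {g : (Fin p → ℝ) → ℝ} (hg : ContDiff ℝ ∞ g) (i j : Fin p) :
    partialX i (partialX j g) = partialX j (partialX i g) := by
  have hd : Differentiable ℝ (fderiv ℝ g) :=
    (hg.fderiv_right (m := ∞) (by simp)).differentiable (by simp)
  have key : ∀ (v w : Fin p → ℝ) x, fderiv ℝ (fun y => fderiv ℝ g y v) x w =
      fderiv ℝ (fderiv ℝ g) x w v := fun v w x => by
    rw [fderiv_clm_apply (hd x) (differentiableAt_const v)]; simp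
  ext x
  change fderiv ℝ (fun y => fderiv ℝ g y _) x _ = fderiv ℝ (fun y => fderiv ℝ g y _) x _
  rw [key, key]
  exact (hg.contDiffAt.isSymmSndFDerivAt (by rw [minSmoothness_of_isRCLikeNormedField]; norm_cast)).eq _ _

theorem contDiff_opPow_partialX {g : (Fin p → ℝ) → ℝ} (hg : ContDiff ℝ ∞ g) (J : Fin p → ℕ) :
    ContDiff ℝ ∞ (opPow partialX J g) :=
  opPow_induction (ContDiff ℝ ∞) (fun i _ h => contDiff_partialX h i) J hg

theorem opPow_partialX_add_single {g : (Fin p → ℝ) → ℝ} (hg : ContDiff ℝ ∞ g) (J : Fin p → ℕ)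
    (i : Fin p) : opPow partialX (J + Pi.single i 1) g = partialX i (opPow partialX J g) :=
  opPow_add_single (ContDiff ℝ ∞) (fun i _ h => contDiff_partialX h i)
    (fun i j _ h => partialX_comm h i j) J i hg

theorem contDiff_component {f : (Fin p → ℝ) → (Fin q → ℝ)} (hf : ContDiff ℝ ∞ f) (α : Fin q) :
    ContDiff ℝ ∞ (fun y => f y α) := contDiff_pi.1 hf α

theorem hasFDerivAt_truncate_prolong {f : (Fin p → ℝ) → (Fin q → ℝ)} (hf : ContDiff ℝ ∞ f)
    (m : ℕ) (x : Fin p → ℝ) : HasFDerivAt (fun y => truncate m (prolong f y))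
      ((ContinuousLinearMap.id ℝ (Fin p → ℝ)).prod (ContinuousLinearMap.pi fun α =>
        ContinuousLinearMap.pi fun J : MultiIndex p m =>
          fderiv ℝ (opPow partialX J.1 (fun y => f y α)) x)) x := by
  refine (hasFDerivAt_id x).prodMk (hasFDerivAt_pi.2 fun α => hasFDerivAt_pi.2 fun J => ?_)
  exact ((contDiff_opPow_partialX (contDiff_component hf α) J.1).differentiable
    (by simp) x).hasFDerivAt

theorem contDiff_truncate_prolong {f : (Fin p → ℝ) → (Fin q → ℝ)} (hf : ContDiff ℝ ∞ f) (m : ℕ) :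
    ContDiff ℝ ∞ (fun y => truncate m (prolong f y)) :=
  contDiff_id.prodMk (contDiff_pi.2 fun α => contDiff_pi.2 fun J =>
    contDiff_opPow_partialX (contDiff_component hf α) J.1)

/-- Truncation is linear, so a line derivative on jets of unrestricted order is one on a
finite-dimensional space, where `fderiv` becomes available. -/
theorem lineDeriv_comp_truncate {m : ℕ} (g : Jet p q m → ℝ) (z v : JetInf p q) :
    lineDeriv ℝ (g ∘ truncate m) z v = lineDeriv ℝ g (truncate m z) (truncate m v) := rfl

theorem totalD_comp_truncate {m : ℕ} {g : Jet p q m → ℝ} (i : Fin p) (z : JetInf p q)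
    (hg : DifferentiableAt ℝ g (truncate m z)) : totalD i (g ∘ truncate m) z =
      fderiv ℝ g (truncate m z) (Pi.single i 1, fun α J => z.2 α (J.1 + Pi.single i 1)) := by
  rw [totalD, lineDeriv_comp_truncate, hg.lineDeriv_eq_fderiv]
  rfl

theorem partialU_comp_truncate {m : ℕ} {g : Jet p q m → ℝ} (α : Fin q) (J : MultiIndex p m)
    (z : JetInf p q) (hg : DifferentiableAt ℝ g (truncate m z)) :
    partialU α J.1 (g ∘ truncate m) z =
      fderiv ℝ g (truncate m z) (0, Pi.single α (Pi.single J 1)) := by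
  have : truncate m ((0, Pi.single α (Pi.single J.1 1)) : JetInf p q) =
      (0, Pi.single α (Pi.single J 1)) := by
    refine Prod.ext rfl ?_
    funext β K
    by_cases hb : β = α
    · subst hb
      by_cases hK : K = J
      · subst hK; simp [truncate]
      · simp [truncate, Pi.single_apply, hK, Subtype.ext_iff.not.1 hK]
    · simp [truncate, Pi.single_apply, hb]
  rw [← this, partialU, lineDeriv_comp_truncate, hg.lineDeriv_eq_fderiv]

/-- The total derivative restricts to the partial derivative along prolongations. -/
theorem totalD_prolong {m : ℕ} {g : Jet p q m → ℝ} (hg : ContDiff ℝ ∞ g)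
    {f : (Fin p → ℝ) → (Fin q → ℝ)} (hf : ContDiff ℝ ∞ f) (i : Fin p) (x : Fin p → ℝ) :
    totalD i (g ∘ truncate m) (prolong f x) =
      partialX i (fun y => (g ∘ truncate m) (prolong f y)) x := by
  have hg' := hg.differentiable (by simp) (truncate m (prolong f x))
  rw [totalD_comp_truncate i _ hg', partialX]
  have := hg'.hasFDerivAt.comp x (hasFDerivAt_truncate_prolong hf m x)
  change _ = fderiv ℝ (g ∘ fun y => truncate m (prolong f y)) x _
  rw [this.fderiv, ContinuousLinearMap.comp_apply]
  congr 1
  refine Prod.ext rfl ?_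
  funext α J
  change opPow partialX (J.1 + Pi.single i 1) (fun y => f y α) x = _
  rw [opPow_partialX_add_single (contDiff_component hf α)]
  rfl

end Partials

/-! ### Taylor polynomials with prescribed jets. -/

section JetPolynomials

variable {p q : ℕ}

/-- Differentiation lowers the degree of a normalised monomial by one and leaves the normalisation
intact, so these monomials are dual to the iterated derivatives at `a`. -/
theorem iterate_deriv_monomial (a : ℝ) (k n : ℕ) :
    deriv^[k] (fun t => (t - a) ^ n / n.factorial) a = if k = n then 1 else 0 := by
  induction k generalizing n with
  | zero => cases n <;> simp
  | succ k ih =>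
    rw [Function.iterate_succ_apply]
    cases n with
    | zero =>
      have : deriv (fun t : ℝ => (t - a) ^ 0 / (Nat.factorial 0 : ℝ)) = fun _ => 0 := by
        ext t; simp
      rw [this]
      have h0 : ∀ k, deriv^[k] (fun _ : ℝ => (0 : ℝ)) = fun _ => 0 := fun k => by
        induction k with
        | zero => rfl
        | succ k ih => rw [Function.iterate_succ_apply', ih]; ext; simp
      simp [h0]
    | succ n =>
      have : deriv (fun t : ℝ => (t - a) ^ (n + 1) / (Nat.factorial (n + 1) : ℝ)) =
          fun t => (t - a) ^ n / n.factorial := by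
        ext t
        have h := ((hasDerivAt_id' t).sub_const a).fun_pow (n + 1)
        rw [deriv_div_const, h.deriv]
        simp [Nat.factorial_succ]
        field_simp
      rw [this, ih]
      simp

/-- On a product of one-variable functions `∂_i` differentiates the `i`-th factor only. Modelling
this on tuples of factors reduces `∂^J` of a product to ordinary iterated derivatives. -/
theorem opPow_update_deriv (φ : Fin p → ℝ → ℝ) (J : Fin p → ℕ) :
    opPow (fun i φ => Function.update φ i (deriv (φ i))) J φ = fun i => deriv^[J i] (φ i) := by
  have hit : ∀ (i : Fin p) k (χ : Fin p → ℝ → ℝ),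
      (fun χ : Fin p → ℝ → ℝ => Function.update χ i (deriv (χ i)))^[k] χ =
        Function.update χ i (deriv^[k] (χ i)) := fun i k χ => by
    induction k with
    | zero => simp
    | succ k ih => rw [Function.iterate_succ_apply', ih, Function.iterate_succ_apply']; simp
  have key : ∀ l : List (Fin p), l.Nodup →
      l.foldr (fun i S => (fun χ : Fin p → ℝ → ℝ =>
        Function.update χ i (deriv (χ i)))^[J i] ∘ S) id φ =
        fun i => if i ∈ l then deriv^[J i] (φ i) else φ i := by
    intro l
    induction l with
    | nil => simp
    | cons j l ih =>
      intro hnd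
      rw [List.nodup_cons] at hnd
      simp only [List.foldr_cons, Function.comp_apply, ih hnd.2, hit]
      ext1 i
      by_cases hij : i = j
      · subst hij; simp [hnd.1]
      · simp [hij]
  simpa [opPow] using key _ (List.nodup_finRange p)

theorem partialX_prod {φ : Fin p → ℝ → ℝ} (hφ : ∀ i, ContDiff ℝ ∞ (φ i)) (i : Fin p) :
    partialX i (fun x => ∏ j, φ j (x j)) =
      fun x => ∏ j, Function.update φ i (deriv (φ i)) j (x j) := by
  ext x
  have h1 : HasFDerivAt (fun x : Fin p → ℝ => ∏ j, φ j (x j))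
      (∑ j, (∏ k ∈ Finset.univ.erase j, φ k (x k)) •
        (deriv (φ j) (x j) • ContinuousLinearMap.proj (R := ℝ) (φ := fun _ => ℝ) j)) x := by
    refine HasFDerivAt.finsetProd fun j _ => ?_
    exact (((hφ j).differentiable (by simp) (x j)).hasDerivAt).comp_hasFDerivAt x
      (hasFDerivAt_apply j x)
  rw [partialX, h1.fderiv, sum_apply, Finset.sum_eq_single i]
  · rw [← Finset.mul_prod_erase _ _ (Finset.mem_univ i)]
    simp only [smul_apply, ContinuousLinearMap.proj_apply, Pi.single_eq_same,
      smul_eq_mul, mul_one, Function.update_self]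
    rw [mul_comm]
    congr 1
    refine Finset.prod_congr rfl fun j hj => ?_
    rw [Function.update_of_ne (Finset.ne_of_mem_erase hj)]
  · intro j _ hj
    simp [Pi.single_eq_of_ne hj]
  · simp

theorem opPow_partialX_prod {φ : Fin p → ℝ → ℝ} (hφ : ∀ i, ContDiff ℝ ∞ (φ i)) (J : Fin p → ℕ) :
    opPow partialX J (fun x => ∏ j, φ j (x j)) = fun x => ∏ j, deriv^[J j] (φ j) (x j) := by
  rw [← opPow_semiconj (T := fun i φ => Function.update φ i (deriv (φ i)))
    (fun φ : Fin p → ℝ → ℝ => ∀ i, ContDiff ℝ ∞ (φ i)) (fun φ (x : Fin p → ℝ) => ∏ j, φ j (x j))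
    (fun i φ h j => ?_) (fun i φ h => (partialX_prod h i).symm) J hφ, opPow_update_deriv]
  by_cases hij : j = i
  · subst hij
    rw [Function.update_self]
    exact (contDiff_infty_iff_deriv.1 (h j)).2
  · rw [Function.update_of_ne hij]; exact h j

theorem opPow_partialX_sum {ι : Type*} [Fintype ι] (c : ι → ℝ) {a : ι → (Fin p → ℝ) → ℝ}
    (ha : ∀ i, ContDiff ℝ ∞ (a i)) (J : Fin p → ℕ) :
    opPow partialX J (fun x => ∑ i, c i * a i x) = fun x => ∑ i, c i * opPow partialX J (a i) x := by
  have h := opPow_semiconj (T := fun j (a : ι → (Fin p → ℝ) → ℝ) i => partialX j (a i))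
    (T' := partialX)
    (fun a => ∀ i, ContDiff ℝ ∞ (a i)) (fun a (x : Fin p → ℝ) => ∑ i, c i * a i x)
    (fun j a h i => contDiff_partialX (h i) j) (fun j a h => ?_) J ha
  · rw [← h]
    ext x
    refine Finset.sum_congr rfl fun i _ => ?_
    rw [opPow_semiconj (T := fun j (a : ι → (Fin p → ℝ) → ℝ) i => partialX j (a i))
      (T' := partialX) (fun _ => True) (fun a => a i) (fun _ _ _ => trivial)
      (fun _ _ _ => rfl) J trivial]
  · ext x
    have : HasFDerivAt (fun x => ∑ i, c i * a i x) (∑ i, c i • fderiv ℝ (a i) x) x :=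
      HasFDerivAt.fun_sum fun i _ => ((h i).differentiable (by simp) x).hasFDerivAt.const_mul (c i)
    rw [partialX, this.fderiv, sum_apply]
    rfl

/-- The polynomial with prescribed derivatives at a point. -/
noncomputable def jetPoly {N : ℕ} (z : Jet p q N) : (Fin p → ℝ) → (Fin q → ℝ) :=
  fun x α => ∑ J : MultiIndex p N, z.2 α J * ∏ i, ((x i - z.1 i) ^ J.1 i / (J.1 i).factorial)

theorem contDiff_monomial (a : ℝ) (n : ℕ) :
    ContDiff ℝ ∞ (fun t : ℝ => (t - a) ^ n / n.factorial) :=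
  ((contDiff_id.sub contDiff_const).pow n).div_const _

/-- At the base point `∂^K` of the `J`-th normalised monomial is a Kronecker delta, and all orders
above `N` vanish. Hence every finite jet comes from a globally defined polynomial, and identities on
jets can be tested on functions. -/
theorem prolong_jetPoly {N : ℕ} (z : Jet p q N) : prolong (jetPoly z) z.1 = extend z := by
  refine Prod.ext rfl ?_
  funext α K
  change opPow partialX K (fun x => ∑ J : MultiIndex p N, z.2 α J * _) z.1 = _
  rw [opPow_partialX_sum (fun J : MultiIndex p N => z.2 α J)
    (a := fun (J : MultiIndex p N) x => ∏ i, ((x i - z.1 i) ^ J.1 i / (J.1 i).factorial))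
    (fun J => contDiff_prod fun i _ => (contDiff_monomial _ _).comp (contDiff_apply _ _ i))]
  have h : ∀ J : MultiIndex p N, opPow partialX K
      (fun x => ∏ i, ((x i - z.1 i) ^ J.1 i / (J.1 i).factorial)) z.1 =
      if K = J.1 then 1 else 0 := fun J => by
    rw [opPow_partialX_prod (φ := fun i t => (t - z.1 i) ^ J.1 i / (J.1 i).factorial)
      fun i => contDiff_monomial _ _]
    simp only [iterate_deriv_monomial]
    rw [Finset.prod_ite_zero]
    simp [funext_iff]
  simp only [h, extend]
  split_ifs with hK
  · rw [Finset.sum_eq_single ⟨K, hK⟩]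
    · simp
    · rintro J _ hJ
      rw [if_neg fun hKJ => hJ (Subtype.ext hKJ.symm), mul_zero]
    · simp
  · refine Finset.sum_eq_zero fun J _ => ?_
    rw [if_neg fun hKJ => hK (by rw [hKJ]; exact J.2), mul_zero]

theorem contDiff_jetPoly {N : ℕ} (z : Jet p q N) : ContDiff ℝ ∞ (jetPoly z) :=
  contDiff_pi.2 fun _ => ContDiff.sum fun _ _ => contDiff_const.mul
    (contDiff_prod fun i _ => (contDiff_monomial _ _).comp (contDiff_apply _ _ i))

end JetPolynomials


/-! ### Further operations on moderate nets. -/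

section MoreNets

variable {E E' F G : Type*} [NormedAddCommGroup E] [NormedSpace ℝ E]
  [NormedAddCommGroup E'] [NormedSpace ℝ E'] [NormedAddCommGroup F] [NormedSpace ℝ F]
  [NormedAddCommGroup G] [NormedSpace ℝ G]
  {W : Set E} {S : Set (Set E)} {w : E → ℝ}

theorem ModNet.fderiv {u : ℝ → E → F} (hu : ModNet W S w u) :
    ModNet W S w (fun ε => fderiv ℝ (u ε)) := by
  refine hu.toIsFrame.modNet (fun ε hε => (hu.smooth ε hε).fderiv_of_isOpen hu.isOpen (by simp))
    fun K hK k => (hu.bdd K hK (k + 1)).of_le (.of_forall fun ε x hx => ?_)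
  rw [norm_iteratedFDeriv_fderiv]

theorem ModNet.clm_apply {u : ℝ → E → F →L[ℝ] G} {v : ℝ → E → F} (hu : ModNet W S w u)
    (hv : ModNet W S w v) : ModNet W S w (fun ε x => u ε x (v ε x)) :=
  hu.bilin (ContinuousLinearMap.id ℝ (F →L[ℝ] G)) hv

/-- Composition of a tempered net with a continuous linear map. -/
theorem ModNet.comp_clm {A : Set E} {A' : Set E'} {g : ℝ → E' → F}
    (hg : ModNet univ {A'} (fun y => ‖y‖) g) (B : E →L[ℝ] E') (hB : MapsTo B A A') :
    ModNet univ {A} (fun x => ‖x‖) (fun ε x => g ε (B x)) := by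
  refine hg.comp ((isFrame_norm A).modNet_clm B fun K _ => bdd_clm_of_norm K B) fun K hK => ?_
  rw [mem_singleton_iff.1 hK]
  exact ⟨A', rfl, .of_forall fun _ x hx => hB hx, (bdd_clm_of_norm A B).norm⟩

end MoreNets

/-! ### Functions of finitely many jet coordinates, and integration by parts for total derivatives.
-/

section JetNets

variable {p q : ℕ}

/-- The projection of jets of order `m'` onto jets of order `m ≤ m'`. -/
noncomputable def jetProj {m m' : ℕ} (h : m ≤ m') : Jet p q m' →L[ℝ] Jet p q m :=
  (ContinuousLinearMap.fst ℝ _ _).prod (ContinuousLinearMap.pi fun α =>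
    ContinuousLinearMap.pi fun J : MultiIndex p m =>
      (ContinuousLinearMap.proj (R := ℝ) (φ := fun _ : MultiIndex p m' => ℝ)
        ⟨J.1, J.2.trans h⟩).comp
      ((ContinuousLinearMap.proj (R := ℝ) (φ := fun _ : Fin q => MultiIndex p m' → ℝ) α).comp
        (ContinuousLinearMap.snd ℝ (Fin p → ℝ) (Fin q → MultiIndex p m' → ℝ))))

theorem sum_add_single (J : Fin p → ℕ) (i : Fin p) :
    ∑ j, (J + Pi.single i 1 : Fin p → ℕ) j = ∑ j, J j + 1 := by
  simp [Finset.sum_add_distrib]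

/-- The linear map sending the jet coordinates `u_J` to `u_{J,i}`. -/
noncomputable def jetShift (m : ℕ) (i : Fin p) : Jet p q (m + 1) →L[ℝ] Jet p q m :=
  (0 : Jet p q (m + 1) →L[ℝ] (Fin p → ℝ)).prod (ContinuousLinearMap.pi fun α =>
    ContinuousLinearMap.pi fun J : MultiIndex p m =>
      (ContinuousLinearMap.proj (R := ℝ) (φ := fun _ : MultiIndex p (m + 1) => ℝ)
        ⟨J.1 + Pi.single i 1, (sum_add_single J.1 i).le.trans (Nat.succ_le_succ J.2)⟩).comp
      ((ContinuousLinearMap.proj (R := ℝ) (φ := fun _ : Fin q => MultiIndex p (m + 1) → ℝ) α).comp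
        (ContinuousLinearMap.snd ℝ (Fin p → ℝ) (Fin q → MultiIndex p (m + 1) → ℝ))))

/-- The direction of `D_i` is a constant plus a continuous linear function of the `(m+1)`-jet;
smoothness and temperedness of `D_i g` are read off from this. -/
theorem direction_eq {m : ℕ} (i : Fin p) (z : JetInf p q) :
    ((Pi.single i 1, fun α (J : MultiIndex p m) => z.2 α (J.1 + Pi.single i 1)) : Jet p q m) =
      (Pi.single i 1, 0) + jetShift m i (truncate (m + 1) z) := by
  refine Prod.ext ?_ ?_
  · simp [jetShift]
  · funext α J; simp [jetShift, truncate]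

/-- Functions depending smoothly on finitely many jet coordinates. -/
def FinOrder (F : JetInf p q → ℝ) : Prop :=
  ∃ (m : ℕ) (g : Jet p q m → ℝ), ContDiff ℝ ∞ g ∧ F = g ∘ truncate m

/-- Nets of functions of jets of order `m`, tempered over `A`. -/
def JetNet (A : Set (Fin p → ℝ)) (m : ℕ) (F : ℝ → JetInf p q → ℝ) : Prop :=
  ∃ g : ℝ → Jet p q m → ℝ, (∀ ε, ContDiff ℝ ∞ (g ε)) ∧
    ModNet univ {A ×ˢ univ} (fun z => ‖z‖) g ∧ ∀ ε, F ε = g ε ∘ truncate m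

variable {A : Set (Fin p → ℝ)} {m m' : ℕ} {F G : ℝ → JetInf p q → ℝ}

theorem JetNet.finOrder (hF : JetNet A m F) (ε : ℝ) : FinOrder (F ε) := by
  obtain ⟨g, h1, _, h3⟩ := hF
  exact ⟨m, g ε, h1 ε, h3 ε⟩

theorem JetNet.mono (hF : JetNet A m F) (h : m ≤ m') : JetNet A m' F := by
  obtain ⟨g, h1, h2, h3⟩ := hF
  exact ⟨fun ε z => g ε (jetProj h z), fun ε => (h1 ε).comp (jetProj h).contDiff,
    h2.comp_clm (jetProj h) fun z hz => ⟨hz.1, mem_univ _⟩, h3⟩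

theorem JetNet.add (hF : JetNet A m F) (hG : JetNet A m G) :
    JetNet A m (fun ε z => F ε z + G ε z) := by
  obtain ⟨g, h1, h2, h3⟩ := hF
  obtain ⟨k, k1, k2, k3⟩ := hG
  exact ⟨_, fun ε => (h1 ε).add (k1 ε), h2.add k2, fun ε => by ext z; simp [h3, k3]⟩

theorem JetNet.mul (hF : JetNet A m F) (hG : JetNet A m G) :
    JetNet A m (fun ε z => F ε z * G ε z) := by
  obtain ⟨g, h1, h2, h3⟩ := hF
  obtain ⟨k, k1, k2, k3⟩ := hG
  exact ⟨_, fun ε => (h1 ε).mul (k1 ε), h2.mul k2, fun ε => by ext z; simp [h3, k3]⟩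

theorem JetNet.neg (hF : JetNet A m F) : JetNet A m (fun ε z => - F ε z) := by
  obtain ⟨g, h1, h2, h3⟩ := hF
  exact ⟨_, fun ε => (h1 ε).neg, h2.neg, fun ε => by ext z; simp [h3]⟩

theorem JetNet.const (c : ℝ) : JetNet (q := q) A m (fun _ _ => c) :=
  ⟨fun _ _ => c, fun _ => contDiff_const, (isFrame_norm _).modNet_const fun _ _ =>
    Bdd.const (fun _ => norm_nonneg _) c, fun _ => rfl⟩

theorem JetNet.sub (hF : JetNet A m F) (hG : JetNet A m G) :
    JetNet A m (fun ε z => F ε z - G ε z) := by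
  simpa only [sub_eq_add_neg] using hF.add hG.neg

theorem JetNet.sum {ι : Type*} (s : Finset ι) {F : ι → ℝ → JetInf p q → ℝ}
    (hF : ∀ i ∈ s, JetNet A m (F i)) : JetNet A m (fun ε z => ∑ i ∈ s, F i ε z) := by
  classical
  induction s using Finset.induction_on with
  | empty => simpa using JetNet.const 0
  | insert a s ha ih =>
    simp only [Finset.sum_insert ha]
    exact (hF a (by simp)).add (ih fun i hi => hF i (by simp [hi]))

theorem JetNet.totalD (hF : JetNet A m F) (i : Fin p) :
    JetNet A (m + 1) (fun ε => totalD i (F ε)) := by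
  obtain ⟨g, h1, h2, h3⟩ := hF
  have hle : m ≤ m + 1 := Nat.le_succ m
  refine ⟨fun ε z => fderiv ℝ (g ε) (jetProj hle z) ((Pi.single i 1, 0) + jetShift m i z),
    fun ε => ?_, ?_, fun ε => ?_⟩
  · exact (((h1 ε).fderiv_right (m := ∞) (by simp)).comp (jetProj hle).contDiff).clm_apply
      (contDiff_const.add (jetShift m i).contDiff)
  · have hf := isFrame_norm (A ×ˢ (univ : Set (Fin q → MultiIndex p (m + 1) → ℝ)))
    refine (h2.fderiv.comp_clm (jetProj hle) fun z hz => ⟨hz.1, mem_univ _⟩).clm_apply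
      ((hf.modNet_const fun _ _ => Bdd.const (fun _ => norm_nonneg _) _).add
      (hf.modNet_clm _ fun _ _ => bdd_clm_of_norm _ _))
  · ext z
    change Colombeau.totalD i (F ε) z = _
    rw [h3, totalD_comp_truncate _ _ ((h1 ε).differentiable (by simp) _), direction_eq]
    rfl

theorem JetNet.partialU (hF : JetNet A m F) (α : Fin q) (J : MultiIndex p m) :
    JetNet A m (fun ε => partialU α J.1 (F ε)) := by
  obtain ⟨g, h1, h2, h3⟩ := hF
  refine ⟨fun ε z => fderiv ℝ (g ε) z (0, Pi.single α (Pi.single J 1)), fun ε => ?_,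
    h2.fderiv_apply _, fun ε => ?_⟩
  · exact ((h1 ε).fderiv_right (m := ∞) (by simp)).clm_apply contDiff_const
  · ext z
    change Colombeau.partialU α J.1 (F ε) z = _
    rw [h3, partialU_comp_truncate _ _ _ ((h1 ε).differentiable (by simp) _)]
    rfl

theorem truncate_extend (w : Jet p q m) : truncate m (extend w) = w := by
  refine Prod.ext rfl ?_
  funext α J
  exact dif_pos J.2

theorem FinOrder.exists_common {F G : JetInf p q → ℝ} (hF : FinOrder F) (hG : FinOrder G) :
    ∃ (m : ℕ) (g k : Jet p q m → ℝ), ContDiff ℝ ∞ g ∧ ContDiff ℝ ∞ k ∧ F = g ∘ truncate m ∧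
      G = k ∘ truncate m := by
  obtain ⟨m, g, hg, rfl⟩ := hF
  obtain ⟨m', k, hk, rfl⟩ := hG
  exact ⟨max m m', fun z => g (jetProj (le_max_left _ _) z),
    fun z => k (jetProj (le_max_right _ _) z), hg.comp (jetProj _).contDiff,
    hk.comp (jetProj _).contDiff, rfl, rfl⟩

theorem FinOrder.totalD {F : JetInf p q → ℝ} (hF : FinOrder F) (i : Fin p) :
    FinOrder (totalD i F) := by
  obtain ⟨m, g, hg, rfl⟩ := hF
  refine ⟨m + 1, fun z => fderiv ℝ g (jetProj (Nat.le_succ m) z)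
    ((Pi.single i 1, 0) + jetShift m i z), ?_, ?_⟩
  · exact ((hg.fderiv_right (m := ∞) (by simp)).comp (jetProj _).contDiff).clm_apply
      (contDiff_const.add (jetShift m i).contDiff)
  · ext z
    rw [totalD_comp_truncate _ _ (hg.differentiable (by simp) _), direction_eq]
    rfl

theorem FinOrder.add {F G : JetInf p q → ℝ} (hF : FinOrder F) (hG : FinOrder G) :
    FinOrder (fun z => F z + G z) := by
  obtain ⟨m, g, k, hg, hk, rfl, rfl⟩ := hF.exists_common hG
  exact ⟨m, _, hg.add hk, rfl⟩

theorem FinOrder.const (c : ℝ) : FinOrder (fun _ : JetInf p q => c) :=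
  ⟨0, fun _ => c, contDiff_const, rfl⟩

theorem totalD_add {F G : JetInf p q → ℝ} (hF : FinOrder F) (hG : FinOrder G) (i : Fin p)
    (z : JetInf p q) : totalD i (fun z => F z + G z) z = totalD i F z + totalD i G z := by
  obtain ⟨m, g, k, hg, hk, rfl, rfl⟩ := hF.exists_common hG
  have hg' := hg.differentiable (by simp) (truncate m z)
  have hk' := hk.differentiable (by simp) (truncate m z)
  rw [totalD_comp_truncate _ _ hg', totalD_comp_truncate _ _ hk']
  change totalD i ((fun w => g w + k w) ∘ truncate m) z = _
  rw [totalD_comp_truncate _ _ (hg'.fun_add hk'), fderiv_fun_add hg' hk']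
  rfl

theorem totalD_mul {F G : JetInf p q → ℝ} (hF : FinOrder F) (hG : FinOrder G) (i : Fin p)
    (z : JetInf p q) :
    totalD i (fun z => F z * G z) z = F z * totalD i G z + totalD i F z * G z := by
  obtain ⟨m, g, k, hg, hk, rfl, rfl⟩ := hF.exists_common hG
  have hg' := hg.differentiable (by simp) (truncate m z)
  have hk' := hk.differentiable (by simp) (truncate m z)
  rw [totalD_comp_truncate _ _ hg', totalD_comp_truncate _ _ hk']
  change totalD i ((fun w => g w * k w) ∘ truncate m) z = _
  rw [totalD_comp_truncate _ _ (hg'.fun_mul hk'), fderiv_fun_mul hg' hk']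
  simp only [add_apply, smul_apply, smul_eq_mul, Function.comp_apply]
  ring

theorem totalD_const (c : ℝ) (i : Fin p) (z : JetInf p q) : totalD i (fun _ => c) z = 0 := by
  simp [totalD, lineDeriv]

theorem totalD_neg (F : JetInf p q → ℝ) (i : Fin p) (z : JetInf p q) :
    totalD i (fun z => - F z) z = - totalD i F z := by
  simp [totalD, lineDeriv]

theorem FinOrder.sum {ι : Type*} (s : Finset ι) {F : ι → JetInf p q → ℝ}
    (hF : ∀ i ∈ s, FinOrder (F i)) : FinOrder (fun z => ∑ i ∈ s, F i z) := by
  classical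
  induction s using Finset.induction_on with
  | empty => simpa using FinOrder.const 0
  | insert a s ha ih =>
    simp only [Finset.sum_insert ha]
    exact (hF a (by simp)).add (ih fun i hi => hF i (by simp [hi]))

theorem totalD_sum {ι : Type*} (s : Finset ι) {F : ι → JetInf p q → ℝ}
    (hF : ∀ i ∈ s, FinOrder (F i)) (i : Fin p) (z : JetInf p q) :
    totalD i (fun z => ∑ j ∈ s, F j z) z = ∑ j ∈ s, totalD i (F j) z := by
  classical
  induction s using Finset.induction_on with
  | empty => simpa using totalD_const 0 i z
  | insert a s ha ih =>
    simp only [Finset.sum_insert ha]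
    rw [totalD_add (hF a (by simp)) (FinOrder.sum s fun i hi => hF i (by simp [hi])),
      ih fun i hi => hF i (by simp [hi])]

theorem FinOrder.totalD_prolong {F : JetInf p q → ℝ} (hF : FinOrder F)
    {f : (Fin p → ℝ) → (Fin q → ℝ)} (hf : ContDiff ℝ ∞ f) (i : Fin p) :
    (fun x => Colombeau.totalD i F (prolong f x)) = partialX i (fun y => F (prolong f y)) := by
  obtain ⟨m, g, hg, rfl⟩ := hF
  ext x
  exact Colombeau.totalD_prolong hg hf i x

theorem FinOrder.contDiff_prolong {F : JetInf p q → ℝ} (hF : FinOrder F)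
    {f : (Fin p → ℝ) → (Fin q → ℝ)} (hf : ContDiff ℝ ∞ f) :
    ContDiff ℝ ∞ (fun y => F (prolong f y)) := by
  obtain ⟨m, g, hg, rfl⟩ := hF
  exact hg.comp (contDiff_truncate_prolong hf m)

theorem FinOrder.opPow_totalD_prolong {F : JetInf p q → ℝ} (hF : FinOrder F)
    {f : (Fin p → ℝ) → (Fin q → ℝ)} (hf : ContDiff ℝ ∞ f) (J : Fin p → ℕ) :
    (fun x => opPow Colombeau.totalD J F (prolong f x)) = opPow partialX J (fun y => F (prolong f y)) :=
  opPow_semiconj FinOrder (fun F x => F (prolong f x)) (fun i _ h => h.totalD i)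
    (fun i _ h => h.totalD_prolong hf i) J hF

/-- Every jet of finite order is attained by the prolongation of a smooth function. -/
theorem exists_prolong_eq (F : JetInf p q → ℝ) (hF : FinOrder F) (G : JetInf p q → ℝ)
    (hG : FinOrder G) (h : ∀ f : (Fin p → ℝ) → (Fin q → ℝ), ContDiff ℝ ∞ f → ∀ x,
      F (prolong f x) = G (prolong f x)) : F = G := by
  obtain ⟨m, g, k, hg, hk, rfl, rfl⟩ := hF.exists_common hG
  ext z
  have := h _ (contDiff_jetPoly (truncate m z)) (truncate m z).1
  rw [prolong_jetPoly] at this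
  simpa [truncate_extend] using this

/-- Along prolongations `D_i` is `∂_i`, so this is the symmetry of second derivatives; prolongations
of smooth functions reach all finite jets. -/
theorem totalD_comm {F : JetInf p q → ℝ} (hF : FinOrder F) (i j : Fin p) :
    totalD i (totalD j F) = totalD j (totalD i F) := by
  refine exists_prolong_eq _ ((hF.totalD j).totalD i) _ ((hF.totalD i).totalD j) fun f hf x => ?_
  have h1 := congrFun ((hF.totalD j).totalD_prolong hf i) x
  have h2 := congrFun ((hF.totalD i).totalD_prolong hf j) x
  rw [hF.totalD_prolong hf] at h1 h2
  exact h1.trans ((congrFun (partialX_comm (hF.contDiff_prolong hf) i j) x).trans h2.symm)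

theorem opPow_totalD_add_single {F : JetInf p q → ℝ} (hF : FinOrder F) (J : Fin p → ℕ)
    (i : Fin p) : opPow totalD (J + Pi.single i 1) F = totalD i (opPow totalD J F) :=
  opPow_add_single FinOrder (fun i _ h => h.totalD i) (fun i j _ h => totalD_comm h i j) J i hF

theorem opPow_totalD_totalD {F : JetInf p q → ℝ} (hF : FinOrder F) (J : Fin p → ℕ)
    (i : Fin p) : opPow totalD J (totalD i F) = opPow totalD (J + Pi.single i 1) F := by
  rw [opPow_totalD_add_single hF]
  exact (opPow_semiconj FinOrder (totalD i) (fun i _ h => h.totalD i)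
    (fun j _ h => totalD_comm h i j) J hF).symm

/-- Induction on the length `|J|`, removing one unit from some nonzero entry. -/
theorem multiIndex_induction {C : (Fin p → ℕ) → Prop} (h0 : C 0)
    (hs : ∀ J i, C J → C (J + Pi.single i 1)) (J : Fin p → ℕ) : C J := by
  obtain ⟨k, hk⟩ : ∃ k, ∑ i, J i = k := ⟨_, rfl⟩
  induction k generalizing J with
  | zero =>
    have : J = 0 := by
      funext i
      simpa using (Finset.sum_eq_zero_iff.1 hk) i (Finset.mem_univ i)
    rwa [this]
  | succ k ih =>
    obtain ⟨i, hi⟩ : ∃ i, J i ≠ 0 := by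
      by_contra! h
      simp [h] at hk
    have hJ : J = (J - Pi.single i 1) + Pi.single i 1 := by
      funext j
      by_cases hij : j = i
      · subst hij; simp; omega
      · simp [Pi.single_eq_of_ne hij]
    rw [hJ] at hk ⊢
    rw [sum_add_single] at hk
    exact hs _ _ (ih _ (by omega))

theorem JetNet.opPow_totalD (hF : JetNet A m F) (J : Fin p → ℕ) :
    JetNet A (m + ∑ i, J i) (fun ε => opPow Colombeau.totalD J (F ε)) := by
  induction J using multiIndex_induction with
  | h0 => simpa [opPow_zero] using hF
  | hs J i ih =>
    rw [sum_add_single]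
    simp only [opPow_totalD_add_single (hF.finOrder _)]
    exact ih.totalD i

/-- Integration by parts for total derivatives. -/
theorem JetNet.exists_flux (J : Fin p → ℕ) {s t r : ℕ} {a b : ℝ → JetInf p q → ℝ}
    (ha : JetNet A s a) (hb : JetNet A t b) (hs : s + ∑ i, J i ≤ r + 1)
    (ht : t + ∑ i, J i ≤ r + 1) :
    ∃ X : Fin p → ℝ → JetInf p q → ℝ, (∀ i, JetNet A r (X i)) ∧ ∀ ε z,
      a ε z * opPow Colombeau.totalD J (b ε) z =
        (-1) ^ (∑ i, J i) * opPow Colombeau.totalD J (a ε) z * b ε z +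
          totalDiv (fun i => X i ε) z := by
  induction J using multiIndex_induction generalizing s a with
  | h0 =>
    refine ⟨fun _ _ _ => 0, fun _ => .const 0, fun ε z => ?_⟩
    simp [opPow_zero, totalDiv, totalD_const]
  | hs J i ih =>
    rw [sum_add_single] at hs ht
    obtain ⟨X, hX, hXe⟩ := ih (ha.totalD i) (by omega) (by omega)
    have hB := hb.opPow_totalD J
    have haB := (ha.mono (by omega : s ≤ r)).mul (hB.mono (by omega : t + ∑ i, J i ≤ r))
    -- From `a D_i(D_J b) = D_i(a D_J b) - (D_i a) D_J b`, with the induction hypothesis applied to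
    -- `D_i a`, whose order is one higher than that of `a`. The new flux `a D_J b` involves one
    -- derivative fewer than the product being integrated, which is why order `r` is enough under
    -- bounds by `r + 1`.
    refine ⟨fun j ε z => (if j = i then a ε z * opPow Colombeau.totalD J (b ε) z else 0) - X j ε z,
      fun j => ?_, fun ε z => ?_⟩
    · by_cases hj : j = i
      all_goals simp only [hj, if_true, if_false]
      · exact hj ▸ haB.sub (hX j)
      · exact (JetNet.const 0).sub (hX j)
    · have hdiv : totalDiv (fun j z => (if j = i then a ε z * opPow Colombeau.totalD J (b ε) z
          else 0) - X j ε z) z = Colombeau.totalD i (fun z => a ε z *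
            opPow Colombeau.totalD J (b ε) z) z - totalDiv (fun j => X j ε) z := by
        simp only [totalDiv]
        have : ∀ j, Colombeau.totalD j (fun z => (if j = i then a ε z *
            opPow Colombeau.totalD J (b ε) z else 0) - X j ε z) z =
            (if j = i then Colombeau.totalD i (fun z => a ε z *
            opPow Colombeau.totalD J (b ε) z) z else 0) - Colombeau.totalD j (X j ε) z := by
          intro j
          simp only [sub_eq_add_neg]
          split_ifs with hj
          · rw [totalD_add (haB.finOrder ε) ((hX j).neg.finOrder ε), totalD_neg, hj]
          · rw [totalD_add (FinOrder.const 0) ((hX j).neg.finOrder ε), totalD_neg, totalD_const]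
        rw [Finset.sum_congr rfl fun j _ => this j, Finset.sum_sub_distrib]
        simp
      have h1 := hXe ε z
      rw [opPow_totalD_totalD (ha.finOrder ε)] at h1
      rw [hdiv, totalD_mul (ha.finOrder ε) (hB.finOrder ε),
        opPow_totalD_add_single (hb.finOrder ε), sum_add_single, pow_succ]
      linear_combination -h1

/-- Construction of the conserved current. -/
theorem exists_current {n : ℕ} {L : ℝ → Jet p q n → ℝ} (hLs : ∀ ε, ContDiff ℝ ∞ (L ε))
    (hL : ModNet univ {A ×ˢ univ} (fun z => ‖z‖) L) {X : Fin p → ℝ → JetInf p q → ℝ}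
    (hX : ∀ i, JetNet A 0 (X i)) {Q : Fin q → ℝ → JetInf p q → ℝ} (hQ : ∀ α, JetNet A 1 (Q α)) :
    ∃ P : Fin p → ℝ → JetInf p q → ℝ, (∀ i, JetNet A (2 * n) (P i)) ∧ ∀ ε z,
      ∑ α, Q α ε z * euler (L ε) α z - totalDiv (fun i => P i ε) z =
        ∑ α, ∑ J : MultiIndex p n, partialU α J.1 (L ε ∘ truncate n) z *
          opPow totalD J.1 (Q α ε) z +
        totalDiv (fun i z => X i ε z * L ε (truncate n z)) z := by
  have hLn : JetNet A n (fun ε => L ε ∘ truncate n) := ⟨L, hLs, hL, fun _ => rfl⟩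
  choose Y hY hYe using fun (α : Fin q) (J : MultiIndex p n) =>
    -- Here `∂L/∂u_J` has order `n` and `Q` has order `1`, and `n + |J|` and `1 + |J|` are both at
    -- most `2n + 1`.
    (hLn.partialU α J).exists_flux J.1 (hQ α) (r := 2 * n) (by have := J.2; omega)
      (by have := J.2; omega)
  have hXL : ∀ i, JetNet A (2 * n) (fun ε z => X i ε z * L ε (truncate n z)) := fun i =>
    ((hX i).mono (by omega)).mul (hLn.mono (by omega))
  have hS : ∀ i, JetNet A (2 * n) (fun ε z => ∑ α, ∑ J : MultiIndex p n, Y α J i ε z) := fun i =>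
    .sum _ fun α _ => .sum _ fun J _ => hY α J i
  -- The sign is forced: the fluxes satisfy `∑ ∂L/∂u_J · D_J Q = Q·E(L) + Div Y`, so `P = -(Y + X
  -- L)` moves both divergences to the other side.
  refine ⟨fun i ε z => -(∑ α, ∑ J : MultiIndex p n, Y α J i ε z + X i ε z * L ε (truncate n z)),
    fun i => ((hS i).add (hXL i)).neg, fun ε z => ?_⟩
  have hdiv : totalDiv (fun i z => -(∑ α, ∑ J : MultiIndex p n, Y α J i ε z +
      X i ε z * L ε (truncate n z))) z =
      -(∑ α, ∑ J : MultiIndex p n, totalDiv (fun i => Y α J i ε) z +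
        totalDiv (fun i z => X i ε z * L ε (truncate n z)) z) := by
    simp only [totalDiv]
    have : ∀ i, totalD i (fun z => -(∑ α, ∑ J : MultiIndex p n, Y α J i ε z +
        X i ε z * L ε (truncate n z))) z = -(∑ α, ∑ J : MultiIndex p n, totalD i (Y α J i ε) z +
        totalD i (fun z => X i ε z * L ε (truncate n z)) z) := fun i => by
      rw [totalD_neg, totalD_add ((hS i).finOrder ε) ((hXL i).finOrder ε),
        totalD_sum _ fun α _ => FinOrder.sum _ fun J _ => (hY α J i).finOrder ε]
      simp only [totalD_sum _ fun J _ => (hY _ J i).finOrder ε]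
    rw [Finset.sum_congr rfl fun i _ => this i, Finset.sum_neg_distrib, Finset.sum_add_distrib,
      Finset.sum_comm]
    simp only [Finset.sum_comm (s := (Finset.univ : Finset (Fin p)))]
  rw [hdiv, sub_neg_eq_add, ← add_assoc, ← Finset.sum_add_distrib]
  congr 1
  refine Finset.sum_congr rfl fun α _ => ?_
  rw [euler, Finset.mul_sum, ← Finset.sum_add_distrib]
  refine Finset.sum_congr rfl fun J _ => ?_
  rw [hYe]
  ring

end JetNets


/-! ### The gliding hump: from negligible integrals to negligible values. -/

section Integrals

variable {p : ℕ}

/-- A point at distance `s` from `x` and at distance at least `s` from `y`. -/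
theorem exists_dist_eq_le_dist (hp : 0 < p) (x y : Fin p → ℝ) {s : ℝ} (hs : 0 ≤ s) :
    ∃ c, dist c x = s ∧ s ≤ dist c y := by
  let e : Fin p → ℝ := Pi.single ⟨0, hp⟩ s
  have he : ‖e‖ = s := by rw [Pi.norm_single, Real.norm_of_nonneg hs]
  have h1 : dist (x + e) x = s := by simp [dist_eq_norm, he]
  have h2 : dist (x - e) x = s := by simp [dist_eq_norm, he]
  by_cases h : s ≤ dist (x + e) y
  · exact ⟨_, h1, h⟩
  · refine ⟨_, h2, ?_⟩
    have h3 : dist (x + e) (x - e) = 2 * s := by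
      rw [dist_eq_norm, add_sub_sub_cancel, ← two_smul ℝ e, norm_smul, he]; norm_num
    have h4 := dist_triangle (x + e) y (x - e)
    rw [dist_comm y] at h4
    linarith [not_le.1 h]

theorem abs_setIntegral_le {T : (Fin p → ℝ) → ℝ} {B : Set (Fin p → ℝ)} {C : ℝ} {c : Fin p → ℝ}
    {s : ℝ} (hs : 0 ≤ s) (hBc : B ⊆ Metric.ball c s) (hC : 0 ≤ C) (h : ∀ x ∈ B, |T x| ≤ C) :
    |∫ x in B, T x| ≤ C * (2 * s) ^ p := by
  have hv : volume B ≤ ENNReal.ofReal ((2 * s) ^ p) := by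
    rcases hs.eq_or_lt with rfl | hs
    · simp only [Metric.ball_zero, subset_empty_iff] at hBc
      simp [hBc]
    · refine (measure_mono hBc).trans ?_
      rw [Real.volume_pi_ball _ hs, Fintype.card_fin]
  have h1 : volume B < ⊤ := hv.trans_lt ENNReal.ofReal_lt_top
  refine (norm_setIntegral_le_of_norm_le_const (μ := volume) (f := T) (C := C) h1 h).trans ?_
  exact mul_le_mul_of_nonneg_left (ENNReal.toReal_le_of_le_ofReal (by positivity) hv) hC

/-- If `T` stays within `b` of a value of modulus at least `2b`, there is no cancellation beyond `b`
per unit volume. Balls of the sup norm are cubes, of volume `(2s)^p`. -/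
theorem le_abs_setIntegral_ball {T : (Fin p → ℝ) → ℝ} {c : Fin p → ℝ} {s a b : ℝ} (hs : 0 < s)
    (hT : IntegrableOn T (Metric.ball c s)) (ha : 2 * b ≤ |a|) (hb : 0 ≤ b)
    (h : ∀ x ∈ Metric.ball c s, |T x - a| ≤ b) : b * (2 * s) ^ p ≤ |∫ x in Metric.ball c s, T x| := by
  have h1 := abs_setIntegral_le hs.le le_rfl hb h
  have hv : volume.real (Metric.ball c s) = (2 * s) ^ p := by
    rw [Measure.real, Real.volume_pi_ball _ hs, Fintype.card_fin,
      ENNReal.toReal_ofReal (by positivity)]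
  rw [integral_sub hT (integrableOn_const measure_ball_lt_top.ne), setIntegral_const, hv,
    smul_eq_mul] at h1
  have h2 : |(2 * s) ^ p * a| = (2 * s) ^ p * |a| := by rw [abs_mul, abs_of_nonneg (by positivity)]
  have h3 := abs_sub_abs_le_abs_sub ((2 * s) ^ p * a) (∫ x in Metric.ball c s, T x)
  rw [abs_sub_comm, h2] at h3
  have h4 : (2 * s) ^ p * (2 * b) ≤ (2 * s) ^ p * |a| :=
    mul_le_mul_of_nonneg_left ha (by positivity)
  linarith

variable {Ω : Set (Fin p → ℝ)} {T : ℝ → (Fin p → ℝ) → ℝ}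

/-- The data of a finite stage of the gliding hump: an open subset of `K` avoiding a ball. -/
structure HumpStage (K : Set (Fin p → ℝ)) (x₀ : Fin p → ℝ) where
  set : Set (Fin p → ℝ)
  radius : ℝ
  isOpen : IsOpen set
  subset : set ⊆ K
  pos : 0 < radius
  disjoint : Disjoint set (Metric.ball x₀ radius)

/-- The stage `s'` extends `s` inside the ball of `s`, the integral of `f` over `s'` is large,
and the integral of `f` over subsets of the new ball is small. -/
structure HumpStage.Extends {K : Set (Fin p → ℝ)} {x₀ : Fin p → ℝ} (s s' : HumpStage K x₀)
    (f : (Fin p → ℝ) → ℝ) (c : ℝ) : Prop where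
  mono : s.set ⊆ s'.set
  radius_le : s'.radius ≤ s.radius
  sdiff_subset : s'.set \ s.set ⊆ Metric.ball x₀ s.radius
  large : 2 * c ≤ |∫ x in s'.set, f x|
  small : ∀ B ⊆ Metric.ball x₀ s'.radius ∩ K, |∫ x in B, f x| ≤ c

/-- If every stage can be extended, with respect to some `T_ε` with `ε` arbitrarily small, then
there is an open set on which the integral of `T_ε` is not negligible. -/
theorem exists_isOpen_integral_not_small {K : Set (Fin p → ℝ)} (hK : IsCompact K)
    {x₀ : Fin p → ℝ} (A : ℕ) (hT : ∀ ε ∈ Ioc (0 : ℝ) 1, IntegrableOn (T ε) K)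
    (hstep : ∀ (s : HumpStage K x₀) (ε₀ : ℝ), 0 < ε₀ → ∃ ε ∈ Ioo 0 ε₀, ∃ s' : HumpStage K x₀,
      s.Extends s' (T ε) (ε ^ A)) :
    ∃ Ω₁ ⊆ K, IsOpen Ω₁ ∧ ∃ᶠ ε : ℝ in 𝓝[>] 0, ε ^ A ≤ |∫ x in Ω₁, T ε x| := by
  choose! e he nx hnx using hstep
  -- Stages are built from the empty set with thresholds `1/(k+1)`, which force the parameters `ε k`
  -- to tend to zero.
  let st : ℕ → HumpStage K x₀ := fun k => Nat.rec
    ⟨∅, 1, isOpen_empty, empty_subset _, one_pos, empty_disjoint _⟩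
    (fun k s => nx s (1 / (k + 1))) k
  let ε : ℕ → ℝ := fun k => e (st k) (1 / (k + 1))
  have hpos : ∀ k : ℕ, (0 : ℝ) < 1 / (k + 1) := fun k => by positivity
  have hε : ∀ k : ℕ, ε k ∈ Ioo (0 : ℝ) (1 / (k + 1)) := fun k => he _ _ (hpos k)
  have hst : ∀ k, (st k).Extends (st (k + 1)) (T (ε k)) (ε k ^ A) := fun k => hnx _ _ (hpos k)
  have hmono : Monotone fun k => (st k).set := monotone_nat_of_le_succ fun k => (hst k).mono
  have hrad : Antitone fun k => (st k).radius := antitone_nat_of_succ_le fun k => (hst k).radius_le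
  have hdiff : ∀ k j, (st (k + j)).set \ (st k).set ⊆ Metric.ball x₀ (st k).radius := by
    intro k j
    induction j with
    | zero => simp
    | succ j ih =>
      intro x hx
      by_cases h : x ∈ (st (k + j)).set
      · exact ih ⟨h, hx.2⟩
      · exact Metric.ball_subset_ball (hrad (Nat.le_add_right k j))
          ((hst (k + j)).sdiff_subset ⟨hx.1, h⟩)
  refine ⟨⋃ k, (st k).set, iUnion_subset fun k => (st k).subset,
    isOpen_iUnion fun k => (st k).isOpen, ?_⟩
  have hlarge : ∀ k, ε k ^ A ≤ |∫ x in ⋃ k, (st k).set, T (ε k) x| := by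
    intro k
    have hε1 : ε k ∈ Ioc (0 : ℝ) 1 := ⟨(hε k).1, (hε k).2.le.trans (by
      rw [div_le_one (by positivity)]; linarith [Nat.cast_nonneg (α := ℝ) k])⟩
    have hsub : (⋃ k, (st k).set) ⊆ K := iUnion_subset fun k => (st k).subset
    have hU : MeasurableSet (⋃ k, (st k).set) := (isOpen_iUnion fun k => (st k).isOpen).measurableSet
    -- The limit set is stage `k + 1` together with all later additions. Those lie in the ball of
    -- stage `k + 1`, so they can change the integral of `T (ε k)` by at most half of its lower
    -- bound.
    have h1 := setIntegral_union (μ := volume) (f := T (ε k)) (s := (st (k + 1)).set)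
      (t := (⋃ k, (st k).set) \ (st (k + 1)).set) disjoint_sdiff_right
      (hU.diff (st (k + 1)).isOpen.measurableSet) ((hT _ hε1).mono_set (st (k + 1)).subset)
      ((hT _ hε1).mono_set (sdiff_subset.trans hsub))
    rw [union_sdiff_cancel (subset_iUnion (fun k => (st k).set) (k + 1))] at h1
    have h2 := (hst k).small ((⋃ k, (st k).set) \ (st (k + 1)).set) fun x hx => by
      obtain ⟨j, hj⟩ := mem_iUnion.1 hx.1
      exact ⟨hdiff (k + 1) j ⟨hmono (Nat.le_add_left j (k + 1)) hj, hx.2⟩, hsub hx.1⟩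
    have h3 := (hst k).large
    rw [h1]
    have h4 := abs_sub_abs_le_abs_add (∫ x in (st (k + 1)).set, T (ε k) x)
      (∫ x in (⋃ k, (st k).set) \ (st (k + 1)).set, T (ε k) x)
    linarith
  have hlim : Tendsto ε atTop (𝓝[>] 0) :=
    tendsto_nhdsWithin_iff.2 ⟨squeeze_zero (fun k => (hε k).1.le) (fun k => (hε k).2.le)
      tendsto_one_div_add_atTop_nhds_zero_nat, .of_forall fun k => (hε k).1⟩
  exact hlim.frequently (Frequently.of_forall hlarge)

/-- A moderate net whose integrals over all relatively compact open sets are negligible is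
negligible on compact sets. -/
theorem eventually_abs_le_of_integral_small (hT : ModNet Ω (compactsIn Ω) (fun _ => 0) T)
    (hint : ∀ Ω₁, IsOpen Ω₁ → closure Ω₁ ∈ compactsIn Ω → ∀ m : ℕ, ∀ᶠ ε : ℝ in 𝓝[>] 0,
      |∫ x in Ω₁, T ε x| ≤ ε ^ m) {K : Set (Fin p → ℝ)} (hK : K ∈ compactsIn Ω) (m : ℕ) :
    ∀ᶠ ε : ℝ in 𝓝[>] 0, ∀ x ∈ K, |T ε x| ≤ ε ^ m := by
  rcases Nat.eq_zero_or_pos p with rfl | hp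
  -- In dimension zero the space is a point of volume one, and the integral is the value itself.
  · rcases K.eq_empty_or_nonempty with rfl | ⟨x₀, hx₀⟩
    · simp
    have huniv : (univ : Set (Fin 0 → ℝ)) ⊆ Ω := fun x _ => by
      rw [Subsingleton.elim x x₀]; exact hK.2 hx₀
    filter_upwards [hint univ isOpen_univ (by
      rw [closure_univ]; exact ⟨(finite_univ).isCompact, huniv⟩) m] with ε h x _
    have h1 : T ε = fun _ => T ε x := by ext y; rw [Subsingleton.elim y x]
    rw [h1, setIntegral_const] at h
    simpa [Measure.real, volume_pi] using h
  by_contra hcon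
  -- By compactness the failure on `K` concentrates at one point: smallness fails on every
  -- neighbourhood of `x₀` in `K`.
  obtain ⟨x₀, hx₀, hfreq⟩ : ∃ x ∈ K, ∀ t ∈ 𝓝[K] x,
      ¬ ∀ᶠ ε : ℝ in 𝓝[>] 0, ∀ x ∈ t, |T ε x| ≤ ε ^ m := by
    by_contra! h
    exact hcon (hK.1.induction_on (p := fun t => ∀ᶠ ε : ℝ in 𝓝[>] 0, ∀ x ∈ t, |T ε x| ≤ ε ^ m)
      (by simp) (fun s t hst h => h.mono fun ε h x hx => h x (hst hx))
      (fun s t hs ht => by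
        filter_upwards [hs, ht] with ε h1 h2 x hx using hx.elim (h1 x) (h2 x)) h)
  obtain ⟨δ, hδ, hKδ⟩ := hK.1.exists_cthickening_subset_open hT.isOpen hK.2
  have hKc : IsCompact (Metric.cthickening δ K) := hK.1.cthickening
  have hKmem : Metric.cthickening δ K ∈ compactsIn Ω := ⟨hKc, hKδ⟩
  obtain ⟨N₁, hN₁⟩ := hT.bdd_zero hKmem
  obtain ⟨N₂, hN₂⟩ := hT.bdd_fderiv hKmem
  obtain ⟨N, hN1, hN2⟩ : ∃ N, N₁ ≤ N ∧ N₂ ≤ N := ⟨_, le_max_left _ _, le_max_right _ _⟩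
  have hTi : ∀ ε ∈ Ioc (0 : ℝ) 1, IntegrableOn (T ε) (Metric.cthickening δ K) := fun ε hε =>
    ((hT.smooth ε hε).continuousOn.mono hKδ).integrableOn_compact hKc
  -- A hump of height `ε^m / 2` over a cube of side about `ε^(m+N+1)` has integral at least `3 ε^A`.
  -- The extra `p + 3` powers of `ε ≤ 1/2` absorb the numerical constants.
  obtain ⟨A, hA⟩ : ∃ A, A = (m + N + 1) * p + p + m + 3 := ⟨_, rfl⟩
  obtain ⟨Ω₁, hsub, hopen, hlarge⟩ := exists_isOpen_integral_not_small (T := T) hKc (x₀ := x₀) A hTi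
    fun s ε₀ hε₀ => by
      have hballs : K ∩ Metric.ball x₀ (s.radius / 2) ∈ 𝓝[K] x₀ :=
        inter_mem_nhdsWithin K (Metric.ball_mem_nhds x₀ (half_pos s.pos))
      -- The set built so far does not depend on the next `ε`, so the hypothesis makes its
      -- contribution at most `ε^A`.
      have hSint := hint s.set s.isOpen ⟨hKc.of_isClosed_subset isClosed_closure
        (closure_minimal s.subset Metric.isClosed_cthickening),
        (closure_minimal s.subset Metric.isClosed_cthickening).trans hKδ⟩ A
      have hf := hfreq _ hballs
      rw [not_eventually] at hf
      have hmin : 0 < min (min ε₀ (1 / 2)) (min δ (s.radius / 2)) := by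
        have := s.pos; positivity
      obtain ⟨ε, hbad, hSε, hN₁, hN₂, hε⟩ :=
        (hf.and_eventually (hSint.and (hN₁.and (hN₂.and (eventually_mem_Ioo hmin))))).exists
      simp only [mem_Ioo, lt_min_iff] at hε
      obtain ⟨hε0, ⟨hεε₀, hε2⟩, hεδ, hεs⟩ := hε
      push Not at hbad
      obtain ⟨x, ⟨hxK, hxb⟩, hx⟩ := hbad
      have hε1 : ε ≤ 1 := by linarith
      have hεI : ε ∈ Ioc (0 : ℝ) 1 := ⟨hε0, hε1⟩
      have hinv : 1 ≤ ε⁻¹ := (one_le_inv₀ hε0).2 hε1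
      have hB1 : ∀ y ∈ Metric.cthickening δ K, |T ε y| ≤ (ε⁻¹) ^ N := fun y hy =>
        (hN₁ y hy).trans (by rw [add_zero, mul_one]; exact pow_le_pow_right₀ hinv hN1)
      have hB2 : ∀ y ∈ Metric.cthickening δ K, ‖fderiv ℝ (T ε) y‖ ≤ (ε⁻¹) ^ N := fun y hy =>
        (hN₂ y hy).trans (by rw [add_zero, mul_one]; exact pow_le_pow_right₀ hinv hN2)
      -- On a ball of this radius the gradient bound `ε^{-N}` permits an oscillation of at most
      -- `ε^(m+1) ≤ ε^m / 2`.
      obtain ⟨r, hr⟩ : ∃ r, r = ε ^ (m + N + 1) := ⟨_, rfl⟩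
      have hr0 : 0 < r := hr ▸ by positivity
      have hrε : r ≤ ε := hr ▸ pow_le_of_le_one hε0.le hε1 (by omega)
      -- The bad point `x` may be `x₀` itself. The hump is centred at `c` instead, so that the ball
      -- of radius `r / 4` about `x₀` remains free for later stages.
      obtain ⟨c, hcx, hcx₀⟩ := exists_dist_eq_le_dist hp x x₀ (s := r / 2) (by positivity)
      have hxr : Metric.ball x r ⊆ Metric.cthickening δ K := fun y hy =>
        Metric.mem_cthickening_of_dist_le y x δ K hxK ((Metric.mem_ball.1 hy).le.trans
          (hrε.trans hεδ.le))
      have hcr : Metric.ball c (r / 4) ⊆ Metric.ball x r :=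
        Metric.ball_subset_ball' (by linarith)
      have hcs : Metric.ball c (r / 4) ⊆ Metric.ball x₀ s.radius :=
        hcr.trans (Metric.ball_subset_ball' (by have := Metric.mem_ball.1 hxb; linarith))
      have hd0 : 0 < min (min (r / 4) s.radius) (ε ^ (A + N) / 2) := by
        have := s.pos; positivity
      have hosc : ∀ y ∈ Metric.ball c (r / 4), |T ε y - T ε x| ≤ ε ^ m / 2 := by
        intro y hy
        have h1 := (convex_ball x r).norm_image_sub_le_of_norm_fderiv_le (𝕜 := ℝ) (f := T ε)
          (fun z hz => (hT.contDiffAt hεI (hKδ (hxr hz))).differentiableAt (by simp))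
          (fun z hz => hB2 z (hxr hz)) (Metric.mem_ball_self hr0) (hcr hy)
        refine h1.trans ?_
        have h2 : ‖y - x‖ ≤ r := by
          rw [← dist_eq_norm]; exact (Metric.mem_ball.1 (hcr hy)).le
        calc (ε⁻¹) ^ N * ‖y - x‖ ≤ (ε⁻¹) ^ N * ε ^ (m + N + 1) := by
              rw [← hr]; gcongr
          _ = ε ^ m * ε := by
              rw [pow_succ, pow_add, inv_pow]; field_simp
          _ ≤ ε ^ m / 2 := by
              rw [div_eq_mul_one_div]; gcongr
      have hlow := le_abs_setIntegral_ball (by positivity : 0 < r / 4)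
        ((hTi ε hεI).mono_set (hcr.trans hxr)) (by linarith : 2 * (ε ^ m / 2) ≤ |T ε x|)
        (by positivity) hosc
      have hlow' : 3 * ε ^ A ≤ ε ^ m / 2 * (2 * (r / 4)) ^ p := by
        have h1 : ε ^ (m + N + 1) * ε ≤ 2 * (r / 4) := by
          rw [← hr]; nlinarith
        have h2 : (ε ^ (m + N + 1) * ε) ^ p ≤ (2 * (r / 4)) ^ p :=
          pow_le_pow_left₀ (by positivity) h1 p
        calc 3 * ε ^ A = (3 * ε ^ 3) * (ε ^ m * (ε ^ (m + N + 1) * ε) ^ p) := by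
              rw [hA, mul_pow, ← pow_mul]; ring
          _ ≤ (1 / 2) * (ε ^ m * (ε ^ (m + N + 1) * ε) ^ p) := by
              gcongr
              have : ε ^ 3 ≤ (1 / 2) ^ 3 := pow_le_pow_left₀ hε0.le hε2.le 3
              linarith
          _ = ε ^ m / 2 * (ε ^ (m + N + 1) * ε) ^ p := by ring
          _ ≤ _ := mul_le_mul_of_nonneg_left h2 (by positivity)
      have hdisj : Disjoint s.set (Metric.ball c (r / 4)) := s.disjoint.mono_right hcs
      refine ⟨ε, ⟨hε0, hεε₀⟩, ⟨s.set ∪ Metric.ball c (r / 4),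
        min (min (r / 4) s.radius) (ε ^ (A + N) / 2), s.isOpen.union Metric.isOpen_ball,
        union_subset s.subset (hcr.trans hxr), hd0, disjoint_union_left.2 ⟨?_, ?_⟩⟩,
        subset_union_left, (min_le_left _ _).trans (min_le_right _ _), ?_, ?_, ?_⟩
      · exact s.disjoint.mono_right (Metric.ball_subset_ball
          ((min_le_left _ _).trans (min_le_right _ _)))
      · refine Metric.ball_disjoint_ball ?_
        have := (min_le_left (min (r / 4) s.radius) (ε ^ (A + N) / 2)).trans (min_le_left _ _)
        linarith
      · exact fun y hy => hcs (hy.1.resolve_left hy.2)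
      · change 2 * ε ^ A ≤ |∫ x in s.set ∪ Metric.ball c (r / 4), T ε x|
        rw [setIntegral_union hdisj measurableSet_ball ((hTi ε hεI).mono_set s.subset)
          ((hTi ε hεI).mono_set (hcr.trans hxr))]
        have := abs_sub_abs_le_abs_add (∫ x in Metric.ball c (r / 4), T ε x) (∫ x in s.set, T ε x)
        rw [add_comm] at this
        linarith
      · intro B hB
        have h1 := abs_setIntegral_le hd0.le (fun y hy => (hB hy).1)
          (by positivity : 0 ≤ (ε⁻¹) ^ N) (fun y hy => hB1 y (hB hy).2)
        refine h1.trans ?_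
        -- The bound `ε^(A+N) / 2` on the new radius beats the size `ε^{-N}` of `T ε`. One factor
        -- `2d` of the volume suffices because `p` is positive and `2d ≤ 1`.
        obtain ⟨d, hd⟩ : ∃ d, d = min (min (r / 4) s.radius) (ε ^ (A + N) / 2) := ⟨_, rfl⟩
        rw [← hd] at hd0 ⊢
        have h2 : 2 * d ≤ ε ^ (A + N) := by
          have := hd ▸ min_le_right (min (r / 4) s.radius) (ε ^ (A + N) / 2)
          linarith
        have h3 : 2 * d ≤ 1 := h2.trans (pow_le_one₀ hε0.le hε1)
        calc (ε⁻¹) ^ N * (2 * d) ^ p ≤ (ε⁻¹) ^ N * (2 * d) := by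
              gcongr; exact pow_le_of_le_one (by positivity) h3 hp.ne'
          _ ≤ (ε⁻¹) ^ N * ε ^ (A + N) := by gcongr
          _ = ε ^ A := by rw [pow_add, inv_pow]; field_simp
  have hcl := closure_minimal hsub Metric.isClosed_cthickening
  -- Order `A + 1` contradicts the lower bound `ε^A`, which holds for arbitrarily small `ε`.
  have hev := hint Ω₁ hopen ⟨hKc.of_isClosed_subset isClosed_closure hcl, hcl.trans hKδ⟩ (A + 1)
  obtain ⟨ε, h1, h2, h3⟩ := (hlarge.and_eventually
    (hev.and (eventually_mem_Ioo one_pos))).exists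
  have h4 := h1.trans h2
  rw [pow_succ] at h4
  have := pow_pos h3.1 A
  nlinarith [h3.2]

end Integrals


/-! ### The determinant and its derivative at the identity. -/

section Determinant

variable {p : ℕ}

theorem det_clm_eq (B : (Fin p → ℝ) →L[ℝ] (Fin p → ℝ)) :
    B.det = (Matrix.of fun i j => B (Pi.single j 1) i).det := by
  rw [ContinuousLinearMap.det, ← LinearMap.det_toMatrix']
  rfl

theorem contDiff_det : ContDiff ℝ ∞ (fun B : (Fin p → ℝ) →L[ℝ] (Fin p → ℝ) => B.det) := by
  simp only [det_clm_eq, Matrix.det_apply, Matrix.of_apply]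
  refine ContDiff.sum fun σ _ => ContDiff.const_smul _ (contDiff_prod fun i _ => ?_)
  exact contDiff_pi.1 (contDiff_id.clm_apply contDiff_const) _

/-- The derivative of the determinant at the identity is the trace. -/
theorem fderiv_det_id (B : (Fin p → ℝ) →L[ℝ] (Fin p → ℝ)) :
    fderiv ℝ (fun B : (Fin p → ℝ) →L[ℝ] (Fin p → ℝ) => B.det)
      (ContinuousLinearMap.id ℝ (Fin p → ℝ)) B = ∑ i, B (Pi.single i 1) i := by
  have hd := contDiff_det.differentiable (by simp) (ContinuousLinearMap.id ℝ (Fin p → ℝ))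
  rw [← hd.lineDeriv_eq_fderiv, lineDeriv]
  let M : Matrix (Fin p) (Fin p) ℝ := Matrix.of fun i j => B (Pi.single j 1) i
  have h1 : ∀ t : ℝ, (ContinuousLinearMap.id ℝ (Fin p → ℝ) + t • B).det =
      (1 + t • M).det := fun t => by
    rw [det_clm_eq]
    congr 1
    ext i j
    simp [M, Matrix.one_apply, Pi.single_apply]
  -- The expansion `det(1 + tM) = 1 + t tr M + O(t²)`, with a polynomial coefficient in the
  -- remainder.
  have h2 : HasDerivAt (fun t : ℝ => 1 + M.trace * t +
      (Matrix.det (1 + (Polynomial.X : Polynomial ℝ) • M.map Polynomial.C)).divX.divX.eval t * t ^ 2)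
      (M.trace * 1 + (_ * 0 ^ 2 + _ * ((2 : ℕ) * 0 ^ (2 - 1) * 1))) 0 :=
    (((hasDerivAt_id' (0 : ℝ)).const_mul M.trace).const_add 1).fun_add
      ((Polynomial.hasDerivAt _ _).fun_mul ((hasDerivAt_id' (0 : ℝ)).fun_pow 2))
  rw [funext fun t => (h1 t).trans (Matrix.det_one_add_smul t M), h2.deriv]
  simp [Matrix.trace, M]

end Determinant

/-! ### The infinitesimal variation of the Lagrangian. -/

section Variation

variable {p q n : ℕ}

/-- The derivative at `η = 0` of `L(Ξ_η(x), pr f'_η(Ξ_η(x))) det DΞ_η(x)`, in terms of `A = Ξ_0`, the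
velocity `V` of `Ξ`, `F₀ = f'_0` and the velocity `F₁` of `f'`. -/
noncomputable def variation (L : Jet p q n → ℝ) (A V : (Fin p → ℝ) → (Fin p → ℝ))
    (F₀ F₁ : (Fin p → ℝ) → (Fin q → ℝ)) (x : Fin p → ℝ) : ℝ :=
  fderiv ℝ L (truncate n (prolong F₀ (A x))) (V x, fun α J =>
      opPow partialX J.1 (fun y => F₁ y α) (A x) +
        fderiv ℝ (opPow partialX J.1 (fun y => F₀ y α)) (A x) (V x)) *
      (fderiv ℝ A x).det +
    L (truncate n (prolong F₀ (A x))) * fderiv ℝ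
      (fun B : (Fin p → ℝ) →L[ℝ] (Fin p → ℝ) => B.det) (fderiv ℝ A x) (fderiv ℝ V x)

theorem clm_apply_eq_sum {F : Type*} [NormedAddCommGroup F] [NormedSpace ℝ F]
    (B : (Fin p → ℝ) →L[ℝ] F) (v : Fin p → ℝ) : B v = ∑ i, v i • B (Pi.single i 1) := by
  conv_lhs => rw [← Finset.univ_sum_single v, map_sum]
  refine Finset.sum_congr rfl fun i _ => ?_
  rw [← map_smul, ← Pi.single_smul, smul_eq_mul, mul_one]

theorem sum_mul_fderiv_single (B : Jet p q n →L[ℝ] ℝ) (c : Fin q → MultiIndex p n → ℝ) :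
    ∑ α, ∑ J, B (0, Pi.single α (Pi.single J 1)) * c α J = B (0, c) := by
  classical
  have : ((0, c) : Jet p q n) = ∑ α, ∑ J, c α J • (0, Pi.single α (Pi.single J 1)) := by
    refine Prod.ext ?_ ?_
    · simp [Prod.fst_sum]
    · funext β K
      simp only [Prod.snd_sum, Finset.sum_apply, Prod.smul_snd, Pi.smul_apply, smul_eq_mul]
      rw [Finset.sum_eq_single β, Finset.sum_eq_single K]
      · simp
      · intro J _ hJ; simp [hJ.symm]
      · simp
      · intro α _ hα; simp [Pi.single_apply, hα.symm]
      · simp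
  rw [this, map_sum]
  simp only [map_sum, map_smul, smul_eq_mul, mul_comm]

theorem prolong_zero (f : (Fin p → ℝ) → (Fin q → ℝ)) (x : Fin p → ℝ) (α : Fin q) :
    (prolong f x).2 α 0 = f x α := by
  exact congrFun (opPow_zero _ _) x

theorem prolong_single {f : (Fin p → ℝ) → (Fin q → ℝ)} (hf : ContDiff ℝ ∞ f) (x : Fin p → ℝ)
    (α : Fin q) (i : Fin p) :
    (prolong f x).2 α (Pi.single i 1) = partialX i (fun y => f y α) x := by
  change opPow partialX (Pi.single i 1) (fun y => f y α) x = _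
  rw [opPow_single (ContDiff ℝ ∞) (fun i _ h => contDiff_partialX h i)
    (fun i j _ h => partialX_comm h i j) i (contDiff_component hf α)]

/-- Along `f` the characteristic is the ideal velocity of `η ↦ f'_η` at `η = 0`; this identifies the
algebraic side with the variational one. -/
theorem characteristic_prolong {ξ : (Fin p → ℝ) → (Fin p → ℝ)}
    {ψ : (Fin p → ℝ) × (Fin q → ℝ) → (Fin q → ℝ)} {f : (Fin p → ℝ) → (Fin q → ℝ)}
    (hf : ContDiff ℝ ∞ f) (x : Fin p → ℝ) (α : Fin q) :
    characteristic ξ ψ α (prolong f x) = (ψ (x, f x) - fderiv ℝ f x (ξ x)) α := by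
  rw [characteristic, Pi.sub_apply]
  have h1 : fderiv ℝ f x (ξ x) α = ∑ i, ξ x i * partialX i (fun y => f y α) x := by
    have h2 : fderiv ℝ (fun y => f y α) x = (ContinuousLinearMap.proj α).comp (fderiv ℝ f x) :=
      ((ContinuousLinearMap.proj (R := ℝ) (φ := fun _ : Fin q => ℝ) α).hasFDerivAt.comp x
        (hf.differentiable (by simp) x).hasFDerivAt).fderiv
    have h3 : fderiv ℝ f x (ξ x) α = fderiv ℝ (fun y => f y α) x (ξ x) := by rw [h2]; rfl
    rw [h3, clm_apply_eq_sum]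
    rfl
  have h0 : (fun β => (prolong f x).2 β 0) = f x := funext fun β => prolong_zero f x β
  rw [h0, h1]
  simp only [prolong_single hf]
  rfl

theorem finOrder_characteristic {ξ : (Fin p → ℝ) → (Fin p → ℝ)}
    {ψ : (Fin p → ℝ) × (Fin q → ℝ) → (Fin q → ℝ)} (hξ : ContDiff ℝ ∞ ξ) (hψ : ContDiff ℝ ∞ ψ)
    (α : Fin q) : FinOrder (characteristic ξ ψ α) := by
  refine ⟨1, fun w => ψ (w.1, fun β => w.2 β ⟨0, by simp⟩) α -
    ∑ i, ξ w.1 i * w.2 α ⟨Pi.single i 1, by simp⟩, ?_, rfl⟩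
  refine ContDiff.sub ?_ (ContDiff.sum fun i _ => ContDiff.mul ?_ ?_)
  · exact (contDiff_pi.1 hψ α).comp (contDiff_fst.prodMk (contDiff_pi.2 fun β =>
      contDiff_pi.1 (contDiff_pi.1 contDiff_snd β) _))
  · exact (contDiff_pi.1 hξ i).comp contDiff_fst
  · exact contDiff_pi.1 (contDiff_pi.1 contDiff_snd α) _

/-- The infinitesimal variation, expressed by the prolonged characteristic and a divergence. -/
theorem variation_eq {L : Jet p q n → ℝ} (hL : ContDiff ℝ ∞ L) {ξ : (Fin p → ℝ) → (Fin p → ℝ)}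
    {ψ : (Fin p → ℝ) × (Fin q → ℝ) → (Fin q → ℝ)} (hξ : ContDiff ℝ ∞ ξ) (hψ : ContDiff ℝ ∞ ψ)
    {f : (Fin p → ℝ) → (Fin q → ℝ)} (hf : ContDiff ℝ ∞ f) (x : Fin p → ℝ) :
    ∑ α, ∑ J : MultiIndex p n, partialU α J.1 (L ∘ truncate n) (prolong f x) *
        opPow totalD J.1 (characteristic ξ ψ α) (prolong f x) +
      totalDiv (fun i z => ξ z.1 i * L (truncate n z)) (prolong f x) =
    variation L id ξ f (fun y => ψ (y, f y) - fderiv ℝ f y (ξ y)) x := by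
  have hLd := hL.differentiable (by simp) (truncate n (prolong f x))
  have hpr := hasFDerivAt_truncate_prolong hf n x
  have hfo : ∀ i, FinOrder (fun z : JetInf p q => ξ z.1 i * L (truncate n z)) := fun i =>
    ⟨n, fun w => ξ w.1 i * L w, ((contDiff_pi.1 hξ i).comp contDiff_fst).mul hL, rfl⟩
  have h1 : ∀ α J, opPow totalD J (characteristic ξ ψ α) (prolong f x) =
      opPow partialX J (fun y => (ψ (y, f y) - fderiv ℝ f y (ξ y)) α) x := fun α J => by
    have := congrFun ((finOrder_characteristic hξ hψ α).opPow_totalD_prolong hf J) x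
    simp only [characteristic_prolong hf] at this
    exact this
  have h2 : totalDiv (fun i z => ξ z.1 i * L (truncate n z)) (prolong f x) =
      fderiv ℝ L (truncate n (prolong f x)) (ξ x, fun α J =>
        fderiv ℝ (opPow partialX J.1 (fun y => f y α)) x (ξ x)) +
      L (truncate n (prolong f x)) * ∑ i, fderiv ℝ ξ x (Pi.single i 1) i := by
    have h3 : ∀ i, totalD i (fun z => ξ z.1 i * L (truncate n z)) (prolong f x) =
        ξ x i * fderiv ℝ (fun y => L (truncate n (prolong f y))) x (Pi.single i 1) +
        L (truncate n (prolong f x)) * fderiv ℝ ξ x (Pi.single i 1) i := fun i => by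
      rw [congrFun ((hfo i).totalD_prolong hf i) x, partialX]
      have hξi : HasFDerivAt (fun y => ξ y i) ((ContinuousLinearMap.proj i).comp (fderiv ℝ ξ x)) x :=
        (ContinuousLinearMap.proj (R := ℝ) (φ := fun _ : Fin p => ℝ) i).hasFDerivAt.comp x
          (hξ.differentiable (by simp) x).hasFDerivAt
      have hc : DifferentiableAt ℝ (fun y => L (truncate n (prolong f y))) x :=
        (hL.comp (contDiff_truncate_prolong hf n)).differentiable (by simp) x
      have := hξi.fun_mul hc.hasFDerivAt
      change fderiv ℝ (fun y => ξ y i * L (truncate n (prolong f y))) x _ = _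
      rw [this.fderiv]
      simp [prolong]
    have h4 : fderiv ℝ (fun y => L (truncate n (prolong f y))) x (ξ x) =
        fderiv ℝ L (truncate n (prolong f x)) (ξ x, fun α J =>
        fderiv ℝ (opPow partialX J.1 (fun y => f y α)) x (ξ x)) := by
      have h5 : HasFDerivAt (fun y => L (truncate n (prolong f y))) _ x :=
        hLd.hasFDerivAt.comp x hpr
      rw [h5.fderiv]
      rfl
    rw [totalDiv, Finset.sum_congr rfl fun i _ => h3 i, Finset.sum_add_distrib, ← Finset.mul_sum,
      ← h4, clm_apply_eq_sum _ (ξ x)]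
    rfl
  -- What remains is `DL` applied to `(0, ∂^J Q)` plus `DL` applied to `(ξ, D(∂^J f) ξ)`, which add
  -- up by linearity, and `L` times the trace of `Dξ`, which is the derivative of the determinant.
  simp only [partialU_comp_truncate _ _ _ hLd, h1]
  rw [sum_mul_fderiv_single _ fun α (J : MultiIndex p n) =>
    opPow partialX J.1 (fun y => (ψ (y, f y) - fderiv ℝ f y (ξ y)) α) x, h2, variation, id,
    fderiv_id, fderiv_det_id, ← add_assoc, ← map_add]
  have hdet : (ContinuousLinearMap.id ℝ (Fin p → ℝ)).det = 1 := LinearMap.det_id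
  rw [hdet, mul_one, Prod.mk_add_mk, zero_add]
  rfl

end Variation

/-! ### Differentiating the transformed integrand in the group parameter. -/

section Flow

variable {p q n : ℕ}

/-- The partial derivative `∂/∂x^i` of a function of `(η, x)`. -/
noncomputable def partialSlice (i : Fin p) (H : ℝ × (Fin p → ℝ) → ℝ) : ℝ × (Fin p → ℝ) → ℝ :=
  fun z => fderiv ℝ H z (0, Pi.single i 1)

/-- The partial derivative `∂/∂η` of a function of `(η, x)`. -/
noncomputable def partialEta {F : Type*} [NormedAddCommGroup F] [NormedSpace ℝ F]
    (H : ℝ × (Fin p → ℝ) → F) : ℝ × (Fin p → ℝ) → F :=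
  fun z => fderiv ℝ H z (1, 0)

theorem contDiff_partialSlice {H : ℝ × (Fin p → ℝ) → ℝ} (hH : ContDiff ℝ ∞ H) (i : Fin p) :
    ContDiff ℝ ∞ (partialSlice i H) :=
  (hH.fderiv_right (m := ∞) (by simp)).clm_apply contDiff_const

theorem contDiff_partialEta {F : Type*} [NormedAddCommGroup F] [NormedSpace ℝ F]
    {H : ℝ × (Fin p → ℝ) → F} (hH : ContDiff ℝ ∞ H) : ContDiff ℝ ∞ (partialEta H) :=
  (hH.fderiv_right (m := ∞) (by simp)).clm_apply contDiff_const

theorem fderiv_fderiv_apply {E F : Type*} [NormedAddCommGroup E] [NormedSpace ℝ E]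
    [NormedAddCommGroup F] [NormedSpace ℝ F] {H : E → F} (hH : ContDiff ℝ ∞ H) (z v w : E) :
    fderiv ℝ (fun y => fderiv ℝ H y v) z w = fderiv ℝ (fderiv ℝ H) z w v := by
  have hd := (hH.fderiv_right (m := ∞) (by simp)).differentiable (by simp) z
  rw [fderiv_clm_apply hd (differentiableAt_const v)]; simp

theorem fderiv_fderiv_symm {E F : Type*} [NormedAddCommGroup E] [NormedSpace ℝ E]
    [NormedAddCommGroup F] [NormedSpace ℝ F] {H : E → F} (hH : ContDiff ℝ ∞ H) (z v w : E) :
    fderiv ℝ (fderiv ℝ H) z w v = fderiv ℝ (fderiv ℝ H) z v w :=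
  (hH.contDiffAt.isSymmSndFDerivAt (by
    rw [minSmoothness_of_isRCLikeNormedField]; norm_cast)).eq _ _

/-- Symmetry of second derivatives on the joint space `(η, x)`. It makes the `η`-derivative of the
jet of `f'_η` the jet of its velocity. -/
theorem partialEta_partialSlice {H : ℝ × (Fin p → ℝ) → ℝ} (hH : ContDiff ℝ ∞ H) (i : Fin p) :
    partialEta (partialSlice i H) = partialSlice i (partialEta H) := by
  ext z
  change fderiv ℝ (fun y => fderiv ℝ H y _) z _ = fderiv ℝ (fun y => fderiv ℝ H y _) z _
  rw [fderiv_fderiv_apply hH, fderiv_fderiv_apply hH, fderiv_fderiv_symm hH]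

theorem hasFDerivAt_slice {F : Type*} [NormedAddCommGroup F] [NormedSpace ℝ F]
    {H : ℝ × (Fin p → ℝ) → F} (hH : ContDiff ℝ ∞ H) (η : ℝ) (x : Fin p → ℝ) :
    HasFDerivAt (fun y => H (η, y)) ((fderiv ℝ H (η, x)).comp (.inr ℝ ℝ (Fin p → ℝ))) x :=
  ((hH.differentiable (by simp) (η, x)).hasFDerivAt.comp x (hasFDerivAt_prodMk_right η x) :)

theorem partialX_slice {H : ℝ × (Fin p → ℝ) → ℝ} (hH : ContDiff ℝ ∞ H) (η : ℝ) (i : Fin p) :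
    (fun x => partialSlice i H (η, x)) = partialX i (fun y => H (η, y)) := by
  ext x
  rw [partialX, (hasFDerivAt_slice hH η x).fderiv]
  simp [partialSlice]

theorem opPow_partialSlice {H : ℝ × (Fin p → ℝ) → ℝ} (hH : ContDiff ℝ ∞ H) (J : Fin p → ℕ)
    (η : ℝ) : (fun x => opPow partialSlice J H (η, x)) = opPow partialX J (fun y => H (η, y)) :=
  opPow_semiconj (ContDiff ℝ ∞) (fun H x => H (η, x)) (fun i _ h => contDiff_partialSlice h i)
    (fun i _ h => partialX_slice h η i) J hH

theorem contDiff_opPow_partialSlice {H : ℝ × (Fin p → ℝ) → ℝ} (hH : ContDiff ℝ ∞ H)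
    (J : Fin p → ℕ) : ContDiff ℝ ∞ (opPow partialSlice J H) :=
  opPow_induction (ContDiff ℝ ∞) (fun i _ h => contDiff_partialSlice h i) J hH

theorem partialEta_opPow {H : ℝ × (Fin p → ℝ) → ℝ} (hH : ContDiff ℝ ∞ H) (J : Fin p → ℕ) :
    partialEta (opPow partialSlice J H) = opPow partialSlice J (partialEta H) :=
  opPow_semiconj (ContDiff ℝ ∞) partialEta (fun i _ h => contDiff_partialSlice h i)
    (fun i _ h => partialEta_partialSlice h i) J hH

theorem fderiv_one_eq {F : Type*} [NormedAddCommGroup F] [NormedSpace ℝ F]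
    {H : ℝ × (Fin p → ℝ) → F} (hH : ContDiff ℝ ∞ H) (η : ℝ) (x v : Fin p → ℝ) :
    fderiv ℝ H (η, x) (1, v) = partialEta H (η, x) + fderiv ℝ (fun y => H (η, y)) x v := by
  rw [(hasFDerivAt_slice hH η x).fderiv, partialEta, ContinuousLinearMap.comp_apply,
    ContinuousLinearMap.inr_apply, ← map_add]
  simp

/-- The transformed function as a function of `(η, x)`. -/
noncomputable def transformedFun (Ξ : ℝ × (Fin p → ℝ) → (Fin p → ℝ))
    (Ψ : ℝ × ((Fin p → ℝ) × (Fin q → ℝ)) → (Fin q → ℝ)) (f : (Fin p → ℝ) → (Fin q → ℝ)) :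
    ℝ × (Fin p → ℝ) → (Fin q → ℝ) :=
  fun z => transformed Ξ Ψ z.1 f z.2

/-- The integrand `L(Ξ_η(x), pr f'_η(Ξ_η(x))) det DΞ_η(x)`. -/
noncomputable def integrand (L : Jet p q n → ℝ) (Ξ : ℝ × (Fin p → ℝ) → (Fin p → ℝ))
    (Ψ : ℝ × ((Fin p → ℝ) × (Fin q → ℝ)) → (Fin q → ℝ)) (f : (Fin p → ℝ) → (Fin q → ℝ))
    (z : ℝ × (Fin p → ℝ)) : ℝ :=
  L (truncate n (prolong (transformed Ξ Ψ z.1 f) (Ξ z))) *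
    (fderiv ℝ (fun y => Ξ (z.1, y)) z.2).det

variable {L : Jet p q n → ℝ} {Ξ : ℝ × (Fin p → ℝ) → (Fin p → ℝ)}
  {Ψ : ℝ × ((Fin p → ℝ) × (Fin q → ℝ)) → (Fin q → ℝ)} {f : (Fin p → ℝ) → (Fin q → ℝ)}

theorem contDiff_transformedFun (hΞ : ContDiff ℝ ∞ Ξ) (hΨ : ContDiff ℝ ∞ Ψ)
    (hf : ContDiff ℝ ∞ f) : ContDiff ℝ ∞ (transformedFun Ξ Ψ f) := by
  have h : ContDiff ℝ ∞ (fun z : ℝ × (Fin p → ℝ) => Ξ (-z.1, z.2)) :=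
    hΞ.comp (contDiff_fst.neg.prodMk contDiff_snd)
  exact hΨ.comp (contDiff_fst.prodMk (h.prodMk (hf.comp h)))

/-- Prolongation at fixed `η` is rewritten through derivatives on the joint space, which makes joint
smoothness in `(η, x)` visible. -/
theorem integrand_eq (hΞ : ContDiff ℝ ∞ Ξ) (hΨ : ContDiff ℝ ∞ Ψ) (hf : ContDiff ℝ ∞ f) :
    integrand L Ξ Ψ f = fun z => L (Ξ z, fun α (J : MultiIndex p n) =>
      opPow partialSlice J.1 (fun z => transformedFun Ξ Ψ f z α) (z.1, Ξ z)) *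
        ((fderiv ℝ Ξ z).comp (.inr ℝ ℝ (Fin p → ℝ))).det := by
  ext z
  rw [integrand, (hasFDerivAt_slice hΞ z.1 z.2).fderiv]
  congr 2
  refine Prod.ext rfl ?_
  funext α J
  exact (congrFun (opPow_partialSlice (contDiff_pi.1 (contDiff_transformedFun hΞ hΨ hf) α) J.1 z.1)
    (Ξ z)).symm

theorem contDiff_integrand (hL : ContDiff ℝ ∞ L) (hΞ : ContDiff ℝ ∞ Ξ) (hΨ : ContDiff ℝ ∞ Ψ)
    (hf : ContDiff ℝ ∞ f) : ContDiff ℝ ∞ (integrand L Ξ Ψ f) := by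
  rw [integrand_eq hΞ hΨ hf]
  refine (hL.comp (hΞ.prodMk (contDiff_pi.2 fun α => contDiff_pi.2 fun J => ?_))).mul
    (contDiff_det.comp ((hΞ.fderiv_right (m := ∞) (by simp)).clm_comp contDiff_const))
  exact (contDiff_opPow_partialSlice (contDiff_pi.1 (contDiff_transformedFun hΞ hΨ hf) α) J.1).comp
    (contDiff_fst.prodMk hΞ)

theorem hasDerivAt_line {F : Type*} [NormedAddCommGroup F] [NormedSpace ℝ F]
    {H : ℝ × (Fin p → ℝ) → F} (hH : ContDiff ℝ ∞ H) (η : ℝ) (x : Fin p → ℝ) :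
    HasDerivAt (fun t => H (t, x)) (partialEta H (η, x)) η :=
  ((hH.differentiable (by simp) (η, x)).hasFDerivAt.comp_hasDerivAt η
    ((hasDerivAt_id η).prodMk (hasDerivAt_const η x)) :)

/-- The derivative of the integrand at `η = 0`. -/
theorem partialEta_integrand (hL : ContDiff ℝ ∞ L) (hΞ : ContDiff ℝ ∞ Ξ) (hΨ : ContDiff ℝ ∞ Ψ)
    (hf : ContDiff ℝ ∞ f) (x : Fin p → ℝ) :
    partialEta (integrand L Ξ Ψ f) (0, x) =
      variation L (fun y => Ξ (0, y)) (fun y => partialEta Ξ (0, y))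
        (fun y => transformedFun Ξ Ψ f (0, y))
        (fun y => partialEta (transformedFun Ξ Ψ f) (0, y)) x := by
  have hF := contDiff_transformedFun hΞ hΨ hf
  have hFα := fun α => contDiff_pi.1 hF α
  have h1 := hasDerivAt_line (contDiff_integrand hL hΞ hΨ hf) 0 x
  refine h1.unique ?_
  rw [integrand_eq hΞ hΨ hf]
  have hΞ' := hasDerivAt_line hΞ 0 x
  have ha : HasDerivAt (fun t => ((Ξ (t, x), fun α (J : MultiIndex p n) =>
      opPow partialSlice J.1 (fun z => transformedFun Ξ Ψ f z α) (t, Ξ (t, x))) : Jet p q n))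
      (partialEta Ξ (0, x), fun α J =>
        opPow partialX J.1 (fun y => partialEta (transformedFun Ξ Ψ f) (0, y) α) (Ξ (0, x)) +
        fderiv ℝ (opPow partialX J.1 (fun y => transformedFun Ξ Ψ f (0, y) α)) (Ξ (0, x))
          (partialEta Ξ (0, x))) 0 := by
    refine hΞ'.prodMk (hasDerivAt_pi.2 fun α => hasDerivAt_pi.2 fun J => ?_)
    have hH := contDiff_opPow_partialSlice (hFα α) J.1
    have h2 := (hH.differentiable (by simp) (0, Ξ (0, x))).hasFDerivAt.comp_hasDerivAt (0 : ℝ)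
      ((hasDerivAt_id (0 : ℝ)).prodMk hΞ')
    rw [fderiv_one_eq hH, partialEta_opPow (hFα α), opPow_partialSlice (hFα α)] at h2
    have h3 : partialEta (fun z => transformedFun Ξ Ψ f z α) =
        fun z => partialEta (transformedFun Ξ Ψ f) z α := by
      ext z
      have h4 : HasFDerivAt (fun z => transformedFun Ξ Ψ f z α) _ z :=
        (ContinuousLinearMap.proj (R := ℝ) (φ := fun _ : Fin q => ℝ) α).hasFDerivAt.comp z
          (hF.differentiable (by simp) z).hasFDerivAt
      rw [partialEta, h4.fderiv]
      rfl
    have h4 := congrFun (opPow_partialSlice (contDiff_partialEta (hFα α)) J.1 0) (Ξ (0, x))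
    rw [h4, h3] at h2
    exact h2
  -- The `η`-derivative of the Jacobian is the Jacobian of the velocity, again by symmetry of second
  -- derivatives.
  have hM : HasDerivAt (fun t => (fderiv ℝ Ξ (t, x)).comp (.inr ℝ ℝ (Fin p → ℝ)))
      (fderiv ℝ (fun y => partialEta Ξ (0, y)) x) 0 := by
    have h2 := (hasDerivAt_line (hΞ.fderiv_right (m := ∞) (by simp)) 0 x).clm_comp
      (hasDerivAt_const (0 : ℝ) (ContinuousLinearMap.inr ℝ ℝ (Fin p → ℝ)))
    convert h2 using 1
    rw [(hasFDerivAt_slice (contDiff_partialEta hΞ) 0 x).fderiv]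
    ext v : 1
    simp only [ContinuousLinearMap.comp_apply, ContinuousLinearMap.comp_zero, add_zero]
    change fderiv ℝ (fun y => fderiv ℝ Ξ y _) _ _ = fderiv ℝ (fderiv ℝ Ξ) _ _ _
    rw [fderiv_fderiv_apply hΞ, fderiv_fderiv_symm hΞ]
  have hLa := (hL.differentiable (by simp) _).hasFDerivAt.comp_hasDerivAt (0 : ℝ) ha
  have hdet := (contDiff_det.differentiable (by simp) _).hasFDerivAt.comp_hasDerivAt (0 : ℝ) hM
  have hb : ((Ξ (0, x), fun α (J : MultiIndex p n) =>
      opPow partialSlice J.1 (fun z => transformedFun Ξ Ψ f z α) (0, Ξ (0, x))) : Jet p q n) =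
      truncate n (prolong (fun y => transformedFun Ξ Ψ f (0, y)) (Ξ (0, x))) := by
    refine Prod.ext rfl ?_
    funext α J
    exact congrFun (opPow_partialSlice (hFα α) J.1 0) (Ξ (0, x))
  have h5 := hLa.mul hdet
  simp only [Function.comp_apply] at h5
  rw [variation, (hasFDerivAt_slice hΞ 0 x).fderiv, ← hb]
  exact h5

/-- Differentiation under the integral sign. -/
theorem hasDerivAt_setIntegral {H : ℝ × (Fin p → ℝ) → ℝ} (hH : ContDiff ℝ ∞ H)
    {B : Set (Fin p → ℝ)} (hB : IsCompact (closure B)) :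
    HasDerivAt (fun t => ∫ x in B, H (t, x)) (∫ x in B, partialEta H (0, x)) 0 := by
  have hc : ∀ {F : ℝ × (Fin p → ℝ) → ℝ}, Continuous F → ∀ t, Continuous fun x => F (t, x) :=
    fun hF t => hF.comp (continuous_const.prodMk continuous_id)
  have hE := (contDiff_partialEta hH).continuous
  obtain ⟨C, hC⟩ := ((isCompact_Icc (a := (-1 : ℝ)) (b := 1)).prod hB).exists_bound_of_continuousOn
    hE.continuousOn
  have hfin : volume B ≠ ⊤ := (measure_mono subset_closure).trans_lt hB.measure_lt_top |>.ne
  have hint : ∀ {F : (Fin p → ℝ) → ℝ}, Continuous F → IntegrableOn F B := fun hF =>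
    (hF.continuousOn.integrableOn_compact hB).mono_set subset_closure
  refine (hasDerivAt_integral_of_dominated_loc_of_deriv_le (μ := volume.restrict B)
    (F := fun t x => H (t, x)) (F' := fun t x => partialEta H (t, x)) (bound := fun _ => C)
    (s := Icc (-1) 1) (Icc_mem_nhds (by norm_num) (by norm_num))
    (.of_forall fun t => (hc hH.continuous t).aestronglyMeasurable) (hint (hc hH.continuous 0))
    (hc hE 0).aestronglyMeasurable ?_ (integrableOn_const hfin)
    (.of_forall fun x t _ => hasDerivAt_line hH t x)).2
  have hae : ∀ᵐ x ∂(volume.restrict B), x ∈ closure B :=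
    ae_restrict_of_ae_restrict_of_subset subset_closure
      (ae_restrict_mem isClosed_closure.measurableSet)
  filter_upwards [hae] with x hx t ht using hC (t, x) ⟨ht, hx⟩

end Flow


/-! ### Stability of evaluations under negligible perturbations. -/

section Approximation

variable {X E E' F G : Type*} [NormedAddCommGroup E] [NormedSpace ℝ E]
  [NormedAddCommGroup E'] [NormedSpace ℝ E'] [NormedAddCommGroup F] [NormedSpace ℝ F]
  [NormedAddCommGroup G] [NormedSpace ℝ G]
  {K : Set X}

theorem Small.eventually_le {u : ℝ → X → F} (hu : Small K (fun _ => 0) u) {δ : ℝ} (hδ : 0 < δ) :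
    ∀ᶠ ε : ℝ in 𝓝[>] 0, ∀ x ∈ K, ‖u ε x‖ ≤ δ := by
  obtain ⟨l, hl⟩ := hu
  filter_upwards [hl 1, eventually_mem_Ioo hδ] with ε h1 h2 x hx
  have := h1 x hx
  simp only [pow_one, add_zero, one_pow, mul_one] at this
  exact this.trans h2.2.le

theorem Small.congr {w : X → ℝ} {u v : ℝ → X → F} (hu : Small K w u)
    (h : ∀ᶠ ε : ℝ in 𝓝[>] 0, ∀ x ∈ K, u ε x = v ε x) : Small K w v :=
  hu.of_le (h.mono fun ε h x hx => by rw [h x hx])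

theorem Bdd.congr {w : X → ℝ} {u v : ℝ → X → F} (hu : Bdd K w u)
    (h : ∀ᶠ ε : ℝ in 𝓝[>] 0, ∀ x ∈ K, u ε x = v ε x) : Bdd K w v :=
  hu.of_le (h.mono fun ε h x hx => by rw [h x hx])

variable {w : X → ℝ}

theorem Small.pi (hw : ∀ x, 0 ≤ w x) {ι : Type*} [Fintype ι] {F : ι → Type*}
    [∀ i, SeminormedAddCommGroup (F i)] {u : ℝ → X → ∀ i, F i}
    (hu : ∀ i, Small K w (fun ε x => u ε x i)) : Small K w u := by
  refine (Small.sum hw Finset.univ fun i _ => (hu i).norm).of_le (.of_forall fun ε x _ => ?_)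
  refine le_trans ?_ (le_abs_self _)
  rw [pi_norm_le_iff_of_nonneg (Finset.sum_nonneg fun _ _ => norm_nonneg _)]
  exact fun i => Finset.single_le_sum (f := fun i => ‖u ε x i‖) (fun _ _ => norm_nonneg _)
    (Finset.mem_univ i)

theorem Bdd.pi (hw : ∀ x, 0 ≤ w x) {ι : Type*} [Fintype ι] {F : ι → Type*}
    [∀ i, SeminormedAddCommGroup (F i)] {u : ℝ → X → ∀ i, F i}
    (hu : ∀ i, Bdd K w (fun ε x => u ε x i)) : Bdd K w u := by
  refine (Bdd.sum hw Finset.univ fun i _ => (hu i).norm).of_le (.of_forall fun ε x _ => ?_)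
  refine le_trans ?_ (le_abs_self _)
  rw [pi_norm_le_iff_of_nonneg (Finset.sum_nonneg fun _ _ => norm_nonneg _)]
  exact fun i => Finset.single_le_sum (f := fun i => ‖u ε x i‖) (fun _ _ => norm_nonneg _)
    (Finset.mem_univ i)

theorem Small.prodMk (hw : ∀ x, 0 ≤ w x) {u : ℝ → X → F} {v : ℝ → X → G} (hu : Small K w u)
    (hv : Small K w v) : Small K w (fun ε x => (u ε x, v ε x)) :=
  hu.of_le_add hw hv (.of_forall fun _ _ _ => max_le_add_of_nonneg (norm_nonneg _) (norm_nonneg _))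

theorem Bdd.prodMk (hw : ∀ x, 0 ≤ w x) {u : ℝ → X → F} {v : ℝ → X → G} (hu : Bdd K w u)
    (hv : Bdd K w v) : Bdd K w (fun ε x => (u ε x, v ε x)) :=
  hu.of_le_add hw hv (.of_forall fun _ _ _ => max_le_add_of_nonneg (norm_nonneg _) (norm_nonneg _))

theorem Bdd.clm_apply (hw : ∀ x, 0 ≤ w x) {B : ℝ → X → F →L[ℝ] G} {v : ℝ → X → F}
    (hB : Bdd K w B) (hv : Bdd K w v) : Bdd K w (fun ε x => B ε x (v ε x)) :=
  hB.of_le_mul hw hv (.of_forall fun _ _ _ => ContinuousLinearMap.le_opNorm _ _)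

theorem Small.clm_apply (hw : ∀ x, 0 ≤ w x) {B : ℝ → X → F →L[ℝ] G} {v : ℝ → X → F}
    (hB : Bdd K w B) (hv : Small K w v) : Small K w (fun ε x => B ε x (v ε x)) :=
  Small.of_le_mul hw hB hv (.of_forall fun _ _ _ => ContinuousLinearMap.le_opNorm _ _)

/-- Continuity of evaluation with respect to negligible perturbations. -/
theorem Small.clm_apply_sub (hw : ∀ x, 0 ≤ w x) {B B' : ℝ → X → F →L[ℝ] G} {v v' : ℝ → X → F}
    (hB : Small K w (fun ε x => B ε x - B' ε x)) (hv : Small K w (fun ε x => v ε x - v' ε x))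
    (hB' : Bdd K w B') (hv' : Bdd K w v') :
    Small K w (fun ε x => B ε x (v ε x) - B' ε x (v' ε x)) := by
  have hvb : Bdd K w v := ((hv.bdd hw).add hw hv').congr (.of_forall fun _ _ _ => by simp)
  have h1 : Small K w (fun ε x => (B ε x - B' ε x) (v ε x)) :=
    Small.of_le_mul hw hvb hB (.of_forall fun _ _ _ => by
      rw [mul_comm]; exact ContinuousLinearMap.le_opNorm _ _)
  refine (h1.add hw (Small.clm_apply hw hB' hv)).congr (.of_forall fun ε x _ => ?_)
  simp

theorem Small.mul_sub (hw : ∀ x, 0 ≤ w x) {a a' b b' : ℝ → X → ℝ}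
    (ha : Small K w (fun ε x => a ε x - a' ε x)) (hb : Small K w (fun ε x => b ε x - b' ε x))
    (ha' : Bdd K w a') (hb' : Bdd K w b') :
    Small K w (fun ε x => a ε x * b ε x - a' ε x * b' ε x) := by
  have hbb : Bdd K w b := ((hb.bdd hw).add hw hb').congr (.of_forall fun _ _ _ => by simp)
  refine ((hbb.mul_small hw ha).add hw (ha'.mul_small hw hb)).congr (.of_forall fun ε x _ => ?_)
  ring

variable {W' : Set E} {S' : Set (Set E)} {w' : E → ℝ}

/-- Values of a moderate net at points which differ by a negligible quantity. -/
theorem ModNet.small_comp_sub {g : ℝ → E → F} (hg : ModNet W' S' w' g) {K' : Set E} (hK' : K' ∈ S')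
    {a b : ℝ → X → E} {δ : ℝ} (hδ : 0 < δ)
    (hb : ∀ᶠ ε : ℝ in 𝓝[>] 0, ∀ x ∈ K, ∀ y, ‖y - b ε x‖ ≤ δ → y ∈ K' ∧ w' y ≤ w' (b ε x) + 1)
    (hwb : Bdd K (fun _ => 0) (fun ε x => w' (b ε x)))
    (hab : Small K (fun _ => 0) (fun ε x => a ε x - b ε x)) :
    Small K (fun _ => 0) (fun ε x => g ε (a ε x) - g ε (b ε x)) := by
  have hw : ∀ x : X, (0 : ℝ) ≤ (fun _ => 0) x := fun _ => le_rfl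
  obtain ⟨N, hN⟩ := hg.bdd_fderiv hK'
  -- The mean value inequality on the ball of radius `δ` about `b`, where the weight grows by at
  -- most one; hence `2` instead of `1` in the gauge.
  refine Small.of_le_mul hw (((Bdd.inv hw).mul hw ((Bdd.const hw (2 : ℝ)).add hw hwb)).pow hw N)
    hab ?_
  filter_upwards [hb, hN, hab.eventually_le hδ, eventually_mem_Ioc] with ε h1 h2 h3 h4 x hx
  have hmem : ∀ y ∈ Metric.closedBall (b ε x) δ, ‖y - b ε x‖ ≤ δ := fun y hy => by
    rwa [← dist_eq_norm]
  have hε := inv_nonneg.2 h4.1.le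
  refine (convex_closedBall (b ε x) δ).norm_image_sub_le_of_norm_fderiv_le (𝕜 := ℝ)
    (fun y hy => (hg.contDiffAt h4 (hg.subset K' hK' (h1 x hx y (hmem y hy)).1)).differentiableAt
      (by simp)) (fun y hy => ?_) (Metric.mem_closedBall_self hδ.le) (by
        rw [Metric.mem_closedBall, dist_eq_norm]; exact h3 x hx)
  have h5 := h1 x hx y (hmem y hy)
  have h6 := hg.nonneg y
  refine ((h2 y h5.1).trans (pow_le_pow_left₀ (by positivity)
    (mul_le_mul_of_nonneg_left ?_ hε) N)).trans (le_abs_self _)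
  linarith [h5.2]

end Approximation

/-! ### Equality of moderate nets modulo negligible ones. -/

section Equivalence

variable {E F G : Type*} [NormedAddCommGroup E] [NormedSpace ℝ E]
  [NormedAddCommGroup F] [NormedSpace ℝ F] [NormedAddCommGroup G] [NormedSpace ℝ G]
  {W : Set E} {S : Set (Set E)} {w : E → ℝ} {u v : ℝ → E → F}

/-- Two moderate nets with negligible difference. -/
structure EquivNet (W : Set E) (S : Set (Set E)) (w : E → ℝ) (u v : ℝ → E → F) : Prop where
  left : ModNet W S w u
  right : ModNet W S w v
  neg : NegNet S w (fun ε x => u ε x - v ε x)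

theorem ModNet.equivNet_refl (hu : ModNet W S w u) : EquivNet W S w u u where
  left := hu
  right := hu
  neg K hK k := (Small.zero hu.nonneg (F := ℝ)).of_le (.of_forall fun ε x _ => by
    simp only [sub_self]
    refine (norm_iteratedFDeriv_const_le (0 : F) k x).trans ?_
    simp)

theorem EquivNet.fderiv (h : EquivNet W S w u v) :
    EquivNet W S w (fun ε => fderiv ℝ (u ε)) (fun ε => fderiv ℝ (v ε)) where
  left := h.left.fderiv
  right := h.right.fderiv
  neg K hK k := (h.neg K hK (k + 1)).of_le (by
    filter_upwards [eventually_mem_Ioc] with ε hε x hx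
    rw [← norm_iteratedFDeriv_fderiv]
    have : (fun y => _root_.fderiv ℝ (u ε) y - _root_.fderiv ℝ (v ε) y) =ᶠ[𝓝 x]
        _root_.fderiv ℝ (fun y => u ε y - v ε y) := by
      filter_upwards [h.left.isOpen.mem_nhds (h.left.subset K hK hx)] with y hy
      rw [fderiv_fun_sub ((h.left.contDiffAt hε hy).differentiableAt (by simp))
        ((h.right.contDiffAt hε hy).differentiableAt (by simp))]
    rw [(this.iteratedFDeriv ℝ k).eq_of_nhds])

theorem EquivNet.clm_comp (h : EquivNet W S w u v) (B : F →L[ℝ] G) :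
    EquivNet W S w (fun ε x => B (u ε x)) (fun ε x => B (v ε x)) where
  left := h.left.clm_comp B
  right := h.right.clm_comp B
  neg K hK k := by
    have hw := h.left.nonneg
    refine Small.of_le_mul hw (Bdd.const hw B) (h.neg K hK k) ?_
    filter_upwards [eventually_mem_Ioc] with ε hε x hx
    simp only [← map_sub]
    have hx' := h.left.subset K hK hx
    exact B.norm_iteratedFDeriv_comp_left
      ((h.left.contDiffAt hε hx').sub (h.right.contDiffAt hε hx')) (by exact_mod_cast le_top)

theorem EquivNet.small (h : EquivNet W S w u v) {K : Set E} (hK : K ∈ S) :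
    Small K w (fun ε x => u ε x - v ε x) := h.neg.small_zero hK

theorem EquivNet.fderiv_apply (h : EquivNet W S w u v) (e : E) :
    EquivNet W S w (fun ε x => _root_.fderiv ℝ (u ε) x e) (fun ε x => _root_.fderiv ℝ (v ε) x e) :=
  h.fderiv.clm_comp (ContinuousLinearMap.apply ℝ F e)

theorem ModNet.of_contDiff {g : E → F} (hg : ContDiff ℝ ∞ g) :
    ModNet univ (compactsIn (univ : Set E)) (fun _ => 0) (fun _ => g) :=
  (isFrame_compactsIn isOpen_univ).modNet (fun _ _ => hg.contDiffOn) fun K hK k => by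
    obtain ⟨C, hC⟩ := hK.1.exists_bound_of_continuousOn
      (hg.continuous_iteratedFDeriv (m := k) (by exact_mod_cast le_top)).continuousOn
    exact bdd_of_forall_le (fun _ => le_rfl) C fun _ => hC

/-- Equivalent nets evaluated at points differing from the identity by a negligible quantity. -/
theorem EquivNet.small_comp [ProperSpace E]
    (h : EquivNet univ (compactsIn (univ : Set E)) (fun _ => 0) u v)
    {A : ℝ → E → E} {K : Set E} (hK : IsCompact K)
    (hA : Small K (fun _ => 0) (fun ε x => A ε x - x)) :
    Small K (fun _ => 0) (fun ε x => u ε (A ε x) - v ε x) := by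
  have hK' : Metric.cthickening 1 K ∈ compactsIn (univ : Set E) :=
    ⟨hK.cthickening, subset_univ _⟩
  refine (Small.add (fun _ => le_rfl) (h.left.small_comp_sub hK' one_pos (b := fun _ x => x)
    (.of_forall fun ε x hx y hy => ⟨Metric.mem_cthickening_of_dist_le y x 1 K hx
      (by rwa [dist_eq_norm]), by simp⟩) (Bdd.const (fun _ => le_rfl) 0) hA)
    (h.small (K := K) ⟨hK, subset_univ _⟩)).congr (.of_forall fun ε x _ => by abel)

end Equivalence

/-! ### The variation depends only on classes. -/

section Variation

variable {p q n : ℕ}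

theorem opPow_net (u : ℝ → (Fin p → ℝ) → ℝ) (J : Fin p → ℕ) (ε : ℝ) :
    opPow (fun i (u : ℝ → (Fin p → ℝ) → ℝ) ε => partialX i (u ε)) J u ε = opPow partialX J (u ε) :=
  opPow_semiconj (T := fun i (u : ℝ → (Fin p → ℝ) → ℝ) ε => partialX i (u ε)) (T' := partialX)
    (fun _ => True) (fun u => u ε) (fun _ _ _ => trivial) (fun _ _ _ => rfl) J trivial

/-- The partial derivatives are taken as operators on whole nets; each preserves equivalence, so
their monomials do as well. -/
theorem EquivNet.opPow {W : Set (Fin p → ℝ)} {S : Set (Set (Fin p → ℝ))} {w : (Fin p → ℝ) → ℝ}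
    {u v : ℝ → (Fin p → ℝ) → ℝ} (h : EquivNet W S w u v) (J : Fin p → ℕ) :
    EquivNet W S w (fun ε => Colombeau.opPow partialX J (u ε))
      (fun ε => Colombeau.opPow partialX J (v ε)) := by
  have := opPow_rel (T := fun i (u : ℝ → (Fin p → ℝ) → ℝ) ε => partialX i (u ε))
    (T' := fun i (u : ℝ → (Fin p → ℝ) → ℝ) ε => partialX i (u ε)) (EquivNet W S w)
    (fun i a b h => h.fderiv_apply (Pi.single i 1)) J h
  simpa only [funext (opPow_net _ J)] using this

theorem ModNet.opPow {W : Set (Fin p → ℝ)} {S : Set (Set (Fin p → ℝ))} {w : (Fin p → ℝ) → ℝ}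
    {u : ℝ → (Fin p → ℝ) → ℝ} (h : ModNet W S w u) (J : Fin p → ℕ) :
    ModNet W S w (fun ε => Colombeau.opPow partialX J (u ε)) :=
  (h.equivNet_refl.opPow J).left

theorem EquivNet.component {W : Set (Fin p → ℝ)} {S : Set (Set (Fin p → ℝ))}
    {w : (Fin p → ℝ) → ℝ} {u v : ℝ → (Fin p → ℝ) → (Fin q → ℝ)} (h : EquivNet W S w u v)
    (α : Fin q) : EquivNet W S w (fun ε y => u ε y α) (fun ε y => v ε y α) :=
  h.clm_comp (ContinuousLinearMap.proj (R := ℝ) (φ := fun _ : Fin q => ℝ) α)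

theorem ModNet.truncate_prolong {U : Set (Fin p → ℝ)} {f : ℝ → (Fin p → ℝ) → (Fin q → ℝ)}
    (hf : ModNet U (compactsIn U) (fun _ => 0) f) (m : ℕ) :
    ModNet U (compactsIn U) (fun _ => 0) (fun ε x => truncate m (prolong (f ε) x)) := by
  have hF := hf.toIsFrame
  refine (hF.modNet_clm (.id ℝ _) fun K hK => bdd_clm_of_isCompact hK.1 (fun _ => le_rfl) _).prodMk
    (ModNet.pi hF fun α => ModNet.pi hF fun J => ?_)
  exact (hf.equivNet_refl.component α).left.opPow J.1

variable {Ω : Set (Fin p → ℝ)} {L : ℝ → Jet p q n → ℝ} {A V ξ : ℝ → (Fin p → ℝ) → (Fin p → ℝ)}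
  {F₀ F₁ f h : ℝ → (Fin p → ℝ) → (Fin q → ℝ)}

/-- The variation depends only on the classes of the nets which enter it. -/
theorem small_variation_sub (hΩ : IsOpen Ω)
    (hL : ModNet univ {closure Ω ×ˢ univ} (fun z => ‖z‖) L)
    (hA : EquivNet univ (compactsIn univ) (fun _ => 0) A (fun _ => id))
    (hV : EquivNet univ (compactsIn univ) (fun _ => 0) V ξ)
    (hF₀ : EquivNet univ (compactsIn univ) (fun _ => 0) F₀ f)
    (hF₁ : EquivNet univ (compactsIn univ) (fun _ => 0) F₁ h) {K : Set (Fin p → ℝ)}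
    (hK : K ∈ compactsIn Ω) :
    Small K (fun _ => 0) (fun ε x => variation (L ε) (A ε) (V ε) (F₀ ε) (F₁ ε) x -
      variation (L ε) id (ξ ε) (f ε) (h ε) x) := by
  have hw : ∀ x : Fin p → ℝ, (0 : ℝ) ≤ (fun _ => 0) x := fun _ => le_rfl
  have hK0 : K ∈ compactsIn (univ : Set (Fin p → ℝ)) := ⟨hK.1, subset_univ _⟩
  have eA : Small K (fun _ => 0) (fun ε x => A ε x - x) := hA.small hK0
  have bA : Bdd K (fun _ => 0) (fun _ x => x) := hA.right.bdd_zero hK0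
  have ea : Small K (fun _ => 0) (fun ε x => truncate n (prolong (F₀ ε) (A ε x)) -
      truncate n (prolong (f ε) x)) :=
    eA.prodMk hw (Small.pi hw fun α => Small.pi hw fun J =>
      ((hF₀.component α).opPow J.1).small_comp hK.1 eA)
  have ba : Bdd K (fun _ => 0) (fun ε x => truncate n (prolong (f ε) x)) :=
    (hF₀.right.truncate_prolong n).bdd_zero hK0
  have eb : Small K (fun _ => 0) (fun ε x => (((V ε x, fun α J =>
      opPow partialX J.1 (fun y => F₁ ε y α) (A ε x) +
        fderiv ℝ (opPow partialX J.1 (fun y => F₀ ε y α)) (A ε x) (V ε x)) : Jet p q n) -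
      (ξ ε x, fun α J => opPow partialX J.1 (fun y => h ε y α) x +
        fderiv ℝ (opPow partialX J.1 (fun y => f ε y α)) x (ξ ε x)))) := by
    refine (hV.small hK0).prodMk hw (Small.pi hw fun α => Small.pi hw fun J => ?_)
    refine ((((hF₁.component α).opPow J.1).small_comp hK.1 eA).add hw
      (Small.clm_apply_sub hw (((hF₀.component α).opPow J.1).fderiv.small_comp hK.1 eA)
        (hV.small hK0) (((hF₀.component α).opPow J.1).right.bdd_fderiv hK0)
        (hV.right.bdd_zero hK0))).congr (.of_forall fun ε x _ => ?_)
    simp only [Pi.sub_apply]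
    ring
  have bb : Bdd K (fun _ => 0) (fun ε x => ((ξ ε x, fun α J =>
      opPow partialX J.1 (fun y => h ε y α) x +
        fderiv ℝ (opPow partialX J.1 (fun y => f ε y α)) x (ξ ε x)) : Jet p q n)) :=
    (hV.right.bdd_zero hK0).prodMk hw (Bdd.pi hw fun α => Bdd.pi hw fun J =>
      (((hF₁.component α).opPow J.1).right.bdd_zero hK0).add hw
        (Bdd.clm_apply hw (((hF₀.component α).opPow J.1).right.bdd_fderiv hK0)
        (hV.right.bdd_zero hK0)))
  -- The growth of `L` is controlled only over `closure Ω`. The perturbed base points, and the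
  -- segments joining them to the original ones, must therefore stay in a thickening of `K` inside
  -- `Ω`.
  obtain ⟨δ, hδ, hKδ⟩ := hK.1.exists_cthickening_subset_open hΩ hK.2
  have hnear : ∀ᶠ ε : ℝ in 𝓝[>] 0, ∀ x ∈ K, ∀ y, ‖y - truncate n (prolong (f ε) x)‖ ≤ min δ 1 →
      y ∈ closure Ω ×ˢ univ ∧ ‖y‖ ≤ ‖truncate n (prolong (f ε) x)‖ + 1 := by
    refine .of_forall fun ε x hx y hy => ⟨⟨subset_closure (hKδ ?_), mem_univ _⟩, ?_⟩
    · refine Metric.mem_cthickening_of_dist_le _ x δ K hx ?_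
      rw [dist_eq_norm]
      exact (norm_fst_le (y - truncate n (prolong (f ε) x))).trans (hy.trans (min_le_left _ _))
    · have := norm_sub_norm_le y (truncate n (prolong (f ε) x))
      linarith [hy.trans (min_le_right _ _)]
  have hmem : ∀ᶠ ε : ℝ in 𝓝[>] 0, ∀ x ∈ K, truncate n (prolong (f ε) x) ∈
      closure Ω ×ˢ (univ : Set (Fin q → MultiIndex p n → ℝ)) :=
    .of_forall fun ε x hx => ⟨subset_closure (hK.2 hx), mem_univ _⟩
  have hδ' : 0 < min δ 1 := lt_min hδ one_pos
  have eL := hL.small_comp_sub (mem_singleton _) hδ' hnear ba.norm ea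
  have eDL := hL.fderiv.small_comp_sub (mem_singleton _) hδ' hnear ba.norm ea
  have bL := Bdd.comp hw (hL.bdd_zero (mem_singleton _)) hmem ba.norm
  have bDL := Bdd.comp hw (hL.bdd_fderiv (mem_singleton _)) hmem ba.norm
  have eM : Small K (fun _ => 0) (fun ε x => fderiv ℝ (A ε) x - fderiv ℝ id x) :=
    hA.fderiv.small hK0
  have hball : Metric.closedBall (ContinuousLinearMap.id ℝ (Fin p → ℝ)) 1 ∈
      compactsIn (univ : Set ((Fin p → ℝ) →L[ℝ] (Fin p → ℝ))) := by
    have : ProperSpace ((Fin p → ℝ) →L[ℝ] (Fin p → ℝ)) := FiniteDimensional.proper ℝ _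
    exact ⟨isCompact_closedBall _ _, subset_univ _⟩
  have hnear' : ∀ᶠ ε : ℝ in 𝓝[>] 0, ∀ x ∈ K, ∀ y, ‖y - fderiv ℝ id x‖ ≤ 1 →
      y ∈ Metric.closedBall (ContinuousLinearMap.id ℝ (Fin p → ℝ)) 1 ∧ (0 : ℝ) ≤ 0 + 1 :=
    .of_forall fun ε x _ y hy => ⟨by rwa [Metric.mem_closedBall, dist_eq_norm, ← fderiv_id], by simp⟩
  have hdet := ModNet.of_contDiff (contDiff_det (p := p))
  have edet := hdet.small_comp_sub hball one_pos hnear' (Bdd.const hw 0) eM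
  have eDdet := hdet.fderiv.small_comp_sub hball one_pos hnear' (Bdd.const hw 0) eM
  simp only [fderiv_id] at edet eDdet
  have e1 := Small.mul_sub hw (Small.clm_apply_sub hw eDL eb bDL bb) edet
    (Bdd.clm_apply hw bDL bb) (Bdd.const hw _)
  have e2 := Small.mul_sub hw eL (Small.clm_apply_sub hw eDdet (hV.fderiv.small hK0)
    (Bdd.const hw _) (hV.right.bdd_fderiv hK0)) bL (Bdd.clm_apply hw (Bdd.const hw _)
    (hV.right.bdd_fderiv hK0))
  refine (e1.add hw e2).congr (.of_forall fun ε x _ => ?_)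
  simp only [variation, id, fderiv_id]
  ring

end Variation


/-! ### Compositions mixing local and tempered estimates. -/

section Composition

variable {E E' Y F G : Type*} [NormedAddCommGroup E] [NormedSpace ℝ E]
  [NormedAddCommGroup E'] [NormedSpace ℝ E'] [NormedAddCommGroup Y] [NormedSpace ℝ Y]
  [NormedAddCommGroup F] [NormedSpace ℝ F] [NormedAddCommGroup G] [NormedSpace ℝ G]

theorem ModNet.comp_clm_compacts {g : ℝ → E' → F}
    (hg : ModNet univ (compactsIn univ) (fun _ => 0) g) (B : E →L[ℝ] E') :
    ModNet univ (compactsIn univ) (fun _ => 0) (fun ε x => g ε (B x)) := by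
  refine hg.comp ((isFrame_compactsIn isOpen_univ).modNet_clm B fun K hK =>
    bdd_clm_of_isCompact hK.1 (fun _ => le_rfl) B) fun K hK => ?_
  exact ⟨B '' K, ⟨hK.1.image B.continuous, subset_univ _⟩,
    .of_forall fun _ x hx => mem_image_of_mem _ hx, Bdd.const (fun _ => le_rfl) 0⟩

/-- Composition of a tempered net with a moderate net. -/
theorem ModNet.comp_tempered {U : Set E} {g : ℝ → E' → F} {a : ℝ → E → E'}
    (hg : ModNet univ {univ} (fun y => ‖y‖) g) (ha : ModNet U (compactsIn U) (fun _ => 0) a) :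
    ModNet U (compactsIn U) (fun _ => 0) (fun ε x => g ε (a ε x)) :=
  hg.comp ha fun _ hK => ⟨univ, rfl, .of_forall fun _ _ _ => mem_univ _, (ha.bdd_zero hK).norm⟩

theorem ModNet.clm {U : Set E} (hU : IsOpen U) (B : E →L[ℝ] F) :
    ModNet U (compactsIn U) (fun _ => 0) (fun _ x => B x) :=
  (isFrame_compactsIn hU).modNet_clm B fun _ hK => bdd_clm_of_isCompact hK.1 (fun _ => le_rfl) B

theorem ModNet.of_tempered {U : Set E} (hU : IsOpen U) {g : ℝ → E → F}
    (hg : ModNet univ {univ} (fun y => ‖y‖) g) : ModNet U (compactsIn U) (fun _ => 0) g :=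
  hg.comp_tempered (ModNet.clm hU (.id ℝ E))

/-- Composition of a net on `E' × Y`, tempered in the second variable, with a moderate net. -/
theorem ModNet.comp_mixed {g : ℝ → E' × Y → F}
    (hg : ModNet univ (slabsIn univ Y) (fun z => ‖z.2‖) g) (B : E →L[ℝ] E') {b : ℝ → E → Y}
    (hb : ModNet univ (compactsIn univ) (fun _ => 0) b) :
    ModNet univ (compactsIn univ) (fun _ => 0) (fun ε x => g ε (B x, b ε x)) :=
  hg.comp ((ModNet.clm isOpen_univ B).prodMk hb) fun K hK => ⟨(B '' K) ×ˢ univ,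
    ⟨B '' K, ⟨hK.1.image B.continuous, subset_univ _⟩, rfl⟩,
    .of_forall fun _ _ hx => ⟨mem_image_of_mem _ hx, mem_univ _⟩, (hb.bdd_zero hK).norm⟩

/-- Moderate nets are equivalent as soon as their values are. -/
theorem EquivNet.of_small [ProperSpace E] {u v : ℝ → E → F}
    (hu : ModNet univ (compactsIn univ) (fun _ => 0) u)
    (hv : ModNet univ (compactsIn univ) (fun _ => 0) v)
    (h : ∀ K, IsCompact K → Small K (fun _ => 0) (fun ε x => u ε x - v ε x)) :
    EquivNet univ (compactsIn univ) (fun _ => 0) u v where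
  left := hu
  right := hv
  neg := (hu.sub hv).negNet_of_small (fun K hK => h K hK.1) fun K hK =>
    ⟨Metric.cthickening 1 K, ⟨hK.1.cthickening, subset_univ _⟩, 1, one_pos, fun x hx y hy =>
      ⟨Metric.mem_cthickening_of_dist_le _ x 1 K hx (by simpa [dist_eq_norm] using hy), by simp⟩⟩

end Composition

/-! ### Initial values and velocities of the flow, up to negligible terms. -/

section Action

variable {p q : ℕ} {Ξ : ℝ → ℝ × (Fin p → ℝ) → (Fin p → ℝ)}
  {Ψ : ℝ → ℝ × ((Fin p → ℝ) × (Fin q → ℝ)) → (Fin q → ℝ)}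
  {ξ : ℝ → (Fin p → ℝ) → (Fin p → ℝ)} {ψ : ℝ → (Fin p → ℝ) × (Fin q → ℝ) → (Fin q → ℝ)}
  {f : ℝ → (Fin p → ℝ) → (Fin q → ℝ)}

section General

variable {X V : Type*} [NormedAddCommGroup V] [NormedSpace ℝ V] {Φ : ℝ → ℝ × V → V}
  {v : ℝ → V → V} {K : Set X} {y : ℝ → X → V}

/-- `Φ_0` is the identity up to negligible terms at moderate points. -/
theorem small_flow_zero (hzero : EqGTau (univ : Set V) (fun ε y => Φ ε (0, y)) (fun _ y => y))
    (hy : Bdd K (fun _ => 0) y) :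
    Small K (fun _ => 0) (fun ε x => Φ ε (0, y ε x) - y ε x) :=
  Small.comp (fun _ => le_rfl) ((eqGTau_iff.1 hzero).small_zero (mem_singleton _))
    (.of_forall fun _ _ _ => mem_univ _) hy.norm

/-- The spatial derivative of `Φ_0` is the identity up to negligible terms at moderate points. -/
theorem small_fderiv_flow_zero (hmem : ModNet univ (slabsIn univ V) (fun z => ‖z.2‖) Φ)
    (hzero : EqGTau (univ : Set V) (fun ε y => Φ ε (0, y)) (fun _ y => y))
    (hy : Bdd K (fun _ => 0) y) :
    Small K (fun _ => 0) (fun ε x => (fderiv ℝ (Φ ε) (0, y ε x)).comp (.inr ℝ ℝ V) -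
      ContinuousLinearMap.id ℝ V) := by
  refine (Small.comp (fun _ => le_rfl) ((eqGTau_iff.1 hzero).small_fderiv (mem_singleton _))
    (.of_forall fun _ _ _ => mem_univ _) hy.norm).congr ?_
  filter_upwards [eventually_mem_Ioc] with ε hε x _
  have h1 : HasFDerivAt (fun z => Φ ε (0, z) - z)
      ((fderiv ℝ (Φ ε) (0, y ε x)).comp (.inr ℝ ℝ V) - ContinuousLinearMap.id ℝ V) (y ε x) :=
    ((((hmem.contDiffAt hε (mem_univ _)).differentiableAt (by simp)).hasFDerivAt.comp (y ε x)
      (hasFDerivAt_prodMk_right 0 (y ε x)))).fun_sub (hasFDerivAt_id (y ε x))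
  exact h1.fderiv

/-- The initial velocity of `Φ` is the generator up to negligible terms at moderate points. -/
theorem small_flow_velocity (hmem : ModNet univ (slabsIn univ V) (fun z => ‖z.2‖) Φ)
    (hv : ModNet univ {univ} (fun y => ‖y‖) v)
    (hzero : EqGTau (univ : Set V) (fun ε y => Φ ε (0, y)) (fun _ y => y))
    (hflow : SatisfiesFlow v Φ) (hy : Bdd K (fun _ => 0) y) :
    Small K (fun _ => 0) (fun ε x => fderiv ℝ (Φ ε) (0, y ε x) (1, 0) - v ε (y ε x)) := by
  have hw : ∀ x : X, (0 : ℝ) ≤ (fun _ => 0) x := fun _ => le_rfl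
  -- At `η = 0` the flow equation gives `v(Φ_0(y))`; the second estimate replaces `Φ_0(y)` by `y`.
  have h1 := Small.comp hw ((eqGMixed_iff.1 hflow).small_zero
    (K := {0} ×ˢ univ) ⟨{0}, ⟨isCompact_singleton, subset_univ _⟩, rfl⟩)
    (a := fun ε x => ((0 : ℝ), y ε x)) (.of_forall fun _ _ _ => ⟨rfl, mem_univ _⟩) hy.norm
  have h2 := hv.small_comp_sub (mem_singleton _) one_pos (b := y) (.of_forall fun ε x _ z hz =>
    ⟨mem_univ _, by linarith [norm_sub_norm_le z (y ε x)]⟩) hy.norm (small_flow_zero hzero hy)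
  refine (h1.add hw h2).congr ?_
  filter_upwards [eventually_mem_Ioc] with ε hε x _
  have h3 : HasDerivAt (fun t => Φ ε (t, y ε x)) (fderiv ℝ (Φ ε) (0, y ε x) (1, 0)) 0 :=
    ((hmem.contDiffAt hε (mem_univ _)).differentiableAt (by simp)).hasFDerivAt.comp_hasDerivAt
      (0 : ℝ) ((hasDerivAt_id (0 : ℝ)).prodMk (hasDerivAt_const 0 (y ε x)))
  rw [h3.deriv]
  abel

end General

/-- The properties of a projectable generalized flow which enter the infinitesimal calculus. -/
structure IsTemperedFlow (Ξ : ℝ → ℝ × (Fin p → ℝ) → (Fin p → ℝ))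
    (Ψ : ℝ → ℝ × ((Fin p → ℝ) × (Fin q → ℝ)) → (Fin q → ℝ))
    (ξ : ℝ → (Fin p → ℝ) → (Fin p → ℝ))
    (ψ : ℝ → (Fin p → ℝ) × (Fin q → ℝ) → (Fin q → ℝ)) : Prop where
  mem : ModNet univ (slabsIn univ ((Fin p → ℝ) × (Fin q → ℝ))) (fun z => ‖z.2‖) (projectable Ξ Ψ)
  gen : ModNet univ {univ} (fun y => ‖y‖) (vectorField ξ ψ)
  zero : EqGTau (univ : Set ((Fin p → ℝ) × (Fin q → ℝ))) (fun ε y => projectable Ξ Ψ ε (0, y))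
    (fun _ y => y)
  flow : SatisfiesFlow (vectorField ξ ψ) (projectable Ξ Ψ)

namespace IsTemperedFlow

/-- Since `Ξ` does not involve `u`, the flow may be evaluated at points `(x, 0)`. -/
theorem modNet_base (h : IsTemperedFlow Ξ Ψ ξ ψ) : ModNet univ (compactsIn univ) (fun _ => 0) Ξ :=
  (h.mem.comp_mixed (ContinuousLinearMap.fst ℝ ℝ (Fin p → ℝ))
    (ModNet.clm isOpen_univ ((ContinuousLinearMap.inl ℝ (Fin p → ℝ) (Fin q → ℝ)).comp
      (ContinuousLinearMap.snd ℝ ℝ (Fin p → ℝ))))).clm_comp (ContinuousLinearMap.fst ℝ _ _)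

theorem contDiff_base (h : IsTemperedFlow Ξ Ψ ξ ψ) {ε : ℝ} (hε : ε ∈ Ioc (0 : ℝ) 1) :
    ContDiff ℝ ∞ (Ξ ε) := contDiffOn_univ.1 (h.modNet_base.smooth ε hε)

theorem contDiff_fiber (h : IsTemperedFlow Ξ Ψ ξ ψ) {ε : ℝ} (hε : ε ∈ Ioc (0 : ℝ) 1) :
    ContDiff ℝ ∞ (Ψ ε) := contDiff_snd.comp (contDiffOn_univ.1 (h.mem.smooth ε hε))

theorem modNet_zero (h : IsTemperedFlow Ξ Ψ ξ ψ) :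
    ModNet univ (compactsIn univ) (fun _ => 0) (fun ε x => Ξ ε (0, x)) :=
  h.modNet_base.comp_clm_compacts (.inr ℝ ℝ (Fin p → ℝ))

theorem modNet_velocity (h : IsTemperedFlow Ξ Ψ ξ ψ) :
    ModNet univ (compactsIn univ) (fun _ => 0) (fun ε x => partialEta (Ξ ε) (0, x)) :=
  (h.modNet_base.fderiv_apply (1, 0)).comp_clm_compacts (.inr ℝ ℝ (Fin p → ℝ))

theorem modNet_generator (h : IsTemperedFlow Ξ Ψ ξ ψ) :
    ModNet univ (compactsIn univ) (fun _ => 0) ξ :=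
  (h.gen.comp_tempered (ModNet.clm isOpen_univ (.inl ℝ (Fin p → ℝ) (Fin q → ℝ)))).clm_comp
    (ContinuousLinearMap.fst ℝ _ _)

/-- Temperedness of `f` is what keeps `f ∘ Ξ_{-η}` moderate: `Ξ_ε` may carry compact sets far away
as `ε` tends to zero. -/
theorem modNet_transformedFun (h : IsTemperedFlow Ξ Ψ ξ ψ)
    (hf : ModNet univ {univ} (fun x => ‖x‖) f) : ModNet univ (compactsIn univ) (fun _ => 0)
      (fun ε => transformedFun (Ξ ε) (Ψ ε) (f ε)) := by
  have ha := h.modNet_base.comp_clm_compacts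
    ((-ContinuousLinearMap.fst ℝ ℝ (Fin p → ℝ)).prod (ContinuousLinearMap.snd ℝ ℝ (Fin p → ℝ)))
  exact (h.mem.comp_mixed (ContinuousLinearMap.fst ℝ ℝ (Fin p → ℝ))
    (ha.prodMk (hf.comp_tempered ha))).clm_comp (ContinuousLinearMap.snd ℝ _ _)

theorem modNet_variation (h : IsTemperedFlow Ξ Ψ ξ ψ)
    (hf : ModNet univ {univ} (fun x => ‖x‖) f) : ModNet univ (compactsIn univ) (fun _ => 0)
      (fun ε x => ψ ε (x, f ε x) - fderiv ℝ (f ε) x (ξ ε x)) := by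
  have hf' := ModNet.of_tempered isOpen_univ hf
  exact ((h.gen.comp_tempered ((ModNet.clm isOpen_univ (.id ℝ _)).prodMk hf')).clm_comp
    (ContinuousLinearMap.snd ℝ _ _)).sub (hf'.fderiv.clm_apply h.modNet_generator)

theorem equivNet_zero (h : IsTemperedFlow Ξ Ψ ξ ψ) :
    EquivNet univ (compactsIn univ) (fun _ => 0) (fun ε x => Ξ ε (0, x)) (fun _ => id) := by
  refine .of_small h.modNet_zero (ModNet.clm isOpen_univ (.id ℝ _)) fun K hK => ?_
  exact (small_flow_zero h.zero (bdd_clm_of_isCompact hK (fun _ => le_rfl)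
    (.inl ℝ (Fin p → ℝ) (Fin q → ℝ)))).of_le (.of_forall fun ε x _ =>
      le_of_eq_of_le rfl (norm_fst_le (projectable Ξ Ψ ε (0, (x, 0)) - (x, 0))))

theorem velocity_eq (h : IsTemperedFlow Ξ Ψ ξ ψ) {ε : ℝ} (hε : ε ∈ Ioc (0 : ℝ) 1)
    (y : (Fin p → ℝ) × (Fin q → ℝ)) :
    (fderiv ℝ (projectable Ξ Ψ ε) (0, y) (1, 0)).1 = partialEta (Ξ ε) (0, y.1) := by
  have h1 : HasDerivAt (fun t => projectable Ξ Ψ ε (t, y))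
      (fderiv ℝ (projectable Ξ Ψ ε) (0, y) (1, 0)) 0 :=
    ((h.mem.contDiffAt hε (mem_univ _)).differentiableAt (by simp)).hasFDerivAt.comp_hasDerivAt
      (0 : ℝ) ((hasDerivAt_id (0 : ℝ)).prodMk (hasDerivAt_const 0 y))
  exact ((ContinuousLinearMap.fst ℝ (Fin p → ℝ) (Fin q → ℝ)).hasFDerivAt.comp_hasDerivAt (0 : ℝ)
    h1).unique (hasDerivAt_line (h.contDiff_base hε) 0 y.1)

theorem equivNet_velocity (h : IsTemperedFlow Ξ Ψ ξ ψ) :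
    EquivNet univ (compactsIn univ) (fun _ => 0) (fun ε x => partialEta (Ξ ε) (0, x)) ξ := by
  refine .of_small h.modNet_velocity h.modNet_generator fun K hK => ?_
  refine (small_flow_velocity h.mem h.gen h.zero h.flow (bdd_clm_of_isCompact hK (fun _ => le_rfl)
    (.inl ℝ (Fin p → ℝ) (Fin q → ℝ)))).of_le ?_
  filter_upwards [eventually_mem_Ioc] with ε hε x _
  refine le_of_eq_of_le ?_ (norm_fst_le _)
  rw [Prod.fst_sub, h.velocity_eq hε]
  rfl

theorem small_graph_sub (h : IsTemperedFlow Ξ Ψ ξ ψ) (hf : ModNet univ {univ} (fun x => ‖x‖) f)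
    {K : Set (Fin p → ℝ)} (hK : IsCompact K) : Small K (fun _ => 0) (fun ε x =>
      (Ξ ε (0, x), f ε (Ξ ε (0, x))) - (x, f ε x)) := by
  have hw : ∀ x : Fin p → ℝ, (0 : ℝ) ≤ (fun _ => 0) x := fun _ => le_rfl
  have hA := h.equivNet_zero.small (K := K) ⟨hK, subset_univ _⟩
  exact hA.prodMk hw ((ModNet.of_tempered isOpen_univ hf).equivNet_refl.small_comp hK hA)

theorem bdd_graph (h : IsTemperedFlow Ξ Ψ ξ ψ) (hf : ModNet univ {univ} (fun x => ‖x‖) f)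
    {K : Set (Fin p → ℝ)} (hK : IsCompact K) : Bdd K (fun _ => 0) (fun ε x =>
      (Ξ ε (0, x), f ε (Ξ ε (0, x)))) :=
  (h.modNet_zero.prodMk (hf.comp_tempered h.modNet_zero)).bdd_zero ⟨hK, subset_univ _⟩

theorem equivNet_transformed (h : IsTemperedFlow Ξ Ψ ξ ψ)
    (hf : ModNet univ {univ} (fun x => ‖x‖) f) : EquivNet univ (compactsIn univ) (fun _ => 0)
      (fun ε x => transformedFun (Ξ ε) (Ψ ε) (f ε) (0, x)) f := by
  have hw : ∀ x : Fin p → ℝ, (0 : ℝ) ≤ (fun _ => 0) x := fun _ => le_rfl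
  refine .of_small ((h.modNet_transformedFun hf).comp_clm_compacts (.inr ℝ ℝ (Fin p → ℝ)))
    (ModNet.of_tempered isOpen_univ hf) fun K hK => ?_
  refine ((small_flow_zero h.zero (h.bdd_graph hf hK)).add hw (h.small_graph_sub hf hK)).of_le
    (.of_forall fun ε x _ => ?_)
  refine le_of_eq_of_le ?_ (norm_snd_le _)
  simp [transformedFun, transformed, projectable]

/-- The chain rule along `t ↦ Φ_t(Ξ_{-t}(x), f(Ξ_{-t}(x)))`, split into the velocity of `Φ` and its
spatial derivative, because the two are approximated by different facts about the flow. -/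
theorem partialEta_transformedFun (h : IsTemperedFlow Ξ Ψ ξ ψ)
    (hf : ModNet univ {univ} (fun x => ‖x‖) f) {ε : ℝ} (hε : ε ∈ Ioc (0 : ℝ) 1) (x : Fin p → ℝ) :
    partialEta (transformedFun (Ξ ε) (Ψ ε) (f ε)) (0, x) =
      (fderiv ℝ (projectable Ξ Ψ ε) (0, (Ξ ε (0, x), f ε (Ξ ε (0, x)))) (1, 0) +
        (fderiv ℝ (projectable Ξ Ψ ε) (0, (Ξ ε (0, x), f ε (Ξ ε (0, x))))).comp
          (.inr ℝ ℝ ((Fin p → ℝ) × (Fin q → ℝ))) (-partialEta (Ξ ε) (0, x),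
            fderiv ℝ (f ε) (Ξ ε (0, x)) (-partialEta (Ξ ε) (0, x)))).2 := by
  have hfε : ContDiff ℝ ∞ (f ε) := contDiffOn_univ.1 (hf.smooth ε hε)
  have h1 : HasDerivAt (fun t => Ξ ε (-t, x)) (-partialEta (Ξ ε) (0, x)) 0 := by
    have h2 : HasDerivAt (fun t => Ξ ε (t, x)) (partialEta (Ξ ε) (0, x)) (-0) := by
      simpa using hasDerivAt_line (h.contDiff_base hε) 0 x
    have h3 := h2.scomp (0 : ℝ) (hasDerivAt_neg (0 : ℝ))
    rw [neg_one_smul] at h3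
    exact h3
  have h0 : Ξ ε (-0, x) = Ξ ε (0, x) := by rw [neg_zero]
  have h2 : HasDerivAt (fun t => f ε (Ξ ε (-t, x)))
      (fderiv ℝ (f ε) (Ξ ε (0, x)) (-partialEta (Ξ ε) (0, x))) 0 := by
    refine HasFDerivAt.comp_hasDerivAt (0 : ℝ) (l := f ε) ?_ h1
    rw [h0]
    exact (hfε.differentiable (by simp) _).hasFDerivAt
  have h3 : HasDerivAt (fun t => projectable Ξ Ψ ε (t, (Ξ ε (-t, x), f ε (Ξ ε (-t, x)))))
      (fderiv ℝ (projectable Ξ Ψ ε) (0, (Ξ ε (0, x), f ε (Ξ ε (0, x))))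
        (1, (-partialEta (Ξ ε) (0, x),
          fderiv ℝ (f ε) (Ξ ε (0, x)) (-partialEta (Ξ ε) (0, x))))) 0 := by
    refine HasFDerivAt.comp_hasDerivAt (0 : ℝ) (l := projectable Ξ Ψ ε) ?_
      ((hasDerivAt_id (0 : ℝ)).prodMk (h1.prodMk h2))
    simp only [neg_zero]
    exact ((h.mem.contDiffAt hε (mem_univ _)).differentiableAt (by simp)).hasFDerivAt
  have h4 := hasDerivAt_line (contDiff_transformedFun (h.contDiff_base hε) (h.contDiff_fiber hε) hfε)
    0 x
  rw [h4.unique ((ContinuousLinearMap.snd ℝ (Fin p → ℝ) (Fin q → ℝ)).hasFDerivAt.comp_hasDerivAt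
    (0 : ℝ) h3), ContinuousLinearMap.coe_snd', ContinuousLinearMap.comp_apply, ContinuousLinearMap.inr_apply, ← map_add]
  simp

/-- Three errors are collected: the velocity of `Φ` against `v` at the displaced graph point, the
displacement of that point, and the spatial derivative of `Φ_0` against the identity. The
`u`-component of the ideal expression is `ψ - Df(ξ)`. -/
theorem equivNet_transformed_velocity (h : IsTemperedFlow Ξ Ψ ξ ψ)
    (hf : ModNet univ {univ} (fun x => ‖x‖) f) : EquivNet univ (compactsIn univ) (fun _ => 0)
      (fun ε x => partialEta (transformedFun (Ξ ε) (Ψ ε) (f ε)) (0, x))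
      (fun ε x => ψ ε (x, f ε x) - fderiv ℝ (f ε) x (ξ ε x)) := by
  have hw : ∀ x : Fin p → ℝ, (0 : ℝ) ≤ (fun _ => 0) x := fun _ => le_rfl
  have hf' := ModNet.of_tempered isOpen_univ hf
  refine .of_small (((h.modNet_transformedFun hf).fderiv_apply (1, 0)).comp_clm_compacts
    (.inr ℝ ℝ (Fin p → ℝ))) (h.modNet_variation hf) fun K hK => ?_
  have hK0 : K ∈ compactsIn (univ : Set (Fin p → ℝ)) := ⟨hK, subset_univ _⟩
  have hA := h.equivNet_zero.small hK0
  have hV := h.equivNet_velocity.small hK0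
  have hy := h.bdd_graph hf hK
  have bξ := h.modNet_generator.neg.bdd_zero hK0
  have e1 := small_flow_velocity h.mem h.gen h.zero h.flow hy
  have e2 := h.gen.small_comp_sub (mem_singleton _) one_pos (b := fun ε x => (x, f ε x))
    (.of_forall fun ε x _ z hz => ⟨mem_univ _, by linarith [norm_sub_norm_le z (x, f ε x)]⟩)
    (((bdd_clm_of_isCompact hK hw (.id ℝ _)).prodMk hw (hf'.bdd_zero hK0)).norm :)
    (h.small_graph_sub hf hK)
  have eV : Small K (fun _ => 0) (fun ε x => -partialEta (Ξ ε) (0, x) - -ξ ε x) :=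
    hV.of_le (.of_forall fun ε x _ => by rw [neg_sub_neg, norm_sub_rev])
  have bD := hf'.bdd_fderiv hK0
  have eD := Small.clm_apply_sub hw (hf'.equivNet_refl.fderiv.small_comp hK hA) eV bD bξ
  have ec : Small K (fun _ => 0) (fun ε x => (-partialEta (Ξ ε) (0, x),
      fderiv ℝ (f ε) (Ξ ε (0, x)) (-partialEta (Ξ ε) (0, x))) -
        (-ξ ε x, fderiv ℝ (f ε) x (-ξ ε x))) := eV.prodMk hw eD
  have bc : Bdd K (fun _ => 0) (fun ε x => (-ξ ε x, fderiv ℝ (f ε) x (-ξ ε x))) :=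
    bξ.prodMk hw (Bdd.clm_apply hw bD bξ)
  have e3 := Small.clm_apply_sub hw (small_fderiv_flow_zero h.mem h.zero hy) ec
    (Bdd.const hw (ContinuousLinearMap.id ℝ ((Fin p → ℝ) × (Fin q → ℝ)))) bc
  refine ((e1.add hw e2).add hw e3).of_le ?_
  filter_upwards [eventually_mem_Ioc] with ε hε x _
  refine le_of_eq_of_le ?_ (norm_snd_le _)
  rw [h.partialEta_transformedFun hf hε]
  congr 1
  simp only [vectorField, Prod.snd_add, Prod.snd_sub, ContinuousLinearMap.id_apply, map_neg]
  abel

end IsTemperedFlow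

end Action


/-! ### The infinitesimal symmetry condition in integrated form. -/

section Integrals

variable {p q n : ℕ} {Ω : Set (Fin p → ℝ)} {L : ℝ → Jet p q n → ℝ}
  {Ξ : ℝ → ℝ × (Fin p → ℝ) → (Fin p → ℝ)}
  {Ψ : ℝ → ℝ × ((Fin p → ℝ) × (Fin q → ℝ)) → (Fin q → ℝ)}
  {ξ : ℝ → (Fin p → ℝ) → (Fin p → ℝ)} {ψ : ℝ → (Fin p → ℝ) × (Fin q → ℝ) → (Fin q → ℝ)}
  {f : ℝ → (Fin p → ℝ) → (Fin q → ℝ)}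

/-- The c-bounded representative maps compact sets into a compact `K'`; the given one differs from
it negligibly and so stays in a thickening of `K'`. Halving `η₀` leaves a compact parameter
interval. -/
theorem MemCBounded.exists_compact (hΩ : IsOpen Ω) {η₀ : ℝ} (hη₀ : 0 < η₀)
    (h : MemCBounded (Ioo (-η₀) η₀ ×ˢ Ω) Ω Ξ) {B : Set (Fin p → ℝ)} (hB : B ∈ compactsIn Ω) :
    ∃ η₁ : ℝ, 0 < η₁ ∧ ∃ K ∈ compactsIn Ω,
      ∀ᶠ ε : ℝ in 𝓝[>] 0, ∀ η ∈ Ioo (-η₁) η₁, ∀ x ∈ B, Ξ ε (η, x) ∈ K := by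
  obtain ⟨v, -, hv, -, hmap⟩ := h
  have hK0 : Icc (-(η₀ / 2)) (η₀ / 2) ×ˢ B ∈ compactsIn (Ioo (-η₀) η₀ ×ˢ Ω) :=
    ⟨isCompact_Icc.prod hB.1, prod_mono (Icc_subset_Ioo (by linarith) (by linarith)) hB.2⟩
  obtain ⟨K', hK', hmap'⟩ := hmap _ hK0
  obtain ⟨δ, hδ, hKδ⟩ := hK'.1.exists_cthickening_subset_open hΩ hK'.2
  refine ⟨η₀ / 2, by linarith, Metric.cthickening δ K', ⟨hK'.1.cthickening, hKδ⟩, ?_⟩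
  filter_upwards [hmap', ((eqG_iff.1 hv).small_zero hK0).eventually_le hδ] with ε h1 h2 η hη x hx
  have hz : (η, x) ∈ Icc (-(η₀ / 2)) (η₀ / 2) ×ˢ B := ⟨Ioo_subset_Icc_self hη, hx⟩
  exact Metric.mem_cthickening_of_dist_le _ _ _ _ (h1 hz) (by rw [dist_eq_norm]; exact h2 _ hz)

theorem continuous_variation_id {L : Jet p q n → ℝ} (hL : ContDiff ℝ ∞ L)
    {V : (Fin p → ℝ) → (Fin p → ℝ)} (hV : ContDiff ℝ ∞ V) {F₀ F₁ : (Fin p → ℝ) → (Fin q → ℝ)}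
    (hF₀ : ContDiff ℝ ∞ F₀) (hF₁ : ContDiff ℝ ∞ F₁) : Continuous (variation L id V F₀ F₁) := by
  have h1 := (contDiff_truncate_prolong hF₀ n).continuous
  have hV' := (hV.fderiv_right (m := ∞) (by simp)).continuous
  unfold variation
  simp only [fderiv_id, id]
  refine ((((hL.fderiv_right (m := ∞) (by simp)).continuous.comp h1).clm_apply
    (hV.continuous.prodMk (continuous_pi fun α => continuous_pi fun J => ?_))).mul
    continuous_const).add ((hL.continuous.comp h1).mul (continuous_const.clm_apply hV'))
  exact (contDiff_opPow_partialX (contDiff_component hF₁ α) J.1).continuous.add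
    (((contDiff_opPow_partialX (contDiff_component hF₀ α) J.1).fderiv_right (m := ∞)
      (by simp)).continuous.clm_apply hV.continuous)

theorem Small.setIntegral {T : ℝ → (Fin p → ℝ) → ℝ} {B : Set (Fin p → ℝ)}
    (hB : IsCompact (closure B)) (hT : Small B (fun _ => 0) T) :
    Small {(0 : ℝ)} (fun _ => 0) (fun ε _ => ∫ x in B, T ε x) := by
  have hw : ∀ x : ℝ, (0 : ℝ) ≤ (fun _ => 0) x := fun _ => le_rfl
  have hfin : volume B < ⊤ := (measure_mono subset_closure).trans_lt hB.measure_lt_top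
  obtain ⟨l, hl⟩ := hT
  refine Small.of_le_mul hw (Bdd.const hw (volume.real B)) (v := fun ε (_ : ℝ) => ⨆ x : B, |T ε x|)
    ⟨l, fun m => ?_⟩ ?_
  · filter_upwards [hl m, eventually_mem_Ioc] with ε h1 hε _ _
    have h2 : 0 ≤ ε ^ m * (1 + (0 : ℝ)) ^ l := by have := hε.1.le; positivity
    rw [Real.norm_of_nonneg (Real.iSup_nonneg fun _ => abs_nonneg _)]
    exact Real.iSup_le (fun x => h1 x x.2) h2
  · filter_upwards [hl 0] with ε h1 _ _
    rw [Real.norm_of_nonneg (Real.iSup_nonneg fun _ => abs_nonneg _), Real.norm_of_nonneg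
      measureReal_nonneg, mul_comm]
    refine norm_setIntegral_le_of_norm_le_const hfin fun x hx => ?_
    exact le_ciSup (f := fun x : B => |T ε x|) ⟨ε ^ 0 * (1 + 0) ^ l, by
      rintro _ ⟨y, rfl⟩; exact h1 y y.2⟩ ⟨x, hx⟩

/-- The infinitesimal form of the symmetry condition, integrated over an open set. -/
theorem IsVariationalSymmetry.small_integral (hsymm : IsVariationalSymmetry Ω L Ξ Ψ)
    (h : IsTemperedFlow Ξ Ψ ξ ψ) (hΩ : IsOpen Ω)
    (hL : ModNet univ {closure Ω ×ˢ univ} (fun z => ‖z‖) L)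
    (hf : ModNet univ {univ} (fun x => ‖x‖) f) {Ω₁ : Set (Fin p → ℝ)} (hΩ₁ : IsOpen Ω₁)
    (hcl : closure Ω₁ ∈ compactsIn Ω) (m : ℕ) :
    ∀ᶠ ε : ℝ in 𝓝[>] 0, |∫ x in Ω₁, variation (L ε) id (ξ ε) (f ε)
      (fun y => ψ ε (y, f ε y) - fderiv ℝ (f ε) y (ξ ε y)) x| ≤ ε ^ m := by
  have hw : ∀ x : ℝ, (0 : ℝ) ≤ (fun _ => 0) x := fun _ => le_rfl
  obtain ⟨η₀, hη₀, hcb⟩ := hsymm.cBounded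
  obtain ⟨η₁, hη₁, hK⟩ := hcb.exists_compact hΩ hη₀ hcl
  have h0 : ({0} : Set ℝ) ∈ compactsIn (Ioo (-η₁) η₁) :=
    ⟨isCompact_singleton, by simp [hη₁]⟩
  -- Equality in `𝒢` of an interval includes all derivatives in `η`, and the right-hand side does
  -- not depend on `η`. Differentiating at `0` thus makes the integral of the `η`-derivative
  -- negligible.
  have h1 := (eqG_iff.1 (hsymm.integral_eq Ω₁ Ω hΩ₁ hΩ hcl.1 hcl.2 le_rfl f
    ((memG_iff hΩ).2 (ModNet.of_tempered hΩ hf)) η₁ hη₁ hK)).small_fderiv h0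
  have hsm := fun {ε : ℝ} (hε : ε ∈ Ioc (0 : ℝ) 1) => contDiff_integrand
    (contDiffOn_univ.1 (hL.smooth ε hε)) (h.contDiff_base hε) (h.contDiff_fiber hε)
    (contDiffOn_univ.1 (hf.smooth ε hε))
  have hvar := fun {ε : ℝ} (hε : ε ∈ Ioc (0 : ℝ) 1) => partialEta_integrand
    (contDiffOn_univ.1 (hL.smooth ε hε)) (h.contDiff_base hε) (h.contDiff_fiber hε)
    (contDiffOn_univ.1 (hf.smooth ε hε))
  have e1 : Small {(0 : ℝ)} (fun _ => 0) (fun ε _ =>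
      ∫ x in Ω₁, partialEta (integrand (L ε) (Ξ ε) (Ψ ε) (f ε)) (0, x)) := by
    refine h1.of_le ?_
    filter_upwards [eventually_mem_Ioc] with ε hε x hx
    rw [mem_singleton_iff.1 hx, ← norm_deriv_eq_norm_fderiv]
    exact (congrArg norm ((hasDerivAt_setIntegral (hsm hε) hcl.1).sub_const _).deriv).symm.le
  have e2 := Small.setIntegral hcl.1 ((small_variation_sub hΩ hL h.equivNet_zero
    h.equivNet_velocity (h.equivNet_transformed hf) (h.equivNet_transformed_velocity hf) hcl).mono
      subset_closure)
  obtain ⟨l, hl⟩ := e1.sub hw e2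
  filter_upwards [hl m, eventually_mem_Ioc] with ε h2 hε
  have hint : ∀ {F : (Fin p → ℝ) → ℝ}, Continuous F → IntegrableOn F Ω₁ := fun hF =>
    (hF.continuousOn.integrableOn_compact hcl.1).mono_set subset_closure
  have hc1 : Continuous (fun x => partialEta (integrand (L ε) (Ξ ε) (Ψ ε) (f ε)) (0, x)) :=
    (contDiff_partialEta (hsm hε)).continuous.comp (continuous_const.prodMk continuous_id)
  have hc2 := continuous_variation_id (contDiffOn_univ.1 (hL.smooth ε hε))
    (contDiffOn_univ.1 (h.modNet_generator.smooth ε hε)) (contDiffOn_univ.1 (hf.smooth ε hε))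
    (contDiffOn_univ.1 ((h.modNet_variation hf).smooth ε hε))
  have h3 := h2 0 rfl
  simp only [← hvar hε] at h3
  rw [integral_sub (hint hc1) (hint hc2), sub_sub_cancel] at h3
  simpa using h3

end Integrals


/-! ### Tempered nets of Taylor polynomials. -/

section PolynomialNets

variable {p q N : ℕ}

theorem ModNet.pow {E : Type*} [NormedAddCommGroup E] [NormedSpace ℝ E] {W : Set E}
    {S : Set (Set E)} {w : E → ℝ} {u : ℝ → E → ℝ} (hu : ModNet W S w u) (k : ℕ) :
    ModNet W S w (fun ε x => u ε x ^ k) := by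
  induction k with
  | zero => simpa using hu.toIsFrame.modNet_const fun _ _ => Bdd.const hu.nonneg (1 : ℝ)
  | succ k ih => simpa only [pow_succ] using ih.mul hu

theorem ModNet.prod {E : Type*} [NormedAddCommGroup E] [NormedSpace ℝ E] {W : Set E}
    {S : Set (Set E)} {w : E → ℝ} {ι : Type*} (hF : IsFrame W S w) (s : Finset ι)
    {u : ι → ℝ → E → ℝ} (hu : ∀ i ∈ s, ModNet W S w (u i)) :
    ModNet W S w (fun ε x => ∏ i ∈ s, u i ε x) := by
  classical
  induction s using Finset.induction_on with
  | empty => simpa using hF.modNet_const fun _ _ => Bdd.const hF.nonneg (1 : ℝ)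
  | insert a s ha ih =>
    simp only [Finset.prod_insert ha]
    exact (hu a (by simp)).mul (ih fun i hi => hu i (by simp [hi]))

/-- Polynomials with moderate coefficients are tempered. -/
theorem modNet_jetPoly {z : ℝ → Jet p q N}
    (hz : Bdd (univ : Set (Fin p → ℝ)) (fun x => ‖x‖) (fun ε _ => z ε)) :
    ModNet univ {univ} (fun x => ‖x‖) (fun ε => jetPoly (z ε)) := by
  have hF := isFrame_norm (univ : Set (Fin p → ℝ))
  have hconst : ∀ {c : ℝ → ℝ}, (∀ ε, ‖c ε‖ ≤ ‖z ε‖) →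
      ModNet univ {univ} (fun x : Fin p → ℝ => ‖x‖) (fun ε _ => c ε) := fun hc =>
    hF.modNet_const fun K hK => by
      rw [mem_singleton_iff.1 hK]
      exact hz.of_le (.of_forall fun ε _ _ => hc ε)
  refine ModNet.pi hF fun α => ModNet.sum hF _ fun J _ => (hconst fun ε => ?_).mul
    (ModNet.prod hF _ fun i _ => ?_)
  · exact (norm_le_pi_norm ((z ε).2 α) J).trans ((norm_le_pi_norm (z ε).2 α).trans
      (norm_snd_le (z ε)))
  · simp only [div_eq_mul_inv]
    refine ((ModNet.sub ?_ (hconst fun ε => ?_)).pow _).mul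
      (hF.modNet_const fun _ _ => Bdd.const hF.nonneg _)
    · exact hF.modNet_clm (ContinuousLinearMap.proj (R := ℝ) (φ := fun _ : Fin p => ℝ) i)
        fun K _ => bdd_clm_of_norm K _
    · exact (norm_le_pi_norm (z ε).1 i).trans (norm_fst_le (z ε))

end PolynomialNets

/-! ### From functions to jets, and from moderate points to all points. -/

section Negligibility

variable {p q N : ℕ} {Ω : Set (Fin p → ℝ)} {g : ℝ → Jet p q N → ℝ}
  {f : ℝ → (Fin p → ℝ) → (Fin q → ℝ)}

/-- Insertion of the jet of a moderate net into a net tempered in the jet variables. -/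
theorem ModNet.comp_prolong (hg : ModNet univ {closure Ω ×ˢ univ} (fun z => ‖z‖) g)
    {U : Set (Fin p → ℝ)} (hU : U ⊆ Ω) (hf : ModNet U (compactsIn U) (fun _ => 0) f) :
    ModNet U (compactsIn U) (fun _ => 0) (fun ε x => g ε (truncate N (prolong (f ε) x))) :=
  hg.comp (hf.truncate_prolong N) fun _ hK => ⟨_, rfl, .of_forall fun _ _ hx =>
    ⟨subset_closure (hU (hK.2 hx)), mem_univ _⟩, ((hf.truncate_prolong N).bdd_zero hK).norm⟩

/-- Over a compact set of base points `‖z‖ ≤ C + ‖z.2‖`, so the full weight may be replaced by one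
in the jet variables. -/
theorem ModNet.of_norm_weight {A : Set (Fin p → ℝ)} (hΩ : Ω ⊆ A)
    (hg : ModNet univ {A ×ˢ univ} (fun z => ‖z‖) g) :
    ModNet univ (slabsIn Ω (Fin q → MultiIndex p N → ℝ)) (fun z => ‖z.2‖) g := by
  have hw : ∀ z : Jet p q N, (0 : ℝ) ≤ ‖z.2‖ := fun _ => norm_nonneg _
  refine IsFrame.modNet ⟨isOpen_univ, fun _ _ => subset_univ _, hw⟩ hg.smooth ?_
  rintro _ ⟨K, hK, rfl⟩ k
  refine Bdd.of_weight_le hw ?_ ((hg.bdd _ rfl k).mono (prod_mono (hK.2.trans hΩ) le_rfl))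
  obtain ⟨C, hC⟩ := hK.1.isBounded.exists_norm_le
  refine (Bdd.of_le_add hw (Bdd.const hw C) (Bdd.weight hw) (.of_forall fun ε z hz => ?_)
    : Bdd (K ×ˢ univ) (fun z : Jet p q N => ‖z.2‖) fun _ z => ‖z‖)
  rw [norm_norm, norm_norm, Prod.norm_def]
  exact max_le ((hC _ hz.1).trans ((le_abs_self C).trans (le_add_of_nonneg_right (norm_nonneg _))))
    (le_add_of_nonneg_left (norm_nonneg _))

/-- A net with small integrals along all jets of tempered functions is small at moderate points. -/
theorem eventually_abs_le_at_moderate_points (hΩ : IsOpen Ω)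
    (hg : ModNet univ {closure Ω ×ˢ univ} (fun z => ‖z‖) g)
    (hint : ∀ f : ℝ → (Fin p → ℝ) → (Fin q → ℝ), ModNet univ {univ} (fun x => ‖x‖) f →
      ∀ Ω₁, IsOpen Ω₁ → closure Ω₁ ∈ compactsIn Ω → ∀ m : ℕ, ∀ᶠ ε : ℝ in 𝓝[>] 0,
        |∫ x in Ω₁, g ε (truncate N (prolong (f ε) x))| ≤ ε ^ m)
    {K : Set (Fin p → ℝ)} (hK : K ∈ compactsIn Ω) (M m : ℕ) :
    ∀ᶠ ε : ℝ in 𝓝[>] 0, ∀ z : Jet p q N, z.1 ∈ K → ‖z.2‖ ≤ (ε⁻¹) ^ M → |g ε z| ≤ ε ^ m := by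
  rcases K.eq_empty_or_nonempty with rfl | ⟨x₀, hx₀⟩
  · simp
  -- A test jet for each `ε`: a counterexample if there is one, and `(x₀, 0)` otherwise. Smallness
  -- at the test jet then implies smallness at every admissible jet.
  have hex : ∀ ε : ℝ, ∃ z : Jet p q N, ε ∈ Ioc (0 : ℝ) 1 → z.1 ∈ K ∧ ‖z.2‖ ≤ (ε⁻¹) ^ M ∧
      (|g ε z| ≤ ε ^ m →
        ∀ z' : Jet p q N, z'.1 ∈ K → ‖z'.2‖ ≤ (ε⁻¹) ^ M → |g ε z'| ≤ ε ^ m) := by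
    intro ε
    by_cases hbad : ∃ z' : Jet p q N, z'.1 ∈ K ∧ ‖z'.2‖ ≤ (ε⁻¹) ^ M ∧ ¬ |g ε z'| ≤ ε ^ m
    · obtain ⟨z', h1, h2, h3⟩ := hbad
      exact ⟨z', fun _ => ⟨h1, h2, fun h => absurd h h3⟩⟩
    · push Not at hbad
      refine ⟨(x₀, 0), fun hε => ⟨hx₀, ?_, fun _ => hbad⟩⟩
      rw [norm_zero]
      exact pow_nonneg (inv_nonneg.2 hε.1.le) M
  choose z hz using hex
  have hw : ∀ x : Fin p → ℝ, (0 : ℝ) ≤ ‖x‖ := fun _ => norm_nonneg _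
  have hzb : Bdd (univ : Set (Fin p → ℝ)) (fun x => ‖x‖) (fun ε _ => z ε) := by
    obtain ⟨C, hC⟩ := hK.1.isBounded.exists_norm_le
    refine Bdd.of_le_add hw (Bdd.const hw C) ((Bdd.inv hw).pow hw M) ?_
    filter_upwards [eventually_mem_Ioc] with ε hε _ _
    rw [Prod.norm_def]
    exact max_le ((hC _ (hz ε hε).1).trans ((le_abs_self C).trans (le_add_of_nonneg_right
      (norm_nonneg _)))) ((hz ε hε).2.1.trans ((le_abs_self _).trans
        (le_add_of_nonneg_left (norm_nonneg _))))
  have hf := modNet_jetPoly hzb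
  filter_upwards [eventually_abs_le_of_integral_small
    (hg.comp_prolong le_rfl (ModNet.of_tempered hΩ hf)) (hint _ hf) hK m, eventually_mem_Ioc]
    with ε h1 hε
  refine (hz ε hε).2.2 ?_
  have h2 := h1 _ (hz ε hε).1
  rwa [prolong_jetPoly, truncate_extend] at h2

/-- A tempered net which is small at moderate points is negligible. -/
theorem negNet_of_moderate_points (hΩ : IsOpen Ω)
    (hg : ModNet univ {closure Ω ×ˢ univ} (fun z => ‖z‖) g)
    (h : ∀ K ∈ compactsIn Ω, ∀ M m : ℕ, ∀ᶠ ε : ℝ in 𝓝[>] 0, ∀ z : Jet p q N, z.1 ∈ K →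
      ‖z.2‖ ≤ (ε⁻¹) ^ M → |g ε z| ≤ ε ^ m) :
    NegNet (slabsIn Ω (Fin q → MultiIndex p N → ℝ)) (fun z => ‖z.2‖) g := by
  have hg' := hg.of_norm_weight subset_closure
  refine hg'.negNet_of_small ?_ ?_
  · rintro _ ⟨K, hK, rfl⟩
    obtain ⟨k, hk⟩ := hg'.bdd_zero (K := K ×ˢ univ) ⟨K, hK, rfl⟩
    refine ⟨k + 1, fun m => ?_⟩
    filter_upwards [hk, h K hK (m + k) m, eventually_mem_Ioc] with ε h1 h2 hε z hz
    have h3 : 1 ≤ 1 + ‖z.2‖ := by linarith [norm_nonneg z.2]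
    have hm : 0 ≤ ε ^ m := pow_nonneg hε.1.le m
    -- Jets of size at most `ε^{-(m+k)}` are covered by the hypothesis. For larger ones `ε^{-k} ≤
    -- ε^m (1 + ‖z.2‖)`, so the moderate bound becomes a negligible one with weight exponent `k +
    -- 1`, independent of `m`.
    rcases le_total ‖z.2‖ ((ε⁻¹) ^ (m + k)) with h4 | h4
    · exact (h2 z hz.1 h4).trans (le_mul_of_one_le_right hm (one_le_pow₀ h3))
    · have h5 : (ε⁻¹) ^ k ≤ ε ^ m * (1 + ‖z.2‖) := by
        have h6 : (ε⁻¹) ^ k = ε ^ m * (ε⁻¹) ^ (m + k) := by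
          rw [pow_add, ← mul_assoc, ← mul_pow, mul_inv_cancel₀ hε.1.ne', one_pow, one_mul]
        rw [h6]
        exact mul_le_mul_of_nonneg_left (by linarith) hm
      calc ‖g ε z‖ ≤ (ε⁻¹ * (1 + ‖z.2‖)) ^ k := h1 z hz
        _ = (ε⁻¹) ^ k * (1 + ‖z.2‖) ^ k := mul_pow _ _ _
        _ ≤ ε ^ m * (1 + ‖z.2‖) * (1 + ‖z.2‖) ^ k :=
          mul_le_mul_of_nonneg_right h5 (by positivity)
        _ = ε ^ m * (1 + ‖z.2‖) ^ (k + 1) := by ring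
  · rintro _ ⟨K, hK, rfl⟩
    obtain ⟨δ, hδ, hKδ⟩ := hK.1.exists_cthickening_subset_open hΩ hK.2
    refine ⟨Metric.cthickening δ K ×ˢ univ, ⟨_, ⟨hK.1.cthickening, hKδ⟩, rfl⟩, min δ 1,
      lt_min hδ one_pos, fun z hz y hy => ⟨⟨?_, mem_univ _⟩, ?_⟩⟩
    · refine Metric.mem_cthickening_of_dist_le _ z.1 δ K hz.1 ?_
      rw [dist_eq_norm, Prod.fst_add, add_sub_cancel_left]
      exact (norm_fst_le y).trans (hy.trans (min_le_left _ _))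
    · exact (norm_add_le z.2 y.2).trans (add_le_add_right ((norm_snd_le y).trans
        (hy.trans (min_le_right _ _))) _)

end Negligibility


/-! ### Sums of negligible nets. -/

section Sums

variable {E F : Type*} [NormedAddCommGroup E] [NormedSpace ℝ E] [NormedAddCommGroup F]
  [NormedSpace ℝ F] {W : Set E} {S : Set (Set E)} {w : E → ℝ} {u v : ℝ → E → F}

theorem ModNet.congr (hu : ModNet W S w u) (h : ∀ ε ∈ Ioc (0 : ℝ) 1, u ε = v ε) :
    ModNet W S w v :=
  hu.toIsFrame.modNet (fun ε hε => h ε hε ▸ hu.smooth ε hε) fun K hK k => (hu.bdd K hK k).of_le (by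
    filter_upwards [eventually_mem_Ioc] with ε hε x _
    rw [h ε hε])

theorem NegNet.add (hu : ModNet W S w u) (hv : ModNet W S w v) (hun : NegNet S w u)
    (hvn : NegNet S w v) : NegNet S w (fun ε x => u ε x + v ε x) := by
  intro K hK k
  refine Small.of_le_add hu.nonneg (hun K hK k) (hvn K hK k) ?_
  filter_upwards [eventually_mem_Ioc] with ε hε x hx
  have hx' := hu.subset K hK hx
  rw [fun_iteratedFDeriv_add_apply ((hu.contDiffAt hε hx').of_le (by exact_mod_cast le_top))
    ((hv.contDiffAt hε hx').of_le (by exact_mod_cast le_top))]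
  exact norm_add_le _ _

theorem NegNet.zero (hF : IsFrame W S w) : NegNet S w (fun _ _ => (0 : F)) := fun _ _ _ =>
  (Small.zero hF.nonneg (F := F)).of_le (.of_forall fun _ _ _ => norm_iteratedFDeriv_const_le _ _ _)

theorem NegNet.sum (hF : IsFrame W S w) {ι : Type*} (s : Finset ι) {u : ι → ℝ → E → F}
    (hu : ∀ i ∈ s, ModNet W S w (u i)) (hun : ∀ i ∈ s, NegNet S w (u i)) :
    NegNet S w (fun ε x => ∑ i ∈ s, u i ε x) := by
  classical
  induction s using Finset.induction_on with
  | empty => simpa using NegNet.zero hF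
  | insert a s ha ih =>
    simp only [Finset.sum_insert ha]
    exact .add (hu a (by simp)) (.sum hF s fun i hi => hu i (by simp [hi])) (hun a (by simp))
      (ih (fun i hi => hu i (by simp [hi])) fun i hi => hun i (by simp [hi]))

end Sums

/-! ### The conserved current and the conservation law. -/

section Conservation

variable {p q n : ℕ} {A Ω : Set (Fin p → ℝ)} {L : ℝ → Jet p q n → ℝ}
  {ξ : ℝ → (Fin p → ℝ) → (Fin p → ℝ)} {ψ : ℝ → (Fin p → ℝ) × (Fin q → ℝ) → (Fin q → ℝ)}

theorem modNet_tempered_base (hgen : ModNet univ {univ} (fun y => ‖y‖) (vectorField ξ ψ))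
    {m : ℕ} (i : Fin p) :
    ModNet univ {A ×ˢ univ} (fun z => ‖z‖) (fun ε (z : Jet p q m) => ξ ε z.1 i) :=
  (hgen.comp_clm ((ContinuousLinearMap.inl ℝ (Fin p → ℝ) (Fin q → ℝ)).comp
    (ContinuousLinearMap.fst ℝ (Fin p → ℝ) (Fin q → MultiIndex p m → ℝ)))
    (mapsTo_univ _ _)).clm_comp ((ContinuousLinearMap.proj (R := ℝ) (φ := fun _ : Fin p => ℝ)
      i).comp (ContinuousLinearMap.fst ℝ _ _))

theorem jetNet_base (hξ : ∀ ε, ContDiff ℝ ∞ (ξ ε))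
    (hgen : ModNet univ {univ} (fun y => ‖y‖) (vectorField ξ ψ)) (i : Fin p) :
    JetNet (q := q) A 0 (fun ε z => ξ ε z.1 i) :=
  ⟨fun ε z => ξ ε z.1 i, fun ε => (contDiff_pi.1 (hξ ε) i).comp contDiff_fst,
    modNet_tempered_base hgen i, fun _ => rfl⟩

theorem jetNet_coordinate {m : ℕ} (α : Fin q) (J : MultiIndex p m) :
    JetNet A m (fun _ z => z.2 α J.1) := by
  let B : Jet p q m →L[ℝ] ℝ := (ContinuousLinearMap.proj (R := ℝ)
    (φ := fun _ : MultiIndex p m => ℝ) J).comp ((ContinuousLinearMap.proj (R := ℝ)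
      (φ := fun _ : Fin q => MultiIndex p m → ℝ) α).comp (ContinuousLinearMap.snd ℝ _ _))
  exact ⟨fun _ z => B z, fun _ => B.contDiff,
    (isFrame_norm _).modNet_clm B fun K _ => bdd_clm_of_norm K B, fun _ => rfl⟩

theorem jetNet_fiber (hψ : ∀ ε, ContDiff ℝ ∞ (ψ ε))
    (hgen : ModNet univ {univ} (fun y => ‖y‖) (vectorField ξ ψ)) (α : Fin q) :
    JetNet A 0 (fun ε z => ψ ε (z.1, fun β => z.2 β 0) α) := by
  let B : Jet p q 0 →L[ℝ] (Fin p → ℝ) × (Fin q → ℝ) := (ContinuousLinearMap.fst ℝ _ _).prod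
    (ContinuousLinearMap.pi fun β => (ContinuousLinearMap.proj (R := ℝ)
      (φ := fun _ : MultiIndex p 0 => ℝ) ⟨0, by simp⟩).comp ((ContinuousLinearMap.proj (R := ℝ)
        (φ := fun _ : Fin q => MultiIndex p 0 → ℝ) β).comp (ContinuousLinearMap.snd ℝ _ _)))
  exact ⟨fun ε z => ψ ε (B z) α, fun ε => (contDiff_pi.1 (hψ ε) α).comp B.contDiff,
    (hgen.comp_clm B (mapsTo_univ _ _)).clm_comp ((ContinuousLinearMap.proj (R := ℝ)
      (φ := fun _ : Fin q => ℝ) α).comp (ContinuousLinearMap.snd ℝ _ _)), fun _ => rfl⟩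

theorem jetNet_characteristic (hξ : ∀ ε, ContDiff ℝ ∞ (ξ ε)) (hψ : ∀ ε, ContDiff ℝ ∞ (ψ ε))
    (hgen : ModNet univ {univ} (fun y => ‖y‖) (vectorField ξ ψ)) (α : Fin q) :
    JetNet A 1 (fun ε => characteristic (ξ ε) (ψ ε) α) :=
  ((jetNet_fiber hψ hgen α).mono zero_le_one).sub (JetNet.sum _ fun i _ =>
    ((jetNet_base hξ hgen i).mono zero_le_one).mul
      (jetNet_coordinate α (⟨Pi.single i 1, by simp⟩ : MultiIndex p 1)))

/-- The derivatives `∂L/∂u_J` have order `n`, and `D_J` raises it by `|J| ≤ n`. -/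
theorem jetNet_euler (hLs : ∀ ε, ContDiff ℝ ∞ (L ε))
    (hL : ModNet univ {A ×ˢ univ} (fun z => ‖z‖) L) (α : Fin q) :
    JetNet A (2 * n) (fun ε => euler (L ε) α) := by
  have h0 : JetNet A n (fun ε => L ε ∘ truncate n) := ⟨L, hLs, hL, fun _ => rfl⟩
  refine JetNet.sum Finset.univ fun J _ => (JetNet.const _).mul
    (((h0.partialU α J).opPow_totalD J.1).mono ?_)
  have := J.2
  omega

theorem JetNet.totalDiv {m : ℕ} {P : Fin p → ℝ → JetInf p q → ℝ} (hP : ∀ i, JetNet A m (P i)) :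
    JetNet A (m + 1) (fun ε => Colombeau.totalDiv (fun i => P i ε)) :=
  JetNet.sum Finset.univ fun i _ => (hP i).totalD i

theorem JetNet.modNet_prolong {m : ℕ} {F : ℝ → JetInf p q → ℝ} (hF : JetNet (closure Ω) m F)
    {U : Set (Fin p → ℝ)} (hU : U ⊆ Ω) {f : ℝ → (Fin p → ℝ) → (Fin q → ℝ)}
    (hf : ModNet U (compactsIn U) (fun _ => 0) f) :
    ModNet U (compactsIn U) (fun _ => 0) (fun ε x => F ε (prolong (f ε) x)) := by
  obtain ⟨g, -, h2, h3⟩ := hF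
  exact (h2.comp_prolong hU hf).congr fun ε _ => by rw [h3]; rfl

/-- Noether's identity: up to a negligible term the product of the characteristic with the Euler
expressions is a divergence. -/
theorem exists_conserved_current (hΩ : IsOpen Ω) (hLs : ∀ ε, ContDiff ℝ ∞ (L ε))
    (hL : ModNet univ {closure Ω ×ˢ univ} (fun z => ‖z‖) L) (hξ : ∀ ε, ContDiff ℝ ∞ (ξ ε))
    (hψ : ∀ ε, ContDiff ℝ ∞ (ψ ε)) (hgen : ModNet univ {univ} (fun y => ‖y‖) (vectorField ξ ψ))
    (hint : ∀ f : ℝ → (Fin p → ℝ) → (Fin q → ℝ), ModNet univ {univ} (fun x => ‖x‖) f →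
      ∀ Ω₁, IsOpen Ω₁ → closure Ω₁ ∈ compactsIn Ω → ∀ m : ℕ, ∀ᶠ ε : ℝ in 𝓝[>] 0,
        |∫ x in Ω₁, variation (L ε) id (ξ ε) (f ε)
          (fun y => ψ ε (y, f ε y) - fderiv ℝ (f ε) y (ξ ε y)) x| ≤ ε ^ m) :
    ∃ P : Fin p → ℝ → JetInf p q → ℝ, (∀ i, JetNet (closure Ω) (2 * n) (P i)) ∧
      ∃ R : ℝ → Jet p q (2 * n + 1) → ℝ, (∀ ε, ContDiff ℝ ∞ (R ε)) ∧
        NegNet (slabsIn Ω (Fin q → MultiIndex p (2 * n + 1) → ℝ)) (fun z => ‖z.2‖) R ∧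
        ∀ ε z, totalDiv (fun i => P i ε) z = R ε (truncate (2 * n + 1) z) +
          ∑ α, characteristic (ξ ε) (ψ ε) α z * euler (L ε) α z := by
  obtain ⟨P, hP, hPR⟩ := exists_current hLs hL (X := fun i ε z => ξ ε z.1 i)
    (fun i => jetNet_base hξ hgen i) (Q := fun α ε => characteristic (ξ ε) (ψ ε) α)
    (fun α => jetNet_characteristic hξ hψ hgen α)
  have hR : JetNet (closure Ω) (2 * n + 1) (fun ε z => totalDiv (fun i => P i ε) z -
      ∑ α, characteristic (ξ ε) (ψ ε) α z * euler (L ε) α z) :=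
    (JetNet.totalDiv hP).sub (JetNet.sum _ fun α _ =>
      ((jetNet_characteristic hξ hψ hgen α).mono (by omega)).mul
        ((jetNet_euler hLs hL α).mono (by omega)))
  obtain ⟨g, h1, h2, h3⟩ := hR
  have h4 : ∀ ε z, totalDiv (fun i => P i ε) z -
      ∑ α, characteristic (ξ ε) (ψ ε) α z * euler (L ε) α z = g ε (truncate (2 * n + 1) z) :=
    fun ε => congrFun (h3 ε)
  refine ⟨P, hP, g, h1, negNet_of_moderate_points hΩ h2 fun K hK =>
    eventually_abs_le_at_moderate_points hΩ h2 (fun f hf Ω₁ hΩ₁ hcl m => ?_) hK,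
    fun ε z => by rw [← h4]; ring⟩
  filter_upwards [hint f hf Ω₁ hΩ₁ hcl m, eventually_mem_Ioc] with ε h5 hε
  -- Along any `f` the remainder is minus the variation, so the integrated symmetry condition
  -- applies to it.
  have h6 : ∀ x, variation (L ε) id (ξ ε) (f ε)
      (fun y => ψ ε (y, f ε y) - fderiv ℝ (f ε) y (ξ ε y)) x =
        -g ε (truncate (2 * n + 1) (prolong (f ε) x)) := fun x => by
    rw [← variation_eq (hLs ε) (hξ ε) (hψ ε) (contDiffOn_univ.1 (hf.smooth ε hε)), ← hPR, ← h4]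
    ring
  simpa only [h6, integral_neg, abs_neg] using h5

/-- On solutions of the Euler–Lagrange equations the divergence of the current vanishes. -/
theorem negNet_totalDiv_prolong (hLs : ∀ ε, ContDiff ℝ ∞ (L ε))
    (hL : ModNet univ {closure Ω ×ˢ univ} (fun z => ‖z‖) L) (hξ : ∀ ε, ContDiff ℝ ∞ (ξ ε))
    (hψ : ∀ ε, ContDiff ℝ ∞ (ψ ε)) (hgen : ModNet univ {univ} (fun y => ‖y‖) (vectorField ξ ψ))
    {m : ℕ} {D : ℝ → JetInf p q → ℝ} {R : ℝ → Jet p q m → ℝ} (hRs : ∀ ε, ContDiff ℝ ∞ (R ε))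
    (hR : NegNet (slabsIn Ω (Fin q → MultiIndex p m → ℝ)) (fun z => ‖z.2‖) R)
    (hD : JetNet (closure Ω) m D)
    (h : ∀ ε z, D ε z = R ε (truncate m z) +
      ∑ α, characteristic (ξ ε) (ψ ε) α z * euler (L ε) α z)
    {U : Set (Fin p → ℝ)} (hU : U ⊆ Ω) {f : ℝ → (Fin p → ℝ) → (Fin q → ℝ)}
    (hf : ModNet U (compactsIn U) (fun _ => 0) f)
    (hE : ∀ α, NegNet (compactsIn U) (fun _ => 0) (fun ε x => euler (L ε) α (prolong (f ε) x))) :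
    NegNet (compactsIn U) (fun _ => 0) (fun ε x => D ε (prolong (f ε) x)) := by
  have hF := hf.toIsFrame
  have mQ := fun α => (jetNet_characteristic hξ hψ hgen α).modNet_prolong hU hf
  have mE := fun α => (jetNet_euler hLs hL α).modNet_prolong hU hf
  have hQE := NegNet.sum hF Finset.univ (fun α _ => (mQ α).mul (mE α)) fun α _ =>
    NegNet.bilin (ContinuousLinearMap.mul ℝ ℝ) (mQ α) (mE α).smooth (hE α)
  have mQE := ModNet.sum hF Finset.univ fun α _ => (mQ α).mul (mE α)
  have hRf := NegNet.comp (fun ε _ => hRs ε) hR (hf.truncate_prolong m) fun K hK =>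
    ⟨K ×ˢ univ, ⟨K, ⟨hK.1, hK.2.trans hU⟩, rfl⟩, .of_forall fun _ _ hx => ⟨hx, mem_univ _⟩,
      ((hf.truncate_prolong m).clm_comp (ContinuousLinearMap.snd ℝ _ _)).bdd_zero hK |>.norm⟩
  have mR : ModNet U (compactsIn U) (fun _ => 0)
      (fun ε x => R ε (truncate m (prolong (f ε) x))) :=
    ((hD.modNet_prolong hU hf).sub mQE).congr fun ε _ => by ext x; rw [h]; simp
  exact (NegNet.add mR mQE hRf hQE).congr (.of_forall fun ε _ _ x _ => .of_forall fun y =>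
    (h ε _).symm)

end Conservation

/-! ### Nets smooth for every real parameter. -/

section Cutoff

open Classical in
/-- The net with the members outside `(0, 1]` replaced by zero. -/
noncomputable def cutoff {E F : Type*} [Zero F] (u : ℝ → E → F) (ε : ℝ) : E → F :=
  if ε ∈ Ioc (0 : ℝ) 1 then u ε else 0

theorem cutoff_of_mem {E F : Type*} [Zero F] {u : ℝ → E → F} {ε : ℝ} (hε : ε ∈ Ioc (0 : ℝ) 1) : cutoff u ε = u ε := if_pos hε

theorem contDiff_cutoff {E F : Type*} [NormedAddCommGroup E] [NormedSpace ℝ E]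
    [NormedAddCommGroup F] [NormedSpace ℝ F] {u : ℝ → E → F} (hu : ∀ ε ∈ Ioc (0 : ℝ) 1, ContDiff ℝ ∞ (u ε)) (ε : ℝ) :
    ContDiff ℝ ∞ (cutoff u ε) := by
  unfold cutoff
  split_ifs with h
  · exact hu ε h
  · exact contDiff_const

end Cutoff

end Colombeau

theorem mainTheorem2 (p q n : ℕ) (Ω : Set (Fin p → ℝ)) (hΩ : IsOpen Ω)
    (L : ℝ → Colombeau.Jet p q n → ℝ)
    (hL : Colombeau.MemGTau (closure Ω ×ˢ Set.univ) L)
    (Ξ : ℝ → ℝ × (Fin p → ℝ) → (Fin p → ℝ))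
    (Ψ : ℝ → ℝ × ((Fin p → ℝ) × (Fin q → ℝ)) → (Fin q → ℝ))
    (ξ : ℝ → (Fin p → ℝ) → (Fin p → ℝ))
    (ψ : ℝ → (Fin p → ℝ) × (Fin q → ℝ) → (Fin q → ℝ))
    (hcomplete : Colombeau.IsStrictlyGComplete
      (Colombeau.vectorField ξ ψ) (Colombeau.projectable Ξ Ψ))
    (hsymm : Colombeau.IsVariationalSymmetry Ω L Ξ Ψ) :
    ∃ P : ℝ → Fin p → Colombeau.Jet p q (2 * n) → ℝ,
      (∀ i, Colombeau.MemGTau (closure Ω ×ˢ Set.univ) (fun ε => P ε i)) ∧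
      Colombeau.EqGMixed Ω
        (fun ε (z : Colombeau.Jet p q (2 * n + 1)) =>
          Colombeau.totalDiv (fun i => P ε i ∘ Colombeau.truncate (2 * n)) (Colombeau.extend z))
        (fun ε z => ∑ α, Colombeau.characteristic (ξ ε) (ψ ε) α (Colombeau.extend z) *
          Colombeau.euler (L ε) α (Colombeau.extend z)) ∧
      ∀ U : Set (Fin p → ℝ), IsOpen U → U ⊆ Ω →
        ∀ f : ℝ → (Fin p → ℝ) → (Fin q → ℝ), Colombeau.MemG U f →
        (∀ α, Colombeau.EqG U
          (fun ε x => Colombeau.euler (L ε) α (Colombeau.prolong (f ε) x)) (fun _ _ => 0)) →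
        Colombeau.EqG U
          (fun ε x => Colombeau.totalDiv (fun i => P ε i ∘ Colombeau.truncate (2 * n))
            (Colombeau.prolong (f ε) x))
          (fun _ _ => 0) := by
  have hL' := Colombeau.memGTau_iff.1 hL
  have hgen := Colombeau.memGTau_iff.1 hcomplete.generator_mem
  have hflow : Colombeau.IsTemperedFlow Ξ Ψ ξ ψ :=
    ⟨by simpa only [univ_prod_univ] using
      (Colombeau.memGMixed_iff isOpen_univ).1 hcomplete.action.mem, hgen, hcomplete.action.zero,
      hcomplete.flow⟩
  have hv := fun ε hε => contDiffOn_univ.1 (hgen.smooth ε hε)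
  -- The differential-algebraic identities are stated for all real `ε`, but the data are smooth only
  -- for `ε ∈ (0, 1]`. Cutting off the other members provides smoothness throughout and changes no
  -- class.
  have cL := fun {ε : ℝ} (hε : ε ∈ Ioc (0 : ℝ) 1) => Colombeau.cutoff_of_mem (u := L) hε
  have cξ := fun {ε : ℝ} (hε : ε ∈ Ioc (0 : ℝ) 1) => Colombeau.cutoff_of_mem (u := ξ) hε
  have cψ := fun {ε : ℝ} (hε : ε ∈ Ioc (0 : ℝ) 1) => Colombeau.cutoff_of_mem (u := ψ) hε
  have sL := Colombeau.contDiff_cutoff (u := L) fun ε hε => contDiffOn_univ.1 (hL'.smooth ε hε)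
  have sξ := Colombeau.contDiff_cutoff (u := ξ) fun ε hε =>
    contDiffOn_univ.1 (hflow.modNet_generator.smooth ε hε)
  have sψ := Colombeau.contDiff_cutoff (u := ψ) fun ε hε => contDiff_snd.comp (hv ε hε)
  have mL := hL'.congr fun ε hε => (cL hε).symm
  have mv : Colombeau.ModNet univ {univ} (fun y => ‖y‖)
      (Colombeau.vectorField (Colombeau.cutoff ξ) (Colombeau.cutoff ψ)) :=
    hgen.congr fun ε hε => funext fun y => by
      simp only [Colombeau.vectorField, cξ hε, cψ hε]
  obtain ⟨P, hP, R, hRs, hR, hPR⟩ := Colombeau.exists_conserved_current hΩ sL mL sξ sψ mv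
    fun f hf Ω₁ hΩ₁ hcl m => by
      filter_upwards [hsymm.small_integral hflow hΩ hL' hf hΩ₁ hcl m,
        Colombeau.eventually_mem_Ioc] with ε h1 hε
      simpa only [cL hε, cξ hε, cψ hε] using h1
  choose g hg1 hg2 hg3 using hP
  have hdiv : ∀ ε, Colombeau.totalDiv (fun i => g i ε ∘ Colombeau.truncate (2 * n)) =
      Colombeau.totalDiv (fun i => P i ε) := fun ε => by simp only [hg3]
  refine ⟨fun ε i => g i ε, fun i => Colombeau.memGTau_iff.2 (hg2 i), ?_, fun U hU hUΩ f hf hE => ?_⟩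
  · refine Colombeau.eqGMixed_iff.2 (hR.congr ?_)
    filter_upwards [Colombeau.eventually_mem_Ioc] with ε hε _ _ z _
    refine .of_forall fun z => ?_
    simp only [hdiv, hPR, cL hε, cξ hε, cψ hε, Colombeau.truncate_extend, add_sub_cancel_right]
  · refine Colombeau.eqG_iff.2 ?_
    simp only [hdiv, sub_zero]
    refine Colombeau.negNet_totalDiv_prolong sL mL sξ sψ mv hRs hR (Colombeau.JetNet.totalDiv
      fun i => ⟨g i, hg1 i, hg2 i, hg3 i⟩) hPR hUΩ ((Colombeau.memG_iff hU).1 hf) fun α => ?_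
    refine (Colombeau.eqG_iff.1 (hE α)).congr ?_
    filter_upwards [Colombeau.eventually_mem_Ioc] with ε hε _ _ x _
    exact .of_forall fun y => by rw [cL hε]; exact sub_zero _
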